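/- Let $Q_0,Q_1$ be real polynomials in three variables, $Q_0$ without constant term and $Q_1$ without constant and linear terms, and consider real-valued solutions of $$\partial_t u-\partial_x^5u+Q_0(u,\partial_xu,\partial_x^2u)\,\partial_x^3u+Q_1(u,\partial_xu,\partial_x^2u)=0,\qquad x\in\mathbb R,\ t\in[0,T].$$ Write $\langle x\rangle=(1+x^2)^{1/2}$, $x_+=\max\{x,0\}$. Let $a_0>0$, $0<\epsilon<1$, and $$a(t)=\frac{a_0}{\sqrt[4]{1+k\,a_0^4\,t}},\qquad k=k(\epsilon)=\frac{5^5}{4^5}\Big(\frac32+\frac{25}{4(5-\epsilon)}\Big).$$ Let $T>0$, let $u_1,u_2\in C([0,T]:H^{10}(\mathbb R)\cap L^2(\langle x\rangle^4dx))$ be solutions (in the sense of distributions) such that $$\Lambda\equiv\int_{-\infty}^{\infty} e^{a_0x_+^{5/4}}|u_1(x,0)-u_2(x,0)|^2\,dx<\infty .$$ Then there is a finite constant $c^{**}$ with $$\sup_{t\in[0,T]}\int_{-\infty}^{\infty} e^{a(t)x_+^{5/4}}|u_1(x,t)-u_2(x,t)|^2\,dx\le c^{**}.$$ Here, with $S(t)=\sum_{j=1}^2\big(\|u_j(\cdot,t)\|_{H^{10}}+\|x^2u_j(\cdot,t)\|_{L^2}\big)$: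 1. (Local existence time.) There is a function $R\mapsto\tau(R)>0$, depending only on $Q_0,Q_1$, such that if $S(0)\le R$ and $T\le\tau(R)$, then $c^{**}$ can be chosen depending only on $Q_0,Q_1,a_0,\epsilon,T$ and on upper bounds for $S(0)$ and $\Lambda$. 2. (Arbitrary interval of existence.) For every $T>0$, $c^{**}$ can be chosen depending only on $Q_0,Q_1,a_0,\epsilon,T$ and on upper bounds for $\sup_{[0,T]}S(t)$ and $\Lambda$. -/

import Mathlib

open MeasureTheory Set Filter Topology
open scoped ENNReal NNReal ContDiff

noncomputable section

namespace FifthOrder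

/-- Test functions on the real line: smooth with compact support. -/
def IsTest (ψ : ℝ → ℝ) : Prop :=
  ContDiff ℝ ∞ ψ ∧ HasCompactSupport ψ

/-- `g` is the `k`-th weak derivative of `f` on the real line. -/
def IsWeakDeriv (k : ℕ) (f g : ℝ → ℝ) : Prop :=
  LocallyIntegrable f volume ∧ LocallyIntegrable g volume ∧
    ∀ ψ : ℝ → ℝ, IsTest ψ →
      ∫ x, f x * iteratedDeriv k ψ x = (-1 : ℝ) ^ k * ∫ x, g x * ψ x

open Classical in
/-- A representative of the `k`-th weak derivative of `f` (unique up to null sets); it is `0` by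
convention if `f` has no `k`-th weak derivative. -/
def weakDeriv (k : ℕ) (f : ℝ → ℝ) : ℝ → ℝ :=
  if h : ∃ g, IsWeakDeriv k f g then h.choose else 0

/-- Membership in the Sobolev space `H^k(ℝ)` of real-valued functions. -/
def MemH (k : ℕ) (f : ℝ → ℝ) : Prop :=
  ∀ j ≤ k, ∃ g : ℝ → ℝ, IsWeakDeriv j f g ∧ MemLp g 2 volume

/-- The norm of `H^k(ℝ)`: the square root of the sum over `j ≤ k` of the squares of the `L²` norms
of the weak derivatives of order `j`. (Used for functions in `H^k(ℝ)` only.) -/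
def hNorm (k : ℕ) (f : ℝ → ℝ) : ℝ≥0∞ :=
  (∑ j ∈ Finset.range (k + 1), eLpNorm (weakDeriv j f) 2 volume ^ 2) ^ (1 / 2 : ℝ)

/-- The bracket `⟨x⟩ = (1 + x²)^{1/2}`. -/
def bracket (x : ℝ) : ℝ := Real.sqrt (1 + x ^ 2)

/-- Membership in `H^{10}(ℝ) ∩ L²(⟨x⟩⁴ dx)`. -/
def MemX (f : ℝ → ℝ) : Prop :=
  MemH 10 f ∧ MemLp (fun x => bracket x ^ 2 * f x) 2 volume

/-- The norm of `H^{10}(ℝ) ∩ L²(⟨x⟩⁴ dx)`. -/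
def xNorm (f : ℝ → ℝ) : ℝ≥0∞ :=
  hNorm 10 f + eLpNorm (fun x => bracket x ^ 2 * f x) 2 volume

/-- `u ∈ C([0,T] : H^{10}(ℝ) ∩ L²(⟨x⟩⁴ dx))`; here `u t` is the function `x ↦ u(x,t)`. -/
def InClass (T : ℝ) (u : ℝ → ℝ → ℝ) : Prop :=
  (∀ t ∈ Icc 0 T, MemX (u t)) ∧
    ∀ t ∈ Icc 0 T,
      Tendsto (fun s => xNorm (fun x => u s x - u t x)) (𝓝[Icc 0 T] t) (𝓝 0)

/-- The nonlinearity `Q₀(f, ∂f, ∂²f) ∂³f + Q₁(f, ∂f, ∂²f)`. -/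
def nonlinearity (Q₀ Q₁ : MvPolynomial (Fin 3) ℝ) (f : ℝ → ℝ) (x : ℝ) : ℝ :=
  MvPolynomial.eval ![f x, weakDeriv 1 f x, weakDeriv 2 f x] Q₀ * weakDeriv 3 f x +
    MvPolynomial.eval ![f x, weakDeriv 1 f x, weakDeriv 2 f x] Q₁

/-- `u` is a solution on `[0,T]`, in the class `C([0,T] : H^{10}(ℝ) ∩ L²(⟨x⟩⁴ dx))`, of
`∂ₜu - ∂ₓ⁵u + Q₀(u, ∂ₓu, ∂ₓ²u) ∂ₓ³u + Q₁(u, ∂ₓu, ∂ₓ²u) = 0`,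
the equation being understood in the sense of distributions in `x`. -/
def IsSolution (Q₀ Q₁ : MvPolynomial (Fin 3) ℝ) (T : ℝ) (u : ℝ → ℝ → ℝ) : Prop :=
  InClass T u ∧
    ∀ ψ : ℝ → ℝ, IsTest ψ → ∀ t ∈ Icc 0 T,
      HasDerivWithinAt (fun s => ∫ x, u s x * ψ x)
        (∫ x, (weakDeriv 5 (u t) x - nonlinearity Q₀ Q₁ (u t) x) * ψ x) (Icc 0 T) t

/-- The size `∑_{j=1,2} (‖f_j‖_{H^{10}} + ‖x² f_j‖_{L²})` of a pair of functions. -/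
def pairSize (f₁ f₂ : ℝ → ℝ) : ℝ≥0∞ :=
  (hNorm 10 f₁ + eLpNorm (fun x => x ^ 2 * f₁ x) 2 volume) +
    (hNorm 10 f₂ + eLpNorm (fun x => x ^ 2 * f₂ x) 2 volume)

/-- `∫ e^{a x₊^{5/4}} |f(x)|² dx`, with values in `[0,∞]`. -/
def expWeighted (a : ℝ) (f : ℝ → ℝ) : ℝ≥0∞ :=
  ∫⁻ x, ENNReal.ofReal (Real.exp (a * (max x 0) ^ (5 / 4 : ℝ)) * |f x| ^ 2)

/-- `k(ε) = (5⁵/4⁵) (3/2 + 25/(4(5-ε)))`. -/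
def kConst (ε : ℝ) : ℝ := 5 ^ 5 / 4 ^ 5 * (3 / 2 + 25 / (4 * (5 - ε)))

/-- `a(t) = a₀ / (1 + k(ε) a₀⁴ t)^{1/4}`. -/
def aRate (a₀ ε t : ℝ) : ℝ := a₀ / (1 + kConst ε * a₀ ^ 4 * t) ^ (1 / 4 : ℝ)

end FifthOrder

end

/-! Write `w = u₁ - u₂`, `Z = w`, `Y = ∂w`, `X = ∂²w`, and consider `∫ φ w²` with `φ = exp (a(t)
p)`, where `p` is a smooth bounded approximation of `x₊^{5/4}`. Put `b = a p'`. To leading order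
`φ^(k)` is `φ b^k`, so the fifth-order term contributes `φ (-5 b X² + 5 b³ Y² - b⁵ Z²)`, while
differentiation of the weight in time contributes `a' p φ Z²`. Since the fifth power of `(x^{5/4})'`
is `(5/4)⁵ x^{5/4}`, one has `p'⁵ ≤ (5/4)⁵ p` (`qW_pow_five_le`), and `a' = -(k/4) a⁵` makes the
last contribution at most `-(11/16) b⁵ φ Z²`. Subtracting the exact derivatives `5 (φ b² Y²)'` and
`5 (φ b³ Y Z)'`, the leading part becomes `-5 b (X + b Y + b² Z / 2)² - (11/16 - 1/4) b⁵ Z²`; a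
small change of the multipliers makes it negative definite in all three variables
(`principal_form_le`). The lower-order terms are absorbed as follows: a large multiple of `(φ b Y
Z)'` supplies `-b Y²`, and `b^j Z²` with `j ≤ 4` is bounded by a small multiple of `b⁵ Z²` plus a
constant multiple of `Z²`, which Gronwall's inequality takes care of (`exists_pointwise_bound`,
`exists_exponential_energy_bound`).

The nonlinearity contributes `c ∂³w` with `c = Q₀(u₁, ∂u₁, ∂²u₁)`, and the gain `b X²` can only pay
for it if `φ |c|` is bounded by a multiple of `φ b + 1`. Interpolation between `∫ ⟨x⟩⁴ u²` and `∫
(∂⁸u)²` gives `|∂^j u| ≤ C ⟨x⟩^{-9/8}` for `j ≤ 3` (`exists_decayBound`). The assumptions on the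
low-degree terms of `Q₀` and `Q₁` transfer this decay to `c` and to the other coefficients. The
approximations `pW δ` are designed so that their derivatives dominate `⟨x⟩^{-9/8}` on the right
half-line uniformly in `δ` (`decay_le_qW`), and on the left half-line `φ` is bounded.

Thus the constants depend on the solutions only through bounds of `∫ ⟨x⟩⁴ u²` and `∫ (∂⁸u)²`. On an
arbitrary interval these are assumed. On a short interval they follow from the data:
`exists_growth_bound` shows that both quantities grow at most linearly as long as they are bounded,
up to a factor two in the second, and a continuity argument concludes (`exists_local_bound`). In the
estimate of order eight the loss of derivatives is compensated by a local smoothing effect: a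
bounded increasing weight `φ` yields `-5 ∫ φ' (∂¹⁰u)²`, and `φ'` dominates the decaying
coefficients.

All computations are made for mollified solutions, which are smooth. They satisfy the equation up to
an error which, thanks to the regularity `H^{10}`, is `O(1/n)` in `L²` with its first six
derivatives (`Controlled.exists_mollError_bound`). The mollification is removed first, then the
truncation `δ`, the latter by Fatou's lemma. -/

noncomputable section

namespace FifthOrder

/-! ### Bounded coefficients, square integrable derivatives and integration by parts. -/

/-- A continuous bounded function. -/
def BddCont (κ : ℝ → ℝ) : Prop := Continuous κ ∧ ∃ C, ∀ x, |κ x| ≤ C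

/-- A smooth function with its successive derivatives, all of them square integrable. -/
structure L2Tower (V : ℕ → ℝ → ℝ) : Prop where
  hasDerivAt : ∀ k x, HasDerivAt (V k) (V (k + 1) x) x
  memLp : ∀ k, MemLp (V k) 2 volume

/-- The first derivatives, up to order `n`, of a function, all of them bounded. -/
structure BddTower (n : ℕ) (φ : ℕ → ℝ → ℝ) : Prop where
  hasDerivAt : ∀ k < n, ∀ x, HasDerivAt (φ k) (φ (k + 1) x) x
  bddCont : ∀ k ≤ n, BddCont (φ k)

lemma BddCont.mul {κ ν : ℝ → ℝ} (h : BddCont κ) (h' : BddCont ν) :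
    BddCont (fun x => κ x * ν x) := by
  obtain ⟨hc, C, hC⟩ := h
  obtain ⟨hc', C', hC'⟩ := h'
  refine ⟨hc.mul hc', C * C', fun x => ?_⟩
  rw [abs_mul]
  exact mul_le_mul (hC x) (hC' x) (abs_nonneg _) ((abs_nonneg _).trans (hC x))

lemma BddCont.add {κ ν : ℝ → ℝ} (h : BddCont κ) (h' : BddCont ν) :
    BddCont (fun x => κ x + ν x) := by
  obtain ⟨hc, C, hC⟩ := h
  obtain ⟨hc', C', hC'⟩ := h'
  exact ⟨hc.add hc', C + C', fun x => (abs_add_le _ _).trans (add_le_add (hC x) (hC' x))⟩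

lemma BddCont.const (c : ℝ) : BddCont (fun _ => c) := ⟨continuous_const, |c|, fun _ => le_rfl⟩

lemma BddCont.const_mul {κ : ℝ → ℝ} (c : ℝ) (h : BddCont κ) : BddCont (fun x => c * κ x) :=
  (BddCont.const c).mul h

lemma BddCont.memLp_mul {κ f : ℝ → ℝ} (h : BddCont κ) (hf : MemLp f 2 volume) :
    MemLp (fun x => κ x * f x) 2 volume := by
  obtain ⟨hc, C, hC⟩ := h
  refine MemLp.of_le (hf.const_mul C) (hc.aestronglyMeasurable.mul hf.1) (ae_of_all _ fun x => ?_)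
  simp only [norm_mul, Real.norm_eq_abs]
  exact mul_le_mul_of_nonneg_right ((hC x).trans (le_abs_self C)) (abs_nonneg _)

lemma BddCont.integrable_mul_mul {κ f g : ℝ → ℝ} (h : BddCont κ) (hf : MemLp f 2 volume)
    (hg : MemLp g 2 volume) : Integrable (fun x => κ x * f x * g x) :=
  (h.memLp_mul hf).integrable_mul hg

lemma integrable_mul_of_memLp {f g : ℝ → ℝ} (hf : MemLp f 2 volume)
    (hg : MemLp g 2 volume) : Integrable (fun x => f x * g x) :=
  hf.integrable_mul hg

lemma BddCont.integrable_mul_sq {κ f : ℝ → ℝ} (h : BddCont κ) (hf : MemLp f 2 volume) :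
    Integrable (fun x => κ x * f x ^ 2) := by
  simpa only [pow_two, mul_assoc] using h.integrable_mul_mul hf hf

lemma continuous_of_forall_hasDerivAt {f f' : ℝ → ℝ} (h : ∀ x, HasDerivAt f (f' x) x) :
    Continuous f :=
  continuous_iff_continuousAt.2 fun x => (h x).continuousAt

lemma L2Tower.continuous {V : ℕ → ℝ → ℝ} (hV : L2Tower V) (k : ℕ) : Continuous (V k) :=
  continuous_of_forall_hasDerivAt (hV.hasDerivAt k)

lemma L2Tower.sub {V W : ℕ → ℝ → ℝ} (hV : L2Tower V) (hW : L2Tower W) :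
    L2Tower (fun k x => V k x - W k x) :=
  ⟨fun k x => (hV.hasDerivAt k x).sub (hW.hasDerivAt k x), fun k => (hV.memLp k).sub (hW.memLp k)⟩

lemma L2Tower.integrable_sq {V : ℕ → ℝ → ℝ} (hV : L2Tower V) (k : ℕ) :
    Integrable (fun x => V k x ^ 2) :=
  (hV.memLp k).integrable_sq

/-- A function that is integrable with its derivative is bounded by the integral of the latter. -/
lemma abs_le_integral_abs_deriv {F F' : ℝ → ℝ} (h : ∀ x, HasDerivAt F (F' x) x)
    (hF : Integrable F) (hF' : Integrable F') (x : ℝ) : |F x| ≤ ∫ y, |F' y| := by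
  have h0 : Tendsto F atBot (𝓝 0) :=
    tendsto_zero_of_hasDerivAt_of_integrableOn_Iic (a := x) (fun y _ => h y)
      hF'.integrableOn hF.integrableOn
  have h1 : ∫ y in Iic x, F' y = F x - 0 :=
    integral_Iic_of_hasDerivAt_of_tendsto' (fun y _ => h y) hF'.integrableOn h0
  rw [sub_zero] at h1
  rw [← h1]
  calc |∫ y in Iic x, F' y| ≤ ∫ y in Iic x, |F' y| := abs_integral_le_integral_abs
    _ ≤ ∫ y, |F' y| := setIntegral_le_integral hF'.abs (ae_of_all _ fun y => abs_nonneg _)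

lemma sq_le_integral_sq_add {f f' : ℝ → ℝ} (h : ∀ x, HasDerivAt f (f' x) x)
    (hf : MemLp f 2 volume) (hf' : MemLp f' 2 volume) (x : ℝ) :
    f x ^ 2 ≤ (∫ y, f y ^ 2) + ∫ y, f' y ^ 2 := by
  have hd : ∀ x, HasDerivAt (fun x => f x ^ 2) (2 * (f x * f' x)) x := fun x =>
    ((h x).fun_pow 2).congr_deriv (by norm_num; ring)
  have := abs_le_integral_abs_deriv hd hf.integrable_sq
    ((integrable_mul_of_memLp hf hf').const_mul 2) x
  rw [abs_of_nonneg (sq_nonneg _)] at this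
  refine this.trans ?_
  rw [← integral_add hf.integrable_sq hf'.integrable_sq]
  refine integral_mono (((integrable_mul_of_memLp hf hf').const_mul 2).abs)
    (hf.integrable_sq.add hf'.integrable_sq) fun y => ?_
  change |2 * (f y * f' y)| ≤ f y ^ 2 + f' y ^ 2
  rw [abs_mul, abs_mul, abs_two]
  nlinarith [sq_nonneg (|f y| - |f' y|), sq_abs (f y), sq_abs (f' y)]

/-- The one-dimensional Sobolev embedding. It allows each derivative to serve as a coefficient in
the integrations by parts. -/
lemma L2Tower.bddCont {V : ℕ → ℝ → ℝ} (hV : L2Tower V) (k : ℕ) : BddCont (V k) :=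
  ⟨hV.continuous k, _, fun x => Real.abs_le_sqrt
    (sq_le_integral_sq_add (hV.hasDerivAt k) (hV.memLp k) (hV.memLp (k + 1)) x)⟩

/-- The integral of the derivative of `κ f g` vanishes. -/
lemma integral_deriv_mul_mul {κ κ' f f' g g' : ℝ → ℝ} (dκ : ∀ x, HasDerivAt κ (κ' x) x)
    (df : ∀ x, HasDerivAt f (f' x) x) (dg : ∀ x, HasDerivAt g (g' x) x)
    (hκ : BddCont κ) (hκ' : BddCont κ') (hf : MemLp f 2 volume) (hf' : MemLp f' 2 volume)
    (hg : MemLp g 2 volume) (hg' : MemLp g' 2 volume) :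
    (∫ x, κ' x * f x * g x) + (∫ x, κ x * f' x * g x) + (∫ x, κ x * f x * g' x) = 0 := by
  have i1 := hκ'.integrable_mul_mul hf hg
  have i2 := hκ.integrable_mul_mul hf' hg
  have i3 := hκ.integrable_mul_mul hf hg'
  have i12 : Integrable (fun x => κ' x * f x * g x + κ x * f' x * g x) := i1.add i2
  rw [← integral_add i1 i2, ← integral_add i12 i3]
  refine integral_eq_zero_of_hasDerivAt_of_integrable (f := fun x => κ x * f x * g x)
    (fun x => ?_) (i12.add i3) (hκ.integrable_mul_mul hf hg)
  exact (((dκ x).fun_mul (df x)).fun_mul (dg x)).congr_deriv (by ring)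

lemma integral_mul_mul_comm (κ f g : ℝ → ℝ) :
    ∫ x, κ x * f x * g x = ∫ x, κ x * g x * f x := by
  congr 1; ext x; ring

section IntegrationByParts

variable {V : ℕ → ℝ → ℝ} {φ : ℕ → ℝ → ℝ} {n : ℕ}

/-- The identities that follow are linear combinations of instances of this one, up to the symmetry
of the integrand. -/
lemma L2Tower.integral_relation (hV : L2Tower V) (hφ : BddTower n φ) {k : ℕ} (hk : k < n)
    (i j : ℕ) :
    (∫ x, φ (k + 1) x * V i x * V j x) + (∫ x, φ k x * V (i + 1) x * V j x) +
      (∫ x, φ k x * V i x * V (j + 1) x) = 0 :=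
  integral_deriv_mul_mul (hφ.hasDerivAt k hk) (hV.hasDerivAt i) (hV.hasDerivAt j)
    (hφ.bddCont k hk.le) (hφ.bddCont (k + 1) hk) (hV.memLp i) (hV.memLp _) (hV.memLp j)
    (hV.memLp _)

lemma L2Tower.integral_mul_one (hV : L2Tower V) (hφ : BddTower n φ) (hn : 1 ≤ n) (j : ℕ) :
    ∫ x, φ 0 x * V j x * V (j + 1) x = -(1 / 2) * ∫ x, φ 1 x * V j x * V j x := by
  have h := hV.integral_relation hφ (k := 0) (by lia) j j
  rw [integral_mul_mul_comm (φ 0) (V (j + 1)) (V j)] at h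
  simp only [zero_add] at h
  linarith

lemma BddTower.shift (hφ : BddTower (n + 1) φ) : BddTower n (fun k => φ (k + 1)) :=
  ⟨fun k hk => hφ.hasDerivAt (k + 1) (by lia), fun k hk => hφ.bddCont (k + 1) (by lia)⟩

lemma BddTower.mono (hφ : BddTower n φ) {l : ℕ} (hl : l ≤ n) : BddTower l φ :=
  ⟨fun k hk => hφ.hasDerivAt k (by lia), fun k hk => hφ.bddCont k (by lia)⟩

lemma L2Tower.integral_mul_two (hV : L2Tower V) (hφ : BddTower n φ) (hn : 2 ≤ n) (j : ℕ) :
    ∫ x, φ 0 x * V j x * V (j + 2) x =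
      -(∫ x, φ 0 x * V (j + 1) x * V (j + 1) x) + 1 / 2 * ∫ x, φ 2 x * V j x * V j x := by
  have h := hV.integral_relation hφ (k := 0) (by lia) j (j + 1)
  have h1 := hV.integral_mul_one (hφ.mono hn).shift le_rfl j
  simp only [zero_add, Nat.reduceAdd, add_assoc] at h h1
  linarith

lemma L2Tower.integral_mul_three (hV : L2Tower V) (hφ : BddTower n φ) (hn : 3 ≤ n) (j : ℕ) :
    ∫ x, φ 0 x * V j x * V (j + 3) x =
      3 / 2 * (∫ x, φ 1 x * V (j + 1) x * V (j + 1) x) -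
        1 / 2 * ∫ x, φ 3 x * V j x * V j x := by
  have h := hV.integral_relation hφ (k := 0) (by lia) j (j + 2)
  have h1 := hV.integral_mul_two (hφ.mono hn).shift le_rfl j
  have h2 := hV.integral_mul_one hφ (by lia) (j + 1)
  simp only [zero_add, Nat.reduceAdd, add_assoc] at h h1 h2
  linarith

/-- The energy identity of the fifth-order linear flow. -/
lemma L2Tower.integral_mul_five (hV : L2Tower V) (hφ : BddTower n φ) (hn : 5 ≤ n) (j : ℕ) :
    2 * ∫ x, φ 0 x * V j x * V (j + 5) x =
      -5 * (∫ x, φ 1 x * V (j + 2) x * V (j + 2) x) +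
        5 * (∫ x, φ 3 x * V (j + 1) x * V (j + 1) x) - ∫ x, φ 5 x * V j x * V j x := by
  -- One derivative is moved off the factor of order `j + 5`. Of the two integrals that appear, the
  -- one with `φ 0` is of the three-derivative type; the one with `φ 1` is split once more into the
  -- two- and three-derivative types.
  have h := hV.integral_relation hφ (k := 0) (by lia) j (j + 4)
  have h1 := hV.integral_mul_three hφ (by lia) (j + 1)
  have h' := hV.integral_relation hφ (k := 1) (by lia) j (j + 3)
  have h2 := hV.integral_mul_two (hφ.mono hn).shift (by lia) (j + 1)
  have h3 := hV.integral_mul_three (hφ.mono hn).shift.shift le_rfl j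
  simp only [zero_add, Nat.reduceAdd, add_assoc] at h h1 h2 h3 h'
  linarith

end IntegrationByParts

/-! ### Differential polynomials and the count of derivatives. -/

/-- The value of the differential monomial `∏_{i ∈ l} ∂^i v`. -/
def monEval (V : ℕ → ℝ → ℝ) (l : List ℕ) (x : ℝ) : ℝ := (l.map fun i => V i x).prod

/-- The monomials of the derivative of a differential monomial. -/
def monDeriv : List ℕ → List (List ℕ)
  | [] => []
  | i :: l => ((i + 1) :: l) :: (monDeriv l).map (i :: ·)

/-- The total order of a differential monomial in excess of two derivatives per factor. -/
def excess (l : List ℕ) : ℕ := (l.map (· - 2)).sum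

/-- Differential polynomials, as lists of monomials with coefficients. -/
abbrev DiffPoly := List (ℝ × List ℕ)

/-- The value of a differential polynomial. -/
def DiffPoly.eval (V : ℕ → ℝ → ℝ) (P : DiffPoly) (x : ℝ) : ℝ :=
  (P.map fun p => p.1 * monEval V p.2 x).sum

/-- The total derivative of a differential polynomial. -/
def DiffPoly.D (P : DiffPoly) : DiffPoly := P.flatMap fun p => (monDeriv p.2).map (p.1, ·)

/-- The bound of a differential polynomial in which all derivatives are bounded by `C`. -/
def DiffPoly.bound (C : ℝ) (P : DiffPoly) : ℝ := (P.map fun p => |p.1| * C ^ p.2.length).sum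

variable {V W : ℕ → ℝ → ℝ} {x : ℝ}

@[simp] lemma monEval_nil : monEval V [] x = 1 := rfl

@[simp] lemma monEval_cons (i : ℕ) (l : List ℕ) :
    monEval V (i :: l) x = V i x * monEval V l x := by
  simp [monEval]

lemma monEval_erase {j : ℕ} {l : List ℕ} (h : j ∈ l) :
    monEval V l x = V j x * monEval V (l.erase j) x := by
  rw [← monEval_cons]
  exact ((List.perm_cons_erase h).map _).prod_eq

@[simp] lemma DiffPoly.eval_nil : DiffPoly.eval V [] x = 0 := rfl

@[simp] lemma DiffPoly.eval_cons (p : ℝ × List ℕ) (P : DiffPoly) :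
    DiffPoly.eval V (p :: P) x = p.1 * monEval V p.2 x + DiffPoly.eval V P x := by
  simp [DiffPoly.eval]

lemma DiffPoly.eval_append (P P' : DiffPoly) :
    DiffPoly.eval V (P ++ P') x = DiffPoly.eval V P x + DiffPoly.eval V P' x := by
  simp [DiffPoly.eval]

lemma hasDerivAt_monEval (h : ∀ i x, HasDerivAt (V i) (V (i + 1) x) x) (l : List ℕ) (x : ℝ) :
    HasDerivAt (monEval V l) (((monDeriv l).map fun l' => monEval V l' x).sum) x := by
  induction l with
  | nil => exact hasDerivAt_const x (1 : ℝ)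
  | cons i l ih =>
    have h1 : monEval V (i :: l) = fun x => V i x * monEval V l x := by
      ext y; simp
    rw [h1]
    refine ((h i x).fun_mul ih).congr_deriv ?_
    simp [monDeriv, List.map_map, Function.comp_def, List.sum_map_mul_left]

lemma DiffPoly.hasDerivAt_eval (h : ∀ i x, HasDerivAt (V i) (V (i + 1) x) x) (P : DiffPoly)
    (x : ℝ) : HasDerivAt (DiffPoly.eval V P) (DiffPoly.eval V P.D x) x := by
  induction P with
  | nil => exact hasDerivAt_const x (0 : ℝ)
  | cons p P ih =>
    have h1 : DiffPoly.eval V (p :: P) = fun x => p.1 * monEval V p.2 x + DiffPoly.eval V P x := by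
      ext y; simp
    rw [h1]
    refine (((hasDerivAt_monEval h p.2 x).const_mul p.1).fun_add ih).congr_deriv ?_
    have h2 : DiffPoly.D (p :: P) = (monDeriv p.2).map (p.1, ·) ++ DiffPoly.D P := by
      simp [DiffPoly.D]
    rw [h2, DiffPoly.eval_append]
    congr 1
    simp [DiffPoly.eval, List.map_map, Function.comp_def, List.sum_map_mul_left]

lemma hasDerivAt_eval_iterate (h : ∀ i x, HasDerivAt (V i) (V (i + 1) x) x) (P : DiffPoly)
    (k : ℕ) (x : ℝ) :
    HasDerivAt (DiffPoly.eval V (DiffPoly.D^[k] P)) (DiffPoly.eval V (DiffPoly.D^[k + 1] P) x) x := by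
  rw [Function.iterate_succ_apply']
  exact DiffPoly.hasDerivAt_eval h _ x

lemma excess_cons (i : ℕ) (l : List ℕ) : excess (i :: l) = (i - 2) + excess l := by
  simp [excess]

lemma le_excess {i : ℕ} {l : List ℕ} (h : i ∈ l) : i - 2 ≤ excess l :=
  List.le_sum_of_mem (List.mem_map_of_mem (f := (· - 2)) h)

lemma excess_erase {j : ℕ} {l : List ℕ} (h : j ∈ l) : excess l = (j - 2) + excess (l.erase j) := by
  rw [← excess_cons]
  exact ((List.perm_cons_erase h).map _).sum_eq

lemma length_of_mem_monDeriv {l l' : List ℕ} (h : l' ∈ monDeriv l) : l'.length = l.length := by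
  induction l generalizing l' with
  | nil => simp [monDeriv] at h
  | cons i l ih =>
    rcases List.mem_cons.1 h with rfl | h
    · simp
    · obtain ⟨l'', h', rfl⟩ := List.mem_map.1 h
      simp [ih h']

/-- A derivative falls on a single factor. As the nonlinearity has excess at most one, its eighth
derivative has excess at most nine, which is what prevents two factors of high order from occurring
together. -/
lemma excess_of_mem_monDeriv {l l' : List ℕ} (h : l' ∈ monDeriv l) :
    excess l' ≤ excess l + 1 := by
  induction l generalizing l' with
  | nil => simp [monDeriv] at h
  | cons i l ih =>
    rcases List.mem_cons.1 h with rfl | h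
    · simp only [excess_cons]; lia
    · obtain ⟨l'', h', rfl⟩ := List.mem_map.1 h
      have := ih h'
      simp only [excess_cons]; lia

lemma le_of_mem_monDeriv {l l' : List ℕ} (h : l' ∈ monDeriv l) {N : ℕ} (hN : ∀ i ∈ l, i ≤ N) :
    ∀ i ∈ l', i ≤ N + 1 := by
  induction l generalizing l' with
  | nil => simp [monDeriv] at h
  | cons i l ih =>
    simp only [List.mem_cons, forall_eq_or_imp] at hN
    rcases List.mem_cons.1 h with rfl | h
    · simp only [List.mem_cons, forall_eq_or_imp]
      exact ⟨by lia, fun j hj => (hN.2 j hj).trans (by lia)⟩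
    · obtain ⟨l'', h', rfl⟩ := List.mem_map.1 h
      simp only [List.mem_cons, forall_eq_or_imp]
      exact ⟨by lia, ih h' hN.2⟩

lemma DiffPoly.exists_of_mem_D {P : DiffPoly} {q : ℝ × List ℕ} (h : q ∈ P.D) :
    ∃ p ∈ P, q.2 ∈ monDeriv p.2 := by
  obtain ⟨p, hp, h⟩ := List.mem_flatMap.1 h
  obtain ⟨l, hl, rfl⟩ := List.mem_map.1 h
  exact ⟨p, hp, hl⟩

lemma DiffPoly.of_mem_iterate_D {P : DiffPoly} {a b N : ℕ} (h : ∀ p ∈ P, a ≤ p.2.length ∧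
    excess p.2 ≤ b ∧ ∀ i ∈ p.2, i ≤ N) (k : ℕ) :
    ∀ p ∈ DiffPoly.D^[k] P, a ≤ p.2.length ∧ excess p.2 ≤ b + k ∧ ∀ i ∈ p.2, i ≤ N + k := by
  induction k with
  | zero => simpa using h
  | succ k ih =>
    intro q hq
    rw [Function.iterate_succ_apply'] at hq
    obtain ⟨p, hp, hm⟩ := DiffPoly.exists_of_mem_D hq
    obtain ⟨h1, h2, h3⟩ := ih p hp
    refine ⟨(length_of_mem_monDeriv hm).symm ▸ h1, (excess_of_mem_monDeriv hm).trans (by lia),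
      le_of_mem_monDeriv hm h3⟩

lemma DiffPoly.bound_nonneg {C : ℝ} (hC : 0 ≤ C) (P : DiffPoly) : 0 ≤ P.bound C :=
  List.sum_nonneg fun y hy => by
    obtain ⟨p, -, rfl⟩ := List.mem_map.1 hy
    positivity

lemma abs_monEval_le {C : ℝ} {l : List ℕ} (h : ∀ i ∈ l, |V i x| ≤ C) :
    |monEval V l x| ≤ C ^ l.length := by
  induction l with
  | nil => simp
  | cons i l ih =>
    simp only [List.mem_cons, forall_eq_or_imp] at h
    rw [monEval_cons, abs_mul, List.length_cons, pow_succ']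
    exact mul_le_mul h.1 (ih h.2) (abs_nonneg _) ((abs_nonneg _).trans h.1)

/-- One factor supplies the decay `θ`; for the others `θ ≤ 1` is enough. -/
lemma abs_monEval_le_mul {C θ : ℝ} (hC : 0 ≤ C) (hθ : θ ≤ 1) {l : List ℕ}
    (hl : 1 ≤ l.length) (h : ∀ i ∈ l, |V i x| ≤ C * θ) :
    |monEval V l x| ≤ C ^ l.length * θ := by
  cases l with
  | nil => simp at hl
  | cons i l =>
    simp only [List.mem_cons, forall_eq_or_imp] at h
    have h2 : |monEval V l x| ≤ C ^ l.length := abs_monEval_le fun i hi =>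
      (h.2 i hi).trans (mul_le_of_le_one_right hC hθ)
    rw [monEval_cons, abs_mul, List.length_cons, pow_succ', mul_right_comm]
    exact mul_le_mul h.1 h2 (abs_nonneg _) ((abs_nonneg _).trans h.1)

lemma DiffPoly.abs_eval_le {P : DiffPoly} {b : ℝ × List ℕ → ℝ}
    (h : ∀ p ∈ P, |monEval V p.2 x| ≤ b p) :
    |DiffPoly.eval V P x| ≤ (P.map fun p => |p.1| * b p).sum := by
  induction P with
  | nil => simp
  | cons p P ih =>
    simp only [List.mem_cons, forall_eq_or_imp] at h
    rw [DiffPoly.eval_cons, List.map_cons, List.sum_cons]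
    refine (abs_add_le _ _).trans (add_le_add ?_ (ih h.2))
    rw [abs_mul]
    exact mul_le_mul_of_nonneg_left h.1 (abs_nonneg _)

lemma DiffPoly.abs_eval_le_bound {C : ℝ} {P : DiffPoly}
    (h : ∀ p ∈ P, ∀ i ∈ p.2, |V i x| ≤ C) : |DiffPoly.eval V P x| ≤ P.bound C :=
  DiffPoly.abs_eval_le fun p hp => abs_monEval_le (h p hp)

lemma DiffPoly.abs_eval_le_bound_mul {C θ : ℝ} (hC : 0 ≤ C) (hθ : θ ≤ 1) {P : DiffPoly}
    (hP : ∀ p ∈ P, 1 ≤ p.2.length) (h : ∀ p ∈ P, ∀ i ∈ p.2, |V i x| ≤ C * θ) :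
    |DiffPoly.eval V P x| ≤ P.bound C * θ := by
  refine (DiffPoly.abs_eval_le fun p hp =>
    abs_monEval_le_mul hC hθ (hP p hp) (h p hp)).trans_eq ?_
  rw [DiffPoly.bound, ← List.sum_map_mul_right]
  congr 1
  exact List.map_congr_left fun p _ => by ring

lemma abs_monEval_sub_le {C : ℝ} (hC : 1 ≤ C) {l : List ℕ} {d : ℝ} (h : ∀ i ∈ l, |V i x| ≤ C)
    (h' : ∀ i ∈ l, |W i x| ≤ C) (hd : ∀ i ∈ l, |V i x - W i x| ≤ d) :
    |monEval V l x - monEval W l x| ≤ l.length * C ^ l.length * d := by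
  induction l with
  | nil => simp
  | cons i l ih =>
    simp only [List.mem_cons, forall_eq_or_imp] at h h' hd
    have h1 := ih h.2 h'.2 hd.2
    have h2 := abs_monEval_le h'.2
    have hd0 : 0 ≤ d := (abs_nonneg _).trans hd.1
    rw [monEval_cons, monEval_cons, List.length_cons]
    have e : V i x * monEval V l x - W i x * monEval W l x =
      V i x * (monEval V l x - monEval W l x) + (V i x - W i x) * monEval W l x := by ring
    have hp : (0 : ℝ) ≤ C ^ l.length := by positivity
    calc _ ≤ C * (l.length * C ^ l.length * d) + d * C ^ l.length := by
          rw [e]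
          refine (abs_add_le _ _).trans (add_le_add ?_ ?_) <;> rw [abs_mul]
          · exact mul_le_mul h.1 h1 (abs_nonneg _) (by linarith)
          · exact mul_le_mul hd.1 h2 (abs_nonneg _) hd0
      _ ≤ _ := by
          push_cast
          rw [pow_succ]
          nlinarith [mul_nonneg (mul_nonneg hd0 hp) (by linarith : (0 : ℝ) ≤ C - 1)]

/-- In the telescoping sum each term contains one difference and, by the assumption on the length,
at least one further factor, which supplies `θ`. This is where the absence of linear terms in `Q₁`
is used. -/
lemma abs_monEval_sub_le_mul {C θ : ℝ} (hC : 1 ≤ C) (hθ0 : 0 ≤ θ) (hθ : θ ≤ 1) {l : List ℕ}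
    (hl : 2 ≤ l.length) {d : ℝ}
    (h : ∀ i ∈ l, |V i x| ≤ C * θ) (h' : ∀ i ∈ l, |W i x| ≤ C * θ)
    (hd : ∀ i ∈ l, |V i x - W i x| ≤ d) :
    |monEval V l x - monEval W l x| ≤ l.length * C ^ l.length * θ * d := by
  cases l with
  | nil => simp at hl
  | cons i l =>
    have hCθ : C * θ ≤ C := mul_le_of_le_one_right (by linarith) hθ
    simp only [List.mem_cons, forall_eq_or_imp] at h h' hd
    have h1 := abs_monEval_sub_le hC (fun i hi => (h.2 i hi).trans hCθ)
      (fun i hi => (h'.2 i hi).trans hCθ) hd.2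
    have h2 := abs_monEval_le_mul (by linarith) hθ (by simpa using hl) h'.2
    have hd0 : 0 ≤ d := (abs_nonneg _).trans hd.1
    rw [monEval_cons, monEval_cons, List.length_cons]
    have e : V i x * monEval V l x - W i x * monEval W l x =
      V i x * (monEval V l x - monEval W l x) + (V i x - W i x) * monEval W l x := by ring
    have hp : (0 : ℝ) ≤ C ^ l.length := by positivity
    calc _ ≤ C * θ * (l.length * C ^ l.length * d) + d * (C ^ l.length * θ) := by
          rw [e]
          refine (abs_add_le _ _).trans (add_le_add ?_ ?_) <;> rw [abs_mul]
          · exact mul_le_mul h.1 h1 (abs_nonneg _) (by positivity)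
          · exact mul_le_mul hd.1 h2 (abs_nonneg _) hd0
      _ ≤ _ := by
          push_cast
          rw [pow_succ]
          nlinarith [mul_nonneg (mul_nonneg (mul_nonneg hd0 hp) hθ0) (by linarith : (0 : ℝ) ≤ C - 1)]

/-- The monomial of the jet with exponents `α`. -/
def monOf (α : Fin 3 →₀ ℕ) : List ℕ :=
  List.replicate (α 0) 0 ++ List.replicate (α 1) 1 ++ List.replicate (α 2) 2

/-- A polynomial in `v, ∂v, ∂²v` as a differential polynomial. -/
def ofMvPoly (Q : MvPolynomial (Fin 3) ℝ) : DiffPoly :=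
  Q.support.toList.map fun α => (Q.coeff α, monOf α)

/-- The differential polynomial `Q₀(v, ∂v, ∂²v) ∂³v + Q₁(v, ∂v, ∂²v)`. -/
def nonlin (Q₀ Q₁ : MvPolynomial (Fin 3) ℝ) : DiffPoly :=
  ((ofMvPoly Q₀).map fun p => (p.1, 3 :: p.2)) ++ ofMvPoly Q₁

lemma eval_ofMvPoly (Q : MvPolynomial (Fin 3) ℝ) :
    DiffPoly.eval V (ofMvPoly Q) x = MvPolynomial.eval ![V 0 x, V 1 x, V 2 x] Q := by
  rw [MvPolynomial.eval_eq', ← Finset.sum_map_toList]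
  simp [DiffPoly.eval, ofMvPoly, Function.comp_def, monEval, monOf, Fin.prod_univ_three, mul_assoc]

lemma eval_map_cons (i : ℕ) (P : DiffPoly) :
    DiffPoly.eval V (P.map fun p => (p.1, i :: p.2)) x = DiffPoly.eval V P x * V i x := by
  induction P with
  | nil => simp
  | cons p P ih =>
    rw [List.map_cons, DiffPoly.eval_cons, DiffPoly.eval_cons, ih, monEval_cons]; ring

lemma eval_nonlin (Q₀ Q₁ : MvPolynomial (Fin 3) ℝ) :
    DiffPoly.eval V (nonlin Q₀ Q₁) x = MvPolynomial.eval ![V 0 x, V 1 x, V 2 x] Q₀ * V 3 x +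
      MvPolynomial.eval ![V 0 x, V 1 x, V 2 x] Q₁ := by
  rw [nonlin, DiffPoly.eval_append, eval_map_cons, eval_ofMvPoly, eval_ofMvPoly]

lemma length_monOf (α : Fin 3 →₀ ℕ) : (monOf α).length = α.degree := by
  simp [monOf, Finsupp.degree_eq_sum, Fin.sum_univ_three, add_assoc]

lemma le_of_mem_monOf {α : Fin 3 →₀ ℕ} {i : ℕ} (h : i ∈ monOf α) : i ≤ 2 := by
  simp only [monOf, List.mem_append, List.mem_replicate] at h
  lia

lemma excess_eq_zero {l : List ℕ} (h : ∀ i ∈ l, i ≤ 2) : excess l = 0 := by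
  induction l with
  | nil => rfl
  | cons i l ih =>
    simp only [List.mem_cons, forall_eq_or_imp] at h
    rw [excess_cons, ih h.2]; lia

lemma of_mem_ofMvPoly {Q : MvPolynomial (Fin 3) ℝ} {d : ℕ} (hQ : ∀ α ∈ Q.support, d ≤ α.degree)
    {p : ℝ × List ℕ} (h : p ∈ ofMvPoly Q) : d ≤ p.2.length ∧ ∀ i ∈ p.2, i ≤ 2 := by
  obtain ⟨α, hα, rfl⟩ := List.mem_map.1 h
  exact ⟨(length_monOf α).symm ▸ hQ α (Finset.mem_toList.1 hα), fun i hi => le_of_mem_monOf hi⟩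

lemma of_mem_nonlin {Q₀ Q₁ : MvPolynomial (Fin 3) ℝ} (hQ₀ : ∀ α ∈ Q₀.support, 1 ≤ α.degree)
    (hQ₁ : ∀ α ∈ Q₁.support, 2 ≤ α.degree) {p : ℝ × List ℕ} (h : p ∈ nonlin Q₀ Q₁) :
    2 ≤ p.2.length ∧ excess p.2 ≤ 1 ∧ ∀ i ∈ p.2, i ≤ 3 := by
  rcases List.mem_append.1 h with h | h
  · obtain ⟨q, hq, rfl⟩ := List.mem_map.1 h
    obtain ⟨h1, h2⟩ := of_mem_ofMvPoly hQ₀ hq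
    refine ⟨by simpa using h1, ?_, ?_⟩
    · rw [excess_cons, excess_eq_zero h2]
    · simp only [List.mem_cons, forall_eq_or_imp]
      exact ⟨le_rfl, fun i hi => (h2 i hi).trans (by lia)⟩
  · obtain ⟨h1, h2⟩ := of_mem_ofMvPoly hQ₁ h
    exact ⟨h1, (excess_eq_zero h2).le.trans (by lia), fun i hi => (h2 i hi).trans (by lia)⟩

/-- In a monomial of excess at most nine, all factors but one are of order at most seven. -/
lemma exists_top_factor {l : List ℕ} (hl : 2 ≤ l.length) (h : excess l ≤ 9) :
    ∃ j ∈ l, j ≤ 11 ∧ 1 ≤ (l.erase j).length ∧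
      ∀ i ∈ l.erase j, i ≤ 7 ∧ (9 ≤ j → i + j ≤ 13) := by
  have hlen : ∀ j ∈ l, 1 ≤ (l.erase j).length := fun j hj => by
    rw [List.length_erase_of_mem hj]; lia
  -- A factor of order `j ≥ 8` consumes `j - 2 ≥ 6` of the excess, so every other factor has order
  -- at most five, and the remaining excess gives the bound for `i + j`. Without such a factor any
  -- choice works.
  by_cases h8 : ∃ j ∈ l, 8 ≤ j
  · obtain ⟨j, hj, hj8⟩ := h8
    have := excess_erase hj
    refine ⟨j, hj, by lia, hlen j hj, fun i hi => ?_⟩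
    have := le_excess hi
    constructor <;> lia
  · push Not at h8
    obtain ⟨j, l', rfl⟩ := List.exists_cons_of_length_pos (l := l) (by lia)
    have hj : j ∈ j :: l' := List.mem_cons_self
    refine ⟨j, hj, (h8 j hj).le.trans (by lia), hlen j hj, fun i hi => ?_⟩
    have := h8 i (List.mem_of_mem_erase hi)
    have := h8 j hj
    constructor <;> lia

/-! ### Functions whose derivatives are polynomials in bounded functions. -/

section PolynomialVectorField

open MvPolynomial

variable {ι : Type*}

/-- Both sides obey the Leibniz rule in `P`, so they agree once they agree on the variables. -/
lemma hasDerivAt_mvPolynomial_eval [Fintype ι] {X : ι → ℝ → ℝ} {d : ι → MvPolynomial ι ℝ}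
    (h : ∀ i x, HasDerivAt (X i) (eval (fun j => X j x) (d i)) x) (P : MvPolynomial ι ℝ) (x : ℝ) :
    HasDerivAt (fun x => eval (fun j => X j x) P) (eval (fun j => X j x) (mkDerivation ℝ d P)) x := by
  induction P using MvPolynomial.induction_on with
  | C a => simpa using hasDerivAt_const x a
  | add p q hp hq => simpa using hp.fun_add hq
  | mul_X p i hp =>
    simp only [map_mul, eval_X, Derivation.leibniz, mkDerivation_X, smul_eq_mul, map_add]
    exact (hp.fun_mul (h i x)).congr_deriv (by ring)

lemma exists_abs_eval_le [Fintype ι] (P : MvPolynomial ι ℝ) :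
    ∃ C : ℝ, 0 ≤ C ∧ ∀ X : ι → ℝ, (∀ i, |X i| ≤ 1) → |eval X P| ≤ C := by
  refine ⟨∑ d ∈ P.support, |P.coeff d|, Finset.sum_nonneg fun _ _ => abs_nonneg _, fun X hX => ?_⟩
  rw [eval_eq']
  refine (Finset.abs_sum_le_sum_abs _ _).trans (Finset.sum_le_sum fun d _ => ?_)
  rw [abs_mul, Finset.abs_prod]
  refine mul_le_of_le_one_right (abs_nonneg _) (Finset.prod_le_one (fun _ _ => abs_nonneg _) ?_)
  intro i _
  rw [abs_pow]
  exact pow_le_one₀ (abs_nonneg _) (hX i)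

/-- If `F' = F * m * ℓ`, where `ℓ` is a polynomial in bounded functions `m, X₁, ...` whose
derivatives are polynomials in these functions divisible by `m`, then all derivatives of `F` are
of this form, with universal bounds. -/
lemma exists_derivatives_of_log_deriv [Fintype ι] (i₀ : ι) (e : ι → MvPolynomial ι ℝ)
    (ℓ : MvPolynomial ι ℝ) : ∃ (C : ℕ → ℝ), (∀ k, 0 ≤ C k) ∧
      ∀ (X : ι → ℝ → ℝ) (F : ℝ → ℝ),
      (∀ i x, |X i x| ≤ 1) →
      (∀ i x, HasDerivAt (X i) (X i₀ x * eval (fun j => X j x) (e i)) x) →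
      (∀ x, HasDerivAt F (F x * (X i₀ x * eval (fun j => X j x) ℓ)) x) →
      ∃ p : ℕ → ℝ → ℝ, (∀ x, p 0 x = 1) ∧ (∀ x, p 1 x = X i₀ x * eval (fun j => X j x) ℓ) ∧
        (∀ k, Continuous (p k)) ∧
        ∀ k x, HasDerivAt (fun x => F x * p k x) (F x * p (k + 1) x) x ∧ |p k x| ≤ C k ∧
          |p (k + 1) x| ≤ C (k + 1) * |X i₀ x| ∧
          HasDerivAt (p k) (p (k + 1) x - p k x * p 1 x) x := by
  -- If `F' = F m ℓ`, then `(F p)' = F (p' + p m ℓ)`, and `p'` is divisible by `m` because the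
  -- derivatives of all variables are. The recursion records the quotient explicitly. It does not
  -- involve the functions, hence the universality of the bounds.
  let R : ℕ → MvPolynomial ι ℝ := fun k => Nat.rec 1
    (fun _ P => X i₀ * (mkDerivation ℝ e P + P * ℓ)) k
  have hR : ∀ k, R (k + 1) = X i₀ * (mkDerivation ℝ e (R k) + R k * ℓ) := fun k => rfl
  choose B hB0 hB using fun k => exists_abs_eval_le (R k)
  choose B' hB'0 hB' using fun k => exists_abs_eval_le (mkDerivation ℝ e (R k) + R k * ℓ)
  -- The constant of index `k` has to bound both `p k` and its quotient by `m`; the quotient comes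
  -- from the step `k - 1`. For `k = 0` the truncated subtraction only adds a harmless nonnegative
  -- term.
  refine ⟨fun k => B k + B' (k - 1), fun k => add_nonneg (hB0 k) (hB'0 _),
    fun Y F hY hd hF => ⟨fun k x => eval (fun j => Y j x) (R k), fun x => by simp [R],
      fun x => by simp [R], fun k => ?_, fun k x => ?_⟩⟩
  all_goals
    have hd' : ∀ i x, HasDerivAt (Y i) (eval (fun j => Y j x) (X i₀ * e i)) x := fun i x => by
      simpa using hd i x
  · exact continuous_of_forall_hasDerivAt (hasDerivAt_mvPolynomial_eval hd' (R k))
  have hsmul : mkDerivation ℝ (fun i => X i₀ * e i) (R k) = X i₀ * mkDerivation ℝ e (R k) := by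
    induction R k using MvPolynomial.induction_on with
    | C a => simp
    | add p q hp hq => simp only [map_add, hp, hq, mul_add]
    | mul_X p i hp =>
      simp only [Derivation.leibniz, mkDerivation_X, smul_eq_mul, hp]
      ring
  have h1 := hasDerivAt_mvPolynomial_eval hd' (R k) x
  have hR1 : R 1 = X i₀ * ℓ := by simp [R]
  refine ⟨?_, ?_, ?_, h1.congr_deriv ?_⟩ <;> dsimp only
  · refine ((hF x).fun_mul h1).congr_deriv ?_
    rw [hsmul, hR]
    simp only [map_mul, map_add, eval_X]
    ring
  · exact (hB k _ fun i => hY i x).trans (le_add_of_nonneg_right (hB'0 _))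
  · rw [hR, map_mul, eval_X, abs_mul, mul_comm]
    refine mul_le_mul_of_nonneg_right ((hB' k _ fun i => hY i x).trans ?_) (abs_nonneg _)
    simpa using hB0 (k + 1)
  · rw [hsmul, hR, hR1]
    simp only [map_mul, map_add, eval_X]
    ring

end PolynomialVectorField

/-! ### The bracket and its powers. -/

lemma bracket_sq (x : ℝ) : bracket x ^ 2 = 1 + x ^ 2 := Real.sq_sqrt (by positivity)

lemma one_le_bracket (x : ℝ) : 1 ≤ bracket x := by
  rw [bracket, Real.one_le_sqrt]; nlinarith [sq_nonneg x]

lemma bracket_pos (x : ℝ) : 0 < bracket x := zero_lt_one.trans_le (one_le_bracket x)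

lemma abs_le_bracket (x : ℝ) : |x| ≤ bracket x := Real.abs_le_sqrt (by linarith)

lemma abs_lt_bracket (x : ℝ) : |x| < bracket x := by
  refine abs_lt_of_sq_lt_sq ?_ (bracket_pos x).le
  rw [bracket_sq]; linarith

lemma hasDerivAt_bracket (x : ℝ) : HasDerivAt bracket (x / bracket x) x := by
  have h : HasDerivAt (fun x : ℝ => 1 + x ^ 2) (2 * x) x :=
    ((hasDerivAt_pow 2 x).const_add 1).congr_deriv (by simp)
  refine (h.sqrt (by positivity)).congr_deriv ?_
  rw [bracket]; field_simp

/-- The inverse of the bracket. -/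
def invBr (x : ℝ) : ℝ := 1 / bracket x

/-- The derivative of the bracket. -/
def slope (x : ℝ) : ℝ := x / bracket x

lemma invBr_pos (x : ℝ) : 0 < invBr x := one_div_pos.2 (bracket_pos x)

lemma invBr_le_one (x : ℝ) : invBr x ≤ 1 := (div_le_one (bracket_pos x)).2 (one_le_bracket x)

lemma abs_invBr (x : ℝ) : |invBr x| = invBr x := abs_of_pos (invBr_pos x)

lemma abs_slope_le (x : ℝ) : |slope x| ≤ 1 := by
  rw [slope, abs_div, abs_of_pos (bracket_pos x), div_le_one (bracket_pos x)]
  exact abs_le_bracket x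

lemma hasDerivAt_invBr (x : ℝ) : HasDerivAt invBr (invBr x * -(slope x * invBr x)) x := by
  have h := (hasDerivAt_bracket x).inv (bracket_pos x).ne'
  have e : invBr = bracket⁻¹ := by ext y; simp [invBr]
  rw [e]
  refine h.congr_deriv ?_
  have := (bracket_pos x).ne'
  simp only [Pi.inv_apply, slope]
  field_simp

lemma hasDerivAt_slope (x : ℝ) : HasDerivAt slope (invBr x * invBr x ^ 2) x := by
  refine ((hasDerivAt_id x).div (hasDerivAt_bracket x) (bracket_pos x).ne').congr_deriv ?_
  have h := (bracket_pos x).ne'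
  simp only [id, invBr]
  field_simp
  rw [bracket_sq]; ring

/-- The decay factor `⟨x⟩^{-9/8}`. -/
def decay (x : ℝ) : ℝ := bracket x ^ (-(9 / 8) : ℝ)

lemma decay_pos (x : ℝ) : 0 < decay x := Real.rpow_pos_of_pos (bracket_pos x) _

lemma decay_le_one (x : ℝ) : decay x ≤ 1 :=
  Real.rpow_le_one_of_one_le_of_nonpos (one_le_bracket x) (by norm_num)

/-- The weights `⟨x⟩^{s}`. -/
def brPow (s : ℝ) (x : ℝ) : ℝ := bracket x ^ s

lemma brPow_pos (s x : ℝ) : 0 < brPow s x := Real.rpow_pos_of_pos (bracket_pos x) _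

lemma brPow_mono {s t : ℝ} (h : s ≤ t) (x : ℝ) : brPow s x ≤ brPow t x :=
  Real.rpow_le_rpow_of_exponent_le (one_le_bracket x) h

lemma brPow_add (s t x : ℝ) : brPow (s + t) x = brPow s x * brPow t x :=
  Real.rpow_add (bracket_pos x) s t

lemma brPow_zero (x : ℝ) : brPow 0 x = 1 := Real.rpow_zero _

lemma hasDerivAt_brPow (s x : ℝ) :
    HasDerivAt (brPow s) (brPow s x * (invBr x * (s * slope x))) x := by
  refine ((hasDerivAt_bracket x).rpow_const (Or.inl (bracket_pos x).ne')).congr_deriv ?_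
  rw [brPow, slope, invBr, Real.rpow_sub_one (bracket_pos x).ne']
  ring

lemma continuous_brPow (s : ℝ) : Continuous (brPow s) :=
  continuous_of_forall_hasDerivAt (hasDerivAt_brPow s)

open MvPolynomial in
/-- The derivatives of the powers of the bracket. -/
lemma exists_deriv_brPow (s : ℝ) : ∃ (C : ℝ) (D₁ D₂ : ℝ → ℝ), 0 ≤ C ∧
    Continuous D₁ ∧ Continuous D₂ ∧
    (∀ x, HasDerivAt (brPow s) (D₁ x) x) ∧ (∀ x, HasDerivAt D₁ (D₂ x) x) ∧
    ∀ x, |D₁ x| ≤ C * (brPow s x * invBr x) ∧ |D₂ x| ≤ C * (brPow s x * invBr x) := by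
  -- The variables are `1/⟨x⟩` and `x/⟨x⟩`, which form a closed system under differentiation; the
  -- first one is the common factor of all derivatives.
  obtain ⟨C, hC0, hC⟩ := exists_derivatives_of_log_deriv (ι := Fin 2) 0
    ![-(X 1 * X 0), X 0 ^ 2] (C s * X 1)
  obtain ⟨p, hp0, -, hpc, hp⟩ := hC ![invBr, slope] (brPow s)
    (Fin.forall_fin_two.2 ⟨fun x => (abs_invBr x).trans_le (invBr_le_one x), abs_slope_le⟩)
    (Fin.forall_fin_two.2 ⟨fun x => by simpa using hasDerivAt_invBr x,
      fun x => by simpa using hasDerivAt_slope x⟩)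
    (fun x => by simpa using hasDerivAt_brPow s x)
  have hb : ∀ k x, |brPow s x * p (k + 1) x| ≤ C (k + 1) * (brPow s x * invBr x) := fun k x => by
    have := (hp k x).2.2.1
    simp only [Matrix.cons_val_zero, abs_invBr] at this
    rw [abs_mul, abs_of_pos (brPow_pos s x)]
    nlinarith [brPow_pos s x]
  have hpos : ∀ x, 0 ≤ brPow s x * invBr x := fun x =>
    (mul_pos (brPow_pos s x) (invBr_pos x)).le
  refine ⟨C 1 + C 2, fun x => brPow s x * p 1 x, fun x => brPow s x * p 2 x,
    add_nonneg (hC0 1) (hC0 2), (continuous_brPow s).mul (hpc 1), (continuous_brPow s).mul (hpc 2),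
    fun x => ?_, fun x => (hp 1 x).1, fun x => ⟨?_, ?_⟩⟩
  · simpa [hp0] using (hp 0 x).1
  · refine (hb 0 x).trans (mul_le_mul_of_nonneg_right ?_ (hpos x))
    exact le_add_of_nonneg_right (hC0 2)
  · refine (hb 1 x).trans (mul_le_mul_of_nonneg_right ?_ (hpos x))
    exact le_add_of_nonneg_left (hC0 1)

/-! ### The weights of the a priori estimates. -/

open MvPolynomial in
/-- Bounded approximations of the weight `⟨x⟩⁴`, with derivatives controlled by `⟨x⟩³`. -/
lemma exists_truncated_weight : ∃ C : ℝ, 0 ≤ C ∧ ∀ δ : ℝ, 0 < δ → ∃ χ : ℕ → ℝ → ℝ,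
    BddTower 5 χ ∧ (∀ x, χ 0 x = ((1 + x ^ 2) / (1 + δ * (1 + x ^ 2))) ^ 2) ∧
      ∀ k x, k ≤ 4 → |χ (k + 1) x| ≤ C * bracket x ^ 3 := by
  -- The third variable is `1 / (1 + δ⟨x⟩²)`, with values in `(0,1]`. With it the system no longer
  -- contains `δ`, so the constants are uniform in the truncation.
  obtain ⟨C, hC0, hC⟩ := exists_derivatives_of_log_deriv (ι := Fin 3) 0
    ![-(X 1 * X 0), X 0 ^ 2, -2 * X 1 * X 2 * (1 - X 2)] (4 * X 1 * X 2)
  refine ⟨∑ k ∈ Finset.range 6, C k, Finset.sum_nonneg fun k _ => hC0 k, fun δ hδ => ?_⟩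
  have hy : ∀ x : ℝ, 0 < 1 + x ^ 2 := fun x => by positivity
  have hr : ∀ x : ℝ, 0 < 1 + δ * (1 + x ^ 2) := fun x => by positivity
  have dy : ∀ x : ℝ, HasDerivAt (fun x : ℝ => 1 + x ^ 2) (2 * x) x := fun x =>
    ((hasDerivAt_pow 2 x).const_add 1).congr_deriv (by simp)
  have dr : ∀ x : ℝ, HasDerivAt (fun x : ℝ => 1 + δ * (1 + x ^ 2)) (δ * (2 * x)) x := fun x =>
    ((dy x).const_mul δ).const_add 1
  have hbr : ∀ x, bracket x ≠ 0 := fun x => (bracket_pos x).ne'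
  have hbr2 := bracket_sq
  set s : ℝ → ℝ := fun x => 1 / (1 + δ * (1 + x ^ 2)) with hs
  have hs0 : ∀ x, 0 < s x := fun x => one_div_pos.2 (hr x)
  have hs1 : ∀ x, s x ≤ 1 := fun x => by
    rw [hs, div_le_one (hr x)]; nlinarith [hy x]
  have ds : ∀ x, HasDerivAt s (invBr x * (-2 * slope x * s x * (1 - s x))) x := fun x => by
    refine ((hasDerivAt_const x (1 : ℝ)).fun_div (dr x) (hr x).ne').congr_deriv ?_
    have := (hr x).ne'
    have := hbr x
    simp only [hs, invBr, slope]
    field_simp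
    rw [hbr2]; ring
  set F : ℝ → ℝ := fun x => ((1 + x ^ 2) / (1 + δ * (1 + x ^ 2))) ^ 2 with hF
  have dF : ∀ x, HasDerivAt F (F x * (invBr x * (4 * slope x * s x))) x := fun x => by
    refine (((dy x).fun_div (dr x) (hr x).ne').fun_pow 2).congr_deriv ?_
    have := (hr x).ne'
    have := hbr x
    simp only [hs, hF, invBr, slope, Nat.cast_ofNat, Nat.add_one_sub_one, pow_one]
    field_simp
    rw [hbr2]; field_simp; ring
  obtain ⟨p, hp0, -, hpc, hp⟩ := hC ![invBr, slope, s] F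
    (by
      simp only [Fin.forall_fin_succ, IsEmpty.forall_iff, and_true]
      exact ⟨fun x => (abs_invBr x).trans_le (invBr_le_one x), abs_slope_le,
        fun x => (abs_of_pos (hs0 x)).trans_le (hs1 x)⟩)
    (by
      simp only [Fin.forall_fin_succ, IsEmpty.forall_iff, and_true]
      exact ⟨fun x => by simpa using hasDerivAt_invBr x,
        fun x => by simpa using hasDerivAt_slope x, fun x => by simpa using ds x⟩)
    (fun x => by simpa using dF x)
  have hF0 : ∀ x, 0 ≤ F x := fun x => sq_nonneg _
  have hFδ : ∀ x, F x ≤ (1 / δ) ^ 2 := fun x => by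
    refine pow_le_pow_left₀ (div_nonneg (hy x).le (hr x).le) ?_ 2
    rw [div_le_div_iff₀ (hr x) hδ]; linarith
  have hF4 : ∀ x, F x ≤ bracket x ^ 4 := fun x => by
    have : bracket x ^ 4 = (1 + x ^ 2) ^ 2 := by rw [← hbr2]; ring
    rw [this]
    refine pow_le_pow_left₀ (div_nonneg (hy x).le (hr x).le) (div_le_self (hy x).le ?_) 2
    nlinarith [hy x]
  refine ⟨fun k x => F x * p k x, ⟨fun k _ x => (hp k x).1, fun k _ => ⟨?_, (1 / δ) ^ 2 * C k,
    fun x => ?_⟩⟩, fun x => by simp [hp0, hF], fun k x hk => ?_⟩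
  · exact (continuous_of_forall_hasDerivAt dF).mul (hpc k)
  · rw [abs_mul, abs_of_nonneg (hF0 x)]
    exact mul_le_mul (hFδ x) (hp k x).2.1 (abs_nonneg _) (by positivity)
  · have h1 : C (k + 1) ≤ ∑ k ∈ Finset.range 6, C k :=
      Finset.single_le_sum (f := C) (fun k _ => hC0 k) (Finset.mem_range.2 (by lia))
    have h2 := (hp k x).2.2.1
    simp only [Matrix.cons_val_zero, abs_invBr] at h2
    have h3 : bracket x ^ 3 = bracket x ^ 4 * invBr x := by
      rw [invBr]; field_simp [hbr x]
    rw [abs_mul, abs_of_nonneg (hF0 x), h3]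
    have h4 := (invBr_pos x).le
    calc F x * |p (k + 1) x| ≤ bracket x ^ 4 * ((∑ k ∈ Finset.range 6, C k) * invBr x) :=
          mul_le_mul (hF4 x) (h2.trans (mul_le_mul_of_nonneg_right h1 h4)) (abs_nonneg _)
            (by positivity)
      _ = _ := by ring

/-- The function `x + ⟨x⟩`. -/
def zW (x : ℝ) : ℝ := x + bracket x

lemma zW_pos (x : ℝ) : 0 < zW x := by
  have := neg_abs_le x
  have := abs_lt_bracket x
  rw [zW]; linarith

/-- The logarithmic derivative is exactly `1/⟨x⟩`. Positive powers of `zW` are therefore smooth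
substitutes for powers of `x₊`: they grow like powers of `2x` on the right and, by `zW_mul`, decay
like the inverse powers of `2|x|` on the left. -/
lemma hasDerivAt_zW (x : ℝ) : HasDerivAt zW (zW x * invBr x) x := by
  refine ((hasDerivAt_id x).add (hasDerivAt_bracket x)).congr_deriv ?_
  have := (bracket_pos x).ne'
  rw [zW, invBr]; field_simp; exact add_comm _ _

lemma zW_mul (x : ℝ) : zW x * (bracket x - x) = 1 := by
  have := bracket_sq x
  rw [zW]; nlinarith

lemma zW_le (x : ℝ) : zW x ≤ 2 * bracket x := by
  have := le_abs_self x
  have := abs_le_bracket x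
  rw [zW]; linarith

lemma inv_zW_le (x : ℝ) : (zW x)⁻¹ ≤ 2 * bracket x := by
  have h := zW_mul x
  have := neg_abs_le x
  have := abs_le_bracket x
  rw [← eq_inv_of_mul_eq_one_right h]; linarith

open MvPolynomial in
/-- A bounded increasing weight whose derivative decays like `⟨x⟩^{-9/8}`. -/
lemma exists_smoothing_weight : ∃ (C c : ℝ) (φ : ℕ → ℝ → ℝ), 0 ≤ C ∧ 0 < c ∧ BddTower 5 φ ∧
    (∀ x, 1 ≤ φ 0 x ∧ φ 0 x ≤ 2) ∧ (∀ x, c * decay x ≤ φ 1 x) ∧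
    ∀ k x, k ≤ 4 → |φ (k + 1) x| ≤ C * φ 1 x := by
  obtain ⟨C, hC0, hC⟩ := exists_derivatives_of_log_deriv (ι := Fin 3) 0
    ![-(X 1 * X 0), X 0 ^ 2, C (1 / 8) * X 2 * (1 - X 2)] (C (1 / 8) * (1 - 2 * X 2) - X 1)
  -- The weight is `1 + g` with `g = t / (1 + t)`. Its derivative is `g (1 - g) / (8⟨x⟩)`, and the
  -- exponent `1/8` makes `g (1 - g)` of size `⟨x⟩^{-1/8}` at both ends, whence the decay
  -- `⟨x⟩^{-9/8}`.
  set t : ℝ → ℝ := fun x => zW x ^ (1 / 8 : ℝ) with ht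
  have ht0 : ∀ x, 0 < t x := fun x => Real.rpow_pos_of_pos (zW_pos x) _
  have dt : ∀ x, HasDerivAt t (1 / 8 * t x * invBr x) x := fun x => by
    refine ((hasDerivAt_zW x).rpow_const (Or.inl (zW_pos x).ne')).congr_deriv ?_
    have := (zW_pos x).ne'
    rw [Real.rpow_sub_one this, ht]
    field_simp
  set g : ℝ → ℝ := fun x => t x / (1 + t x) with hg
  have h1t : ∀ x, 1 + t x ≠ 0 := fun x => by have := ht0 x; positivity
  have hg0 : ∀ x, 0 < g x := fun x => div_pos (ht0 x) (by have := ht0 x; positivity)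
  have hg1 : ∀ x, g x < 1 := fun x => by
    have := ht0 x
    rw [hg, div_lt_one (by positivity)]; linarith
  have dg : ∀ x, HasDerivAt g (invBr x * (1 / 8 * g x * (1 - g x))) x := fun x => by
    refine ((dt x).fun_div ((dt x).const_add 1) (h1t x)).congr_deriv ?_
    have := h1t x
    simp only [hg]
    field_simp
  set F : ℝ → ℝ := fun x => invBr x * (1 / 8 * g x * (1 - g x)) with hF
  have dF : ∀ x, HasDerivAt F (F x * (invBr x * (1 / 8 * (1 - 2 * g x) - slope x))) x := fun x => by
    refine ((hasDerivAt_invBr x).fun_mul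
      (((dg x).const_mul (1 / 8)).fun_mul ((dg x).const_sub 1))).congr_deriv ?_
    simp only [hF]
    ring
  have hF0 : ∀ x, 0 < F x := fun x => mul_pos (invBr_pos x)
    (mul_pos (mul_pos (by norm_num) (hg0 x)) (sub_pos.2 (hg1 x)))
  have hF1 : ∀ x, F x ≤ 1 := fun x => by
    have := invBr_le_one x
    have := invBr_pos x
    have := hg0 x
    have := hg1 x
    have : 1 / 8 * g x * (1 - g x) ≤ 1 := by nlinarith
    exact mul_le_one₀ (invBr_le_one x) (by have := sub_pos.2 (hg1 x); positivity) this
  obtain ⟨p, hp0, -, hpc, hp⟩ := hC ![invBr, slope, g] F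
    (by
      simp only [Fin.forall_fin_succ, IsEmpty.forall_iff, and_true]
      exact ⟨fun x => (abs_invBr x).trans_le (invBr_le_one x), abs_slope_le,
        fun x => (abs_of_pos (hg0 x)).trans_le (hg1 x).le⟩)
    (by
      simp only [Fin.forall_fin_succ, IsEmpty.forall_iff, and_true]
      exact ⟨fun x => by simpa using hasDerivAt_invBr x,
        fun x => by simpa using hasDerivAt_slope x, fun x => by simpa using dg x⟩)
    (fun x => by simpa using dF x)
  refine ⟨∑ k ∈ Finset.range 6, C k, 1 / 64, fun k => Nat.casesOn k (fun x => 1 + g x)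
    (fun k x => F x * p k x), Finset.sum_nonneg fun k _ => hC0 k, by norm_num,
    ⟨fun k _ x => ?_, fun k _ => ?_⟩, fun x => ⟨?_, ?_⟩, fun x => ?_, fun k x hk => ?_⟩
  · cases k with
    | zero => simpa [hp0, hF] using (dg x).const_add 1
    | succ k => exact (hp k x).1
  · cases k with
    | zero => exact ⟨(continuous_of_forall_hasDerivAt dg).const_add 1, 2, fun x => by
        change |1 + g x| ≤ 2
        have := hg0 x
        have := hg1 x
        rw [abs_of_pos (by positivity)]; linarith⟩
    | succ k => exact ⟨(continuous_of_forall_hasDerivAt dF).mul (hpc k), C k, fun x => by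
        change |F x * p k x| ≤ C k
        rw [abs_mul, abs_of_pos (hF0 x)]
        exact (mul_le_of_le_one_left (abs_nonneg _) (hF1 x)).trans (hp k x).2.1⟩
  · have := (hg0 x).le
    change 1 ≤ 1 + g x
    linarith
  · have := (hg1 x).le
    change 1 + g x ≤ 2
    linarith
  · change 1 / 64 * decay x ≤ F x * p 0 x
    rw [hp0, mul_one]
    have hb := bracket_pos x
    have h2b : (2 * bracket x) ^ (1 / 8 : ℝ) ≤ 2 * bracket x ^ (1 / 8 : ℝ) := by
      rw [Real.mul_rpow (by norm_num) hb.le]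
      refine mul_le_mul_of_nonneg_right ?_ (Real.rpow_nonneg hb.le _)
      exact (Real.rpow_le_rpow_of_exponent_le (by norm_num) (by norm_num : (1 / 8 : ℝ) ≤ 1)).trans_eq
        (Real.rpow_one 2)
    have e1 : t x ≤ 2 * bracket x ^ (1 / 8 : ℝ) :=
      (Real.rpow_le_rpow (zW_pos x).le (zW_le x) (by norm_num)).trans h2b
    have e2 : (t x)⁻¹ ≤ 2 * bracket x ^ (1 / 8 : ℝ) := by
      rw [ht, ← Real.inv_rpow (zW_pos x).le]
      exact (Real.rpow_le_rpow (inv_nonneg.2 (zW_pos x).le) (inv_zW_le x) (by norm_num)).trans h2b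
    set B := bracket x ^ (1 / 8 : ℝ) with hB
    have hB1 : 1 ≤ B := Real.one_le_rpow (one_le_bracket x) (by norm_num)
    have e3 : decay x = invBr x * B⁻¹ := by
      rw [decay, invBr, hB, ← Real.rpow_neg hb.le, one_div, ← Real.rpow_neg_one,
        ← Real.rpow_add hb]
      norm_num
    have e4 : g x * (1 - g x) = 1 / (t x + (t x)⁻¹ + 2) := by
      have := h1t x
      have := (ht0 x).ne'
      have h3 : t x + (t x)⁻¹ + 2 = (1 + t x) ^ 2 / t x := by field_simp; ring
      rw [h3, hg]
      field_simp
      ring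
    -- As `t` and `1/t` are at most `2B` and `B ≥ 1`, the denominator is at most `8B`. Together with
    -- the factor `1/8` in `F` this gives the constant `1/64`.
    have e5 : 1 / 8 * B⁻¹ ≤ g x * (1 - g x) := by
      have := ht0 x
      rw [e4, ← div_eq_mul_inv, div_div, div_le_div_iff₀ (by positivity) (by positivity)]
      linarith
    rw [e3]
    simp only [hF]
    have := mul_le_mul_of_nonneg_left e5 (invBr_pos x).le
    linarith
  · change |F x * p k x| ≤ _ * (F x * p 0 x)
    rw [hp0, mul_one, abs_mul, abs_of_pos (hF0 x), mul_comm]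
    refine mul_le_mul_of_nonneg_right ((hp k x).2.1.trans ?_) (hF0 x).le
    exact Finset.single_le_sum (f := C) (fun k _ => hC0 k) (Finset.mem_range.2 (by lia))

/-! ### Truncated approximations of the exponent. -/

/-- A smooth function at bounded distance from `x₊^{5/4}`. -/
def yW (x : ℝ) : ℝ := (zW x / 2) ^ (5 / 4 : ℝ)

lemma yW_pos (x : ℝ) : 0 < yW x := Real.rpow_pos_of_pos (half_pos (zW_pos x)) _

lemma hasDerivAt_yW (x : ℝ) : HasDerivAt yW (5 / 4 * yW x * invBr x) x := by
  refine (((hasDerivAt_zW x).div_const 2).rpow_const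
    (Or.inl (half_pos (zW_pos x)).ne')).congr_deriv ?_
  have := (zW_pos x).ne'
  rw [Real.rpow_sub_one (half_pos (zW_pos x)).ne', yW]
  field_simp

lemma half_zW_le (x : ℝ) : zW x / 2 ≤ bracket x := by linarith [zW_le x]

lemma yW_pow_four (x : ℝ) : yW x ^ 4 = (zW x / 2) ^ 5 := by
  rw [yW, ← Real.rpow_natCast, ← Real.rpow_mul (half_pos (zW_pos x)).le, ← Real.rpow_natCast]
  norm_num

lemma max_rpow_le_yW (x : ℝ) : max x 0 ^ (5 / 4 : ℝ) ≤ yW x := by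
  refine Real.rpow_le_rpow (le_max_right _ _) (max_le ?_ (half_pos (zW_pos x)).le) (by norm_num)
  have := le_abs_self x
  have := abs_le_bracket x
  rw [zW]; linarith

lemma yW_le_one {x : ℝ} (hx : x ≤ 0) : yW x ≤ 1 := by
  refine Real.rpow_le_one (half_pos (zW_pos x)).le ?_ (by norm_num)
  have := zW_mul x
  have := zW_pos x
  have := one_le_bracket x
  nlinarith

/-- For `x ≥ 0` let `A = zW x / 2`. Convexity of the power `5/4` gives `yW x - x^{5/4} ≤ (5/4) yW x
(1 - x/A)`. Here `A - x = (⟨x⟩ - x)/2` is of size `1/⟨x⟩`, and `yW x ≤ A⟨x⟩`, so the right-hand side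
is at most `5/8`. -/
lemma yW_le (x : ℝ) : yW x ≤ max x 0 ^ (5 / 4 : ℝ) + 1 := by
  rcases le_total x 0 with hx | hx
  · have := Real.rpow_nonneg (le_max_right x 0) (5 / 4 : ℝ)
    linarith [yW_le_one hx]
  rw [max_eq_left hx]
  have hA := half_pos (zW_pos x)
  have hb := bracket_pos x
  have hxA : x ≤ zW x / 2 := by
    have := le_abs_self x
    have := abs_le_bracket x
    rw [zW]; linarith
  have h1 := one_add_mul_self_le_rpow_one_add (s := x / (zW x / 2) - 1) (p := 5 / 4)
    (by have : 0 ≤ x / (zW x / 2) := by positivity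
        linarith) (by norm_num)
  have e : (1 + (x / (zW x / 2) - 1)) ^ (5 / 4 : ℝ) = x ^ (5 / 4 : ℝ) / yW x := by
    rw [add_sub_cancel, Real.div_rpow hx hA.le, yW]
  rw [e, le_div_iff₀ (yW_pos x)] at h1
  have h2 : yW x ≤ (zW x / 2) * bracket x := by
    rw [yW, show (5 / 4 : ℝ) = 1 + 1 / 4 by norm_num, Real.rpow_add hA, Real.rpow_one]
    refine mul_le_mul_of_nonneg_left ?_ hA.le
    calc (zW x / 2) ^ (1 / 4 : ℝ) ≤ bracket x ^ (1 / 4 : ℝ) :=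
          Real.rpow_le_rpow hA.le (half_zW_le x) (by norm_num)
      _ ≤ bracket x ^ (1 : ℝ) := Real.rpow_le_rpow_of_exponent_le (one_le_bracket x) (by norm_num)
      _ = bracket x := Real.rpow_one _
  have h3 : zW x / 2 - x = (bracket x - x) / 2 := by rw [zW]; ring
  have h4 : bracket x * (bracket x - x) ≤ 1 := by
    have := bracket_sq x
    have := zW_mul x
    have : bracket x ≤ zW x := by rw [zW]; linarith
    have : 0 ≤ bracket x - x := by linarith [le_abs_self x, abs_le_bracket x]
    nlinarith
  have h5 : yW x * (1 - x / (zW x / 2)) ≤ 1 / 2 := by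
    have e5 : 1 - x / (zW x / 2) = (zW x / 2 - x) / (zW x / 2) := by
      rw [sub_div, div_self hA.ne']
    have h6 : 0 ≤ (zW x / 2 - x) / (zW x / 2) := div_nonneg (by linarith) hA.le
    rw [e5]
    calc yW x * ((zW x / 2 - x) / (zW x / 2))
        ≤ (zW x / 2 * bracket x) * ((zW x / 2 - x) / (zW x / 2)) :=
          mul_le_mul_of_nonneg_right h2 h6
      _ = bracket x * (zW x / 2 - x) := by
          have := (zW_pos x).ne'
          field_simp
      _ ≤ 1 / 2 := by rw [h3]; linarith
  nlinarith

/-- Bounded approximations of `yW`. -/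
def pW (δ x : ℝ) : ℝ := 10 / δ * (1 - (1 + δ * yW x) ^ (-(1 / 10) : ℝ))

/-- The derivative of `pW`. -/
def qW (δ x : ℝ) : ℝ := 5 / 4 * yW x * invBr x * (1 + δ * yW x) ^ (-(11 / 10) : ℝ)

section

variable {δ : ℝ}

lemma one_lt_rW (hδ : 0 < δ) (x : ℝ) : 1 < 1 + δ * yW x := by
  have := mul_pos hδ (yW_pos x); linarith

lemma hasDerivAt_rW (δ x : ℝ) :
    HasDerivAt (fun x => 1 + δ * yW x) (δ * (5 / 4 * yW x * invBr x)) x :=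
  ((hasDerivAt_yW x).const_mul δ).const_add 1

lemma hasDerivAt_pW (hδ : 0 < δ) (x : ℝ) : HasDerivAt (pW δ) (qW δ x) x := by
  have hr := (zero_lt_one.trans (one_lt_rW hδ x)).ne'
  refine ((((hasDerivAt_rW δ x).rpow_const (Or.inl hr)).const_sub 1).const_mul
    (10 / δ)).congr_deriv ?_
  rw [show (-(1 / 10) - 1 : ℝ) = -(11 / 10) by norm_num, qW]
  field_simp

lemma hasDerivAt_qW (hδ : 0 < δ) (x : ℝ) : HasDerivAt (qW δ)
    (qW δ x * (invBr x * (5 / 4 - slope x - 11 / 8 * (δ * yW x / (1 + δ * yW x))))) x := by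
  have hr := (zero_lt_one.trans (one_lt_rW hδ x)).ne'
  refine ((((hasDerivAt_yW x).const_mul (5 / 4)).fun_mul (hasDerivAt_invBr x)).fun_mul
    ((hasDerivAt_rW δ x).rpow_const (Or.inl hr))).congr_deriv ?_
  rw [Real.rpow_sub_one hr, qW]
  field_simp
  ring

lemma qW_pos (hδ : 0 < δ) (x : ℝ) : 0 < qW δ x := by
  have := zero_lt_one.trans (one_lt_rW hδ x)
  have := yW_pos x
  have := invBr_pos x
  have := Real.rpow_pos_of_pos ‹0 < 1 + δ * yW x› (-(11 / 10) : ℝ)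
  rw [qW]; positivity

/-- The tenth root of `1 + δ y`. -/
lemma exists_root (hδ : 0 < δ) (x : ℝ) : ∃ s : ℝ, 1 < s ∧ δ * yW x = s ^ 10 - 1 ∧
    pW δ x = 10 / δ * (1 - s⁻¹) ∧ qW δ x = 5 / 4 * yW x * invBr x * (s ^ 11)⁻¹ := by
  have h1 := one_lt_rW hδ x
  have hr := zero_lt_one.trans h1
  refine ⟨(1 + δ * yW x) ^ (1 / 10 : ℝ), Real.one_lt_rpow h1 (by norm_num), ?_, ?_, ?_⟩
  · rw [← Real.rpow_natCast, ← Real.rpow_mul hr.le]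
    norm_num
  · rw [pW, Real.rpow_neg hr.le]
  · rw [← Real.rpow_natCast, ← Real.rpow_mul hr.le, qW, Real.rpow_neg hr.le]
    norm_num

lemma pW_nonneg (hδ : 0 < δ) (x : ℝ) : 0 ≤ pW δ x := by
  obtain ⟨s, hs, -, hp, -⟩ := exists_root hδ x
  have : s⁻¹ ≤ 1 := inv_le_one_of_one_le₀ hs.le
  rw [hp]
  exact mul_nonneg (by positivity) (by linarith)

lemma pW_le_const (hδ : 0 < δ) (x : ℝ) : pW δ x ≤ 10 / δ := by
  obtain ⟨s, hs, -, hp, -⟩ := exists_root hδ x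
  have : 0 < s⁻¹ := inv_pos.2 (by linarith)
  rw [hp]
  exact mul_le_of_le_one_right (by positivity) (by linarith)

/-- As a function of `y`, the truncation is concave, vanishes at `0` and has slope `1` there. In
terms of the tenth root `s` the claim is Bernoulli's inequality `s^10 - 1 ≥ 10 (s - 1)` followed by
`s - 1 ≥ 1 - 1/s`. -/
lemma pW_le_yW (hδ : 0 < δ) (x : ℝ) : pW δ x ≤ yW x := by
  obtain ⟨s, hs, hy, hp, -⟩ := exists_root hδ x
  have hs0 : 0 < s := by linarith
  have e : yW x = (s ^ 10 - 1) / δ := by rw [← hy]; field_simp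
  rw [hp, e, div_mul_eq_mul_div, div_le_div_iff_of_pos_right hδ]
  have h1 := one_add_mul_le_pow (a := s - 1) (by linarith) 10
  rw [add_sub_cancel] at h1
  have h2 : 1 - s⁻¹ ≤ s - 1 := by
    have : (s - 1) ^ 2 / s = s - 2 + s⁻¹ := by field_simp; ring
    have : 0 ≤ (s - 1) ^ 2 / s := by positivity
    linarith
  push_cast at h1
  linarith

/-- A concave function vanishing at `0` dominates `y` times its derivative. With the tenth root `s`
this is the geometric sum `s^10 - 1 = (s - 1) ∑ s^i`, each of whose ten terms is at most `s^10`. -/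
lemma mul_rpow_le_pW (hδ : 0 < δ) (x : ℝ) : yW x * (1 + δ * yW x) ^ (-(11 / 10) : ℝ) ≤ pW δ x := by
  have h1 := one_lt_rW hδ x
  have hr := zero_lt_one.trans h1
  obtain ⟨s, hs, hy, hp, hq⟩ := exists_root hδ x
  have hs0 : 0 < s := by linarith
  have e' : (1 + δ * yW x) ^ (-(11 / 10) : ℝ) = (s ^ 11)⁻¹ := by
    rw [qW] at hq
    have := (yW_pos x).ne'
    have := (invBr_pos x).ne'
    refine mul_left_cancel₀ (a := 5 / 4 * yW x * invBr x) (by positivity) hq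
  have e : yW x = (s ^ 10 - 1) / δ := by rw [← hy]; field_simp
  rw [e', hp, e, div_mul_eq_mul_div, div_mul_eq_mul_div, div_le_div_iff_of_pos_right hδ,
    ← div_eq_mul_inv, div_le_iff₀ (by positivity)]
  have e2 : 10 * (1 - s⁻¹) * s ^ 11 = 10 * s ^ 10 * (s - 1) := by field_simp
  have e3 : s ^ 10 - 1 = (∑ i ∈ Finset.range 10, s ^ i) * (s - 1) := (geom_sum_mul s 10).symm
  rw [e2, e3]
  refine mul_le_mul_of_nonneg_right ?_ (by linarith)
  calc ∑ i ∈ Finset.range 10, s ^ i ≤ ∑ i ∈ Finset.range 10, s ^ 10 :=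
        Finset.sum_le_sum fun i hi => pow_le_pow_right₀ hs.le (Finset.mem_range.1 hi).le
    _ = 10 * s ^ 10 := by simp

/-- The truncated form of the equality `((x^{5/4})')⁵ = (5/4)⁵ x^{5/4}`, and the origin of the
factor `5⁵/4⁵` in `kConst`. The cut-off factor `R ≤ 1` enters the left side as `R⁵ ≤ R`, which
`mul_rpow_le_pW` can handle. -/
lemma qW_pow_five_le (hδ : 0 < δ) (x : ℝ) : qW δ x ^ 5 ≤ (5 / 4) ^ 5 * pW δ x := by
  have hr1 := one_lt_rW hδ x
  have hr := zero_lt_one.trans hr1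
  have hy := yW_pos x
  have hm := invBr_pos x
  set R := (1 + δ * yW x) ^ (-(11 / 10) : ℝ) with hR
  have hR0 : 0 < R := Real.rpow_pos_of_pos hr _
  have hR1 : R ≤ 1 := Real.rpow_le_one_of_one_le_of_nonpos hr1.le (by norm_num)
  have h1 : invBr x ^ 5 * yW x ^ 4 ≤ 1 := by
    rw [yW_pow_four, ← mul_pow]
    refine pow_le_one₀ (mul_nonneg hm.le (half_pos (zW_pos x)).le) ?_
    have hb := bracket_pos x
    rw [invBr, one_div, inv_mul_le_iff₀ hb, mul_one]
    exact half_zW_le x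
  have hR5 : R ^ 5 ≤ R := pow_le_of_le_one hR0.le hR1 (by norm_num)
  calc qW δ x ^ 5 = (5 / 4) ^ 5 * ((invBr x ^ 5 * yW x ^ 4) * (yW x * R ^ 5)) := by
        rw [qW]; ring
    _ ≤ (5 / 4) ^ 5 * (1 * (yW x * R)) := by gcongr
    _ ≤ (5 / 4) ^ 5 * pW δ x := by
        rw [one_mul]
        exact mul_le_mul_of_nonneg_left (mul_rpow_le_pW hδ x) (by norm_num)

/-- The exponent `1/10` in `pW` is chosen for this bound: for `δ ≤ 1` the derivative is at least of
size `⟨x⟩^{1/4}⟨x⟩^{-11/8} = ⟨x⟩^{-9/8}`, uniformly in `δ`, although `pW δ` is bounded. One factor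
`1/4` is lost in comparing `yW` with `⟨x⟩^{5/4}` and another one in the cut-off. -/
lemma decay_le_qW (hδ : 0 < δ) (hδ1 : δ ≤ 1) {x : ℝ} (hx : 0 ≤ x) :
    1 / 16 * decay x ≤ qW δ x := by
  have hr := zero_lt_one.trans (one_lt_rW hδ x)
  have hb := bracket_pos x
  have hb1 := one_le_bracket x
  have hy1 : (bracket x / 2) ^ (5 / 4 : ℝ) ≤ yW x :=
    Real.rpow_le_rpow (by positivity) (by rw [zW]; linarith) (by norm_num)
  have hy2 : yW x ≤ bracket x ^ (5 / 4 : ℝ) :=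
    Real.rpow_le_rpow (half_pos (zW_pos x)).le (half_zW_le x) (by norm_num)
  have hB : 1 ≤ bracket x ^ (5 / 4 : ℝ) := Real.one_le_rpow hb1 (by norm_num)
  have hr2 : 1 + δ * yW x ≤ 2 * bracket x ^ (5 / 4 : ℝ) := by nlinarith [yW_pos x]
  have h3 : (2 * bracket x ^ (5 / 4 : ℝ)) ^ (-(11 / 10) : ℝ) ≤ (1 + δ * yW x) ^ (-(11 / 10) : ℝ) :=
    Real.rpow_le_rpow_of_nonpos hr hr2 (by norm_num)
  rw [Real.mul_rpow (by norm_num) (by positivity), ← Real.rpow_mul hb.le] at h3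
  rw [Real.div_rpow hb.le (by norm_num)] at hy1
  have e1 : decay x = bracket x ^ (5 / 4 : ℝ) * invBr x *
      bracket x ^ (5 / 4 * -(11 / 10) : ℝ) := by
    rw [decay, invBr, one_div, ← Real.rpow_neg_one, ← Real.rpow_add hb, ← Real.rpow_add hb]
    norm_num
  have h2a : (1 / 4 : ℝ) ≤ 2 ^ (-(11 / 10) : ℝ) := by
    calc (1 / 4 : ℝ) = 2 ^ (-2 : ℝ) := by
          rw [Real.rpow_neg (by norm_num)]; norm_num
      _ ≤ _ := Real.rpow_le_rpow_of_exponent_le (by norm_num) (by norm_num)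
  have h2b : (2 : ℝ) ^ (5 / 4 : ℝ) ≤ 4 := by
    calc (2 : ℝ) ^ (5 / 4 : ℝ) ≤ 2 ^ (2 : ℝ) :=
          Real.rpow_le_rpow_of_exponent_le (by norm_num) (by norm_num)
      _ = 4 := by norm_num
  have hy3 : bracket x ^ (5 / 4 : ℝ) / 4 ≤ yW x := by
    refine le_trans ?_ hy1
    exact div_le_div_of_nonneg_left (by positivity) (by positivity) h2b
  have hm := invBr_pos x
  have hT : 0 < bracket x ^ (5 / 4 * -(11 / 10) : ℝ) := Real.rpow_pos_of_pos hb _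
  set T := bracket x ^ (5 / 4 * -(11 / 10) : ℝ)
  set R := (1 + δ * yW x) ^ (-(11 / 10) : ℝ) with hR
  have h5 : 1 / 4 * T ≤ R := le_trans (mul_le_mul_of_nonneg_right h2a hT.le) h3
  have hy := yW_pos x
  calc 1 / 16 * decay x = bracket x ^ (5 / 4 : ℝ) / 4 * invBr x * (1 / 4 * T) := by
        rw [e1]; ring
    _ ≤ yW x * invBr x * R := by gcongr
    _ ≤ qW δ x := by
        rw [qW, ← hR]
        have : 0 ≤ yW x * invBr x * R := by
          have : 0 < R := Real.rpow_pos_of_pos hr _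
          positivity
        linarith

lemma tendsto_pW (x : ℝ) : Tendsto (fun δ => pW δ x) (𝓝[>] 0) (𝓝 (yW x)) := by
  have h : Tendsto (fun δ : ℝ => yW x * (1 + δ * yW x) ^ (-(11 / 10) : ℝ)) (𝓝[>] 0)
      (𝓝 (yW x)) := by
    have hc : ContinuousAt (fun δ : ℝ => yW x * (1 + δ * yW x) ^ (-(11 / 10) : ℝ)) 0 := by
      refine continuousAt_const.mul (ContinuousAt.rpow_const (by fun_prop) (Or.inl ?_))
      simp
    have := hc.tendsto
    simp only [zero_mul, add_zero, Real.one_rpow, mul_one] at this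
    exact this.mono_left nhdsWithin_le_nhds
  refine tendsto_of_tendsto_of_tendsto_of_le_of_le' h tendsto_const_nhds ?_ ?_
  · filter_upwards [self_mem_nhdsWithin] with δ hδ using mul_rpow_le_pW hδ x
  · filter_upwards [self_mem_nhdsWithin] with δ hδ using pW_le_yW hδ x

open MvPolynomial in
/-- The logarithmic derivatives of `qW`. -/
lemma exists_deriv_qW : ∃ C : ℝ, 1 ≤ C ∧ ∀ δ : ℝ, 0 < δ → ∃ l : ℕ → ℝ → ℝ,
    (∀ x, l 0 x = 1) ∧ (∀ k, Continuous (l k)) ∧ (∀ k ≤ 4, ∀ x, |l k x| ≤ C) ∧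
    ∀ k x, HasDerivAt (fun x => qW δ x * l k x) (qW δ x * l (k + 1) x) x := by
  -- The third variable is `δ y / (1 + δ y)`, with values in `[0,1]`; since `δ` appears nowhere
  -- else, the bounds are uniform in `δ`.
  obtain ⟨C, hC0, hC⟩ := exists_derivatives_of_log_deriv (ι := Fin 3) 0
    ![-(X 1 * X 0), X 0 ^ 2, C (5 / 4) * X 2 * (1 - X 2)] (C (5 / 4) - X 1 - C (11 / 8) * X 2)
  refine ⟨1 + ∑ k ∈ Finset.range 6, C k, le_add_of_nonneg_right
    (Finset.sum_nonneg fun k _ => hC0 k), fun δ hδ => ?_⟩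
  have hr : ∀ x, 1 + δ * yW x ≠ 0 := fun x => (zero_lt_one.trans (one_lt_rW hδ x)).ne'
  set s : ℝ → ℝ := fun x => δ * yW x / (1 + δ * yW x) with hs
  have ds : ∀ x, HasDerivAt s (invBr x * (5 / 4 * s x * (1 - s x))) x := fun x => by
    refine (((hasDerivAt_yW x).const_mul δ).fun_div (hasDerivAt_rW δ x) (hr x)).congr_deriv ?_
    have := hr x
    simp only [hs]
    field_simp
  obtain ⟨p, hp0, -, hpc, hp⟩ := hC ![invBr, slope, s] (qW δ)
    (by
      simp only [Fin.forall_fin_succ, IsEmpty.forall_iff, and_true]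
      refine ⟨fun x => (abs_invBr x).trans_le (invBr_le_one x), abs_slope_le, fun x => ?_⟩
      have h1 := one_lt_rW hδ x
      change |δ * yW x / (1 + δ * yW x)| ≤ 1
      rw [abs_of_nonneg (div_nonneg (by linarith) (by linarith)), div_le_one (by linarith)]
      linarith)
    (by
      simp only [Fin.forall_fin_succ, IsEmpty.forall_iff, and_true]
      exact ⟨fun x => by simpa using hasDerivAt_invBr x,
        fun x => by simpa using hasDerivAt_slope x, fun x => by simpa using ds x⟩)
    (fun x => by simpa using hasDerivAt_qW hδ x)
  refine ⟨p, hp0, hpc, fun k hk x => (hp k x).2.1.trans ?_, fun k x => (hp k x).1⟩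
  have := Finset.single_le_sum (f := C) (fun k _ => hC0 k) (Finset.mem_range.2 (by lia : k < 6))
  linarith

end

/-! ### Weighted interpolation and pointwise decay. -/

/-- An `L2Tower` all of whose members belong to `L²(⟨x⟩⁴ dx)`. -/
structure WTower (V : ℕ → ℝ → ℝ) : Prop extends L2Tower V where
  memLp_weight : ∀ k, MemLp (fun x => brPow 2 x * V k x) 2 volume

/-- The weighted square integrals `∫ ⟨x⟩^{4-j/2} (∂^j v)²`. -/
def wInt (V : ℕ → ℝ → ℝ) (j : ℕ) : ℝ := ∫ x, brPow (4 - j / 2) x * V j x ^ 2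

lemma integrable_weight_mul {κ f g : ℝ → ℝ} (hκ : Continuous κ) {C : ℝ}
    (hC : ∀ x, |κ x| ≤ C * brPow 4 x)
    (hf : MemLp (fun x => brPow 2 x * f x) 2 volume)
    (hg : MemLp (fun x => brPow 2 x * g x) 2 volume) :
    Integrable (fun x => κ x * f x * g x) := by
  have h : BddCont (fun x => κ x * brPow (-4) x) := by
    refine ⟨hκ.mul (continuous_brPow _), C, fun x => ?_⟩
    rw [abs_mul, abs_of_pos (brPow_pos _ x)]
    calc |κ x| * brPow (-4) x ≤ C * brPow 4 x * brPow (-4) x :=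
          mul_le_mul_of_nonneg_right (hC x) (brPow_pos _ x).le
      _ = C := by rw [mul_assoc, ← brPow_add]; norm_num [brPow_zero]
  refine (h.integrable_mul_mul hf hg).congr (ae_of_all _ fun x => ?_)
  have e : brPow (-4) x * (brPow 2 x * brPow 2 x) = 1 := by
    rw [← brPow_add, ← brPow_add]; norm_num [brPow_zero]
  calc κ x * brPow (-4) x * (brPow 2 x * f x) * (brPow 2 x * g x)
      = κ x * f x * g x * (brPow (-4) x * (brPow 2 x * brPow 2 x)) := by ring
    _ = κ x * f x * g x := by rw [e, mul_one]

lemma abs_brPow_le {s : ℝ} (hs : s ≤ 4) (x : ℝ) : |brPow s x| ≤ 1 * brPow 4 x := by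
  rw [abs_of_pos (brPow_pos s x), one_mul]
  exact brPow_mono hs x

lemma WTower.integrable {V : ℕ → ℝ → ℝ} (hV : WTower V) {s : ℝ} (hs : s ≤ 4) (i : ℕ) :
    Integrable (fun x => brPow s x * V i x ^ 2) := by
  simpa only [pow_two, mul_assoc] using integrable_weight_mul (continuous_brPow s)
    (abs_brPow_le hs) (hV.memLp_weight i) (hV.memLp_weight i)

lemma wInt_nonneg (V : ℕ → ℝ → ℝ) (j : ℕ) : 0 ≤ wInt V j :=
  integral_nonneg fun x => mul_nonneg (brPow_pos _ x).le (sq_nonneg _)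

lemma WTower.integral_le_wInt {V : ℕ → ℝ → ℝ} (hV : WTower V) {s : ℝ} {j : ℕ}
    (hs : s ≤ 4 - j / 2) : ∫ x, brPow s x * V j x ^ 2 ≤ wInt V j := by
  have hj : (0 : ℝ) ≤ j / 2 := by positivity
  exact integral_mono (hV.integrable (by linarith) j) (hV.integrable (by linarith) j) fun x =>
    mul_le_mul_of_nonneg_right (brPow_mono hs x) (sq_nonneg _)

lemma WTower.integral_sq_le_wInt {V : ℕ → ℝ → ℝ} (hV : WTower V) {j : ℕ} (hj : j ≤ 8) :
    ∫ x, V j x ^ 2 ≤ wInt V j := by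
  have h8 : (j : ℝ) ≤ 8 := by exact_mod_cast hj
  simpa [brPow_zero] using hV.integral_le_wInt (s := 0) (j := j) (by linarith)

lemma two_mul_le_of_split {η : ℝ} (hη : 0 < η) (P Q a b : ℝ) :
    2 * (P * Q * |a * b|) ≤ η * (Q ^ 2 * b ^ 2) + η⁻¹ * (P ^ 2 * a ^ 2) := by
  have h : 0 ≤ η * (Q * |b| - η⁻¹ * (P * |a|)) ^ 2 := by positivity
  have e : η * (Q * |b| - η⁻¹ * (P * |a|)) ^ 2 =
      η * (Q ^ 2 * b ^ 2) + η⁻¹ * (P ^ 2 * a ^ 2) - 2 * (P * Q * |a * b|) := by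
    rw [abs_mul, ← sq_abs a, ← sq_abs b]
    field_simp
    ring
  linarith

/-- Integration by parts gives `∫ ω v_{j+1}² = -∫ ω v_j v_{j+2} + (1/2) ∫ ω'' v_j²`. Each derivative
costs half a power of `⟨x⟩`, so the exponent of `ω` is the mean of those for `j` and `j + 2`, and
the mixed term splits accordingly. -/
lemma wInt_step : ∃ C : ℝ, 0 ≤ C ∧ ∀ V, WTower V → ∀ j, j ≤ 6 → ∀ η : ℝ, 0 < η →
    wInt V (j + 1) ≤ η * wInt V (j + 2) + (η⁻¹ + C) * wInt V j := by
  choose C D₁ D₂ hC hD₁ hD₂ d₁ d₂ hb using fun j : ℕ => exists_deriv_brPow (4 - (j + 1 : ℕ) / 2)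
  refine ⟨∑ j ∈ Finset.range 7, C j, Finset.sum_nonneg fun j _ => hC j,
    fun V hV j hj η hη => ?_⟩
  have hCj : C j ≤ ∑ j ∈ Finset.range 7, C j :=
    Finset.single_le_sum (fun j _ => hC j) (Finset.mem_range.2 (by lia))
  have hs4 : (4 - ((j + 1 : ℕ) : ℝ) / 2) ≤ 4 := by
    have : (0 : ℝ) ≤ ((j + 1 : ℕ) : ℝ) / 2 := by positivity
    linarith
  set s : ℝ := 4 - ((j + 1 : ℕ) : ℝ) / 2 with hs
  have hbr : ∀ x, brPow s x * invBr x ≤ brPow s x := fun x =>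
    mul_le_of_le_one_right (brPow_pos _ x).le (invBr_le_one x)
  have hD1b : ∀ x, |D₁ j x| ≤ C j * brPow 4 x := fun x => ((hb j x).1.trans
    (mul_le_mul_of_nonneg_left ((hbr x).trans (brPow_mono hs4 x)) (hC j)))
  have hD2b : ∀ x, |D₂ j x| ≤ C j * brPow s x := fun x => (hb j x).2.trans
    (mul_le_mul_of_nonneg_left (hbr x) (hC j))
  have hD2b' : ∀ x, |D₂ j x| ≤ C j * brPow 4 x := fun x => (hD2b x).trans
    (mul_le_mul_of_nonneg_left (brPow_mono hs4 x) (hC j))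
  have i1 := fun i k => integrable_weight_mul (hD₁ j) hD1b (hV.memLp_weight i) (hV.memLp_weight k)
  have i2 := fun i k => integrable_weight_mul (hD₂ j) hD2b' (hV.memLp_weight i) (hV.memLp_weight k)
  have i0 := fun i k => integrable_weight_mul (continuous_brPow s) (abs_brPow_le hs4)
    (hV.memLp_weight i) (hV.memLp_weight k)
  have r1 : ∫ x, (D₁ j x * V j x * V (j + 1) x + brPow s x * V (j + 1) x * V (j + 1) x +
      brPow s x * V j x * V (j + 2) x) = 0 := by
    refine integral_eq_zero_of_hasDerivAt_of_integrable
      (f := fun x => brPow s x * V j x * V (j + 1) x) (fun x => ?_)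
      (((i1 _ _).add (i0 _ _)).add (i0 _ _)) (i0 _ _)
    exact (((d₁ j x).fun_mul (hV.hasDerivAt j x)).fun_mul (hV.hasDerivAt (j + 1) x)).congr_deriv
      (by ring)
  have r2 : ∫ x, (D₂ j x * V j x * V j x + 2 * (D₁ j x * V j x * V (j + 1) x)) = 0 := by
    refine integral_eq_zero_of_hasDerivAt_of_integrable
      (f := fun x => D₁ j x * V j x * V j x) (fun x => ?_)
      ((i2 _ _).add ((i1 _ _).const_mul 2)) (i1 _ _)
    exact (((d₂ j x).fun_mul (hV.hasDerivAt j x)).fun_mul (hV.hasDerivAt j x)).congr_deriv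
      (by ring)
  have i01 : Integrable (fun x => D₁ j x * V j x * V (j + 1) x +
    brPow s x * V (j + 1) x * V (j + 1) x) := (i1 _ _).add (i0 _ _)
  rw [integral_add i01 (i0 _ _), integral_add (i1 _ _) (i0 _ _)] at r1
  rw [integral_add (i2 _ _) ((i1 _ _).const_mul 2), integral_const_mul] at r2
  have hj0 : (0 : ℝ) ≤ j / 2 := by positivity
  have b1 : ∫ x, D₂ j x * V j x * V j x ≤ C j * wInt V j := by
    rw [wInt, ← integral_const_mul]
    refine integral_mono (i2 _ _) ((hV.integrable (by linarith) j).const_mul _) fun x => ?_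
    have h1 : brPow s x ≤ brPow (4 - j / 2) x := brPow_mono (by rw [hs]; push_cast; linarith) x
    calc D₂ j x * V j x * V j x = D₂ j x * V j x ^ 2 := by ring
      _ ≤ (C j * brPow (4 - j / 2) x) * V j x ^ 2 := by
          refine mul_le_mul_of_nonneg_right ((le_abs_self _).trans ((hD2b x).trans ?_)) (sq_nonneg _)
          exact mul_le_mul_of_nonneg_left h1 (hC j)
      _ = _ := by ring
  have b2 : -2 * ∫ x, brPow s x * V j x * V (j + 2) x ≤ η * wInt V (j + 2) + η⁻¹ * wInt V j := by
    rw [wInt, wInt, ← integral_const_mul, ← integral_const_mul, ← integral_const_mul,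
      ← integral_add]
    rotate_left
    · refine (hV.integrable ?_ _).const_mul _
      have : (0 : ℝ) ≤ ((j + 2 : ℕ) : ℝ) / 2 := by positivity
      linarith
    · exact (hV.integrable (by linarith) j).const_mul _
    refine integral_mono ((i0 _ _).const_mul _) (((hV.integrable ?_ _).const_mul _).add
      ((hV.integrable (by linarith) j).const_mul _)) fun x => ?_
    · have : (0 : ℝ) ≤ ((j + 2 : ℕ) : ℝ) / 2 := by positivity
      linarith
    have h := two_mul_le_of_split hη (brPow ((4 - j / 2) / 2) x)
      (brPow ((4 - ((j + 2 : ℕ) : ℝ) / 2) / 2) x) (V j x) (V (j + 2) x)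
    have e1 : brPow s x = brPow ((4 - j / 2) / 2) x * brPow ((4 - ((j + 2 : ℕ) : ℝ) / 2) / 2) x := by
      rw [← brPow_add, hs]; congr 1; push_cast; ring
    have e2 : ∀ t, brPow t x = brPow (t / 2) x ^ 2 := fun t => by
      rw [pow_two, ← brPow_add]; congr 1; ring
    rw [← e1, ← e2, ← e2] at h
    refine le_trans ?_ h
    have h2 := neg_abs_le (V j x * V (j + 2) x)
    have h3 := brPow_pos s x
    change -2 * (brPow s x * V j x * V (j + 2) x) ≤ _
    nlinarith
  have e : ∫ x, brPow s x * V (j + 1) x * V (j + 1) x = wInt V (j + 1) := by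
    rw [wInt]; congr 1; ext x; ring
  have h0 := wInt_nonneg V j
  have h1 := wInt_nonneg V (j + 2)
  have h2 := mul_le_mul_of_nonneg_right hCj h0
  have h3 := mul_nonneg hη.le h1
  have h4 := mul_nonneg (inv_nonneg.2 hη.le) h0
  have h5 := mul_nonneg (hC j) h0
  rw [e] at r1
  linarith

/-- A sequence satisfying interpolation inequalities is bounded by its end points. -/
lemma exists_bound_of_interpolation (C : ℝ) (hC : 0 ≤ C) (n : ℕ) : ∃ K : ℝ, ∀ A : ℕ → ℝ,
    (∀ j, 0 ≤ A j) → (∀ j, j + 2 ≤ n → ∀ η : ℝ, 0 < η →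
      A (j + 1) ≤ η * A (j + 2) + (η⁻¹ + C) * A j) → ∀ j ≤ n, A j ≤ K * (A 0 + A n) := by
  have step : ∀ j, ∀ η : ℝ, 0 < η → ∃ K : ℝ, 0 ≤ K ∧ ∀ A : ℕ → ℝ, (∀ j, 0 ≤ A j) →
      (∀ j, j + 2 ≤ n → ∀ η : ℝ, 0 < η → A (j + 1) ≤ η * A (j + 2) + (η⁻¹ + C) * A j) →
      j + 1 ≤ n → A j ≤ η * A (j + 1) + K * A 0 := by
    intro j
    induction j with
    | zero => exact fun η hη => ⟨1, zero_le_one, fun A hA _ _ => by nlinarith [hA 0, hA 1]⟩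
    | succ j ih =>
      intro η hη
      set c : ℝ := (η / 2)⁻¹ + C with hc
      have hc0 : 0 < c := by positivity
      -- With this choice the induction hypothesis, multiplied by `c`, returns `A (j + 1) / 2`,
      -- which is absorbed on the left.
      obtain ⟨K, hK, hKA⟩ := ih (1 / (2 * c)) (by positivity)
      refine ⟨2 * c * K, by positivity, fun A hA h hj => ?_⟩
      have h1 := h j hj (η / 2) (half_pos hη)
      have h2 := hKA A hA h (by lia)
      have h3 : c * A j ≤ c * (1 / (2 * c) * A (j + 1) + K * A 0) :=
        mul_le_mul_of_nonneg_left h2 hc0.le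
      have h4 : c * (1 / (2 * c) * A (j + 1) + K * A 0) = 1 / 2 * A (j + 1) + c * K * A 0 := by
        field_simp
      change A (j + 1) ≤ _
      linarith
  choose K hK hKA using fun j => step j 1 one_pos
  -- Each term is now bounded by its successor and `A 0`, so a descent from `A n` reaches all
  -- indices.
  have desc : ∀ i, i ≤ n → ∃ L : ℝ, 0 ≤ L ∧ ∀ A : ℕ → ℝ, (∀ j, 0 ≤ A j) →
      (∀ j, j + 2 ≤ n → ∀ η : ℝ, 0 < η → A (j + 1) ≤ η * A (j + 2) + (η⁻¹ + C) * A j) →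
      A (n - i) ≤ L * (A 0 + A n) := by
    intro i
    induction i with
    | zero => exact fun _ => ⟨1, zero_le_one, fun A hA _ => by simpa using hA 0⟩
    | succ i ih =>
      intro hi
      obtain ⟨L, hL, hLA⟩ := ih (by lia)
      refine ⟨L + K (n - (i + 1)), add_nonneg hL (hK _), fun A hA h => ?_⟩
      have h1 := hKA (n - (i + 1)) A hA h (by lia)
      have e : n - (i + 1) + 1 = n - i := by lia
      rw [e] at h1
      have h2 := hLA A hA h
      nlinarith [hA 0, hA n, hK (n - (i + 1)), mul_nonneg (hK (n - (i + 1))) (hA n)]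
  choose! L hL hLA using desc
  refine ⟨∑ i ∈ Finset.range (n + 1), L i, fun A hA h j hj => ?_⟩
  have h1 := hLA (n - j) (by lia) A hA h
  rw [show n - (n - j) = j by lia] at h1
  refine h1.trans (mul_le_mul_of_nonneg_right ?_ (add_nonneg (hA 0) (hA n)))
  exact Finset.single_le_sum (f := L) (fun i hi => hL i (by simpa [Nat.lt_succ_iff] using hi))
    (Finset.mem_range.2 (by lia))

/-- The quantitative consequences of bounds for `∫ ⟨x⟩⁴ v²` and `∫ (∂⁸v)²`. -/
structure DecayBound (C : ℝ) (V : ℕ → ℝ → ℝ) : Prop where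
  wInt_le : ∀ j ≤ 8, wInt V j ≤ C
  abs_le_decay : ∀ j ≤ 3, ∀ x, |V j x| ≤ C * decay x
  abs_le : ∀ j ≤ 7, ∀ x, |V j x| ≤ C

lemma decay_sq (x : ℝ) : decay x ^ 2 * brPow (9 / 4) x = 1 := by
  have : decay x = brPow (-(9 / 8)) x := rfl
  rw [this, pow_two, ← brPow_add, ← brPow_add]
  norm_num [brPow_zero]

/-- The function `⟨x⟩^{9/4} v_j²` is bounded by the integral of its derivative, whose main term
`⟨x⟩^{9/4} v_j v_{j+1}` is split into `⟨x⟩^{5/2} v_j²` and `⟨x⟩² v_{j+1}²`. For `j = 3` these are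
exactly the available weights `4 - 3/2` and `4 - 4/2`; this is the origin of the exponent `9/8`. -/
lemma WTower.exists_pointwise_decay : ∃ K : ℝ, 0 ≤ K ∧ ∀ V, WTower V → ∀ j ≤ 3, ∀ x,
    V j x ^ 2 ≤ K * (wInt V j + wInt V (j + 1)) * decay x ^ 2 := by
  obtain ⟨C, D₁, D₂, hC, hD₁, hD₂, d₁, d₂, hb⟩ := exists_deriv_brPow (9 / 4)
  refine ⟨C + 1, by positivity, fun V hV j hj x => ?_⟩
  have hj3 : (j : ℝ) ≤ 3 := by exact_mod_cast hj
  have hj0 : (0 : ℝ) ≤ j := Nat.cast_nonneg j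
  have hw : ∀ x, brPow (9 / 4) x * invBr x ≤ brPow (9 / 4) x := fun x =>
    mul_le_of_le_one_right (brPow_pos _ x).le (invBr_le_one x)
  have hD1 : ∀ x, |D₁ x| ≤ C * brPow (9 / 4) x := fun x => (hb x).1.trans
    (mul_le_mul_of_nonneg_left (hw x) hC)
  have hD14 : ∀ x, |D₁ x| ≤ C * brPow 4 x := fun x => (hD1 x).trans
    (mul_le_mul_of_nonneg_left (brPow_mono (by norm_num) x) hC)
  have i1 := integrable_weight_mul hD₁ hD14 (hV.memLp_weight j) (hV.memLp_weight j)
  have i0 := fun k => integrable_weight_mul (continuous_brPow (9 / 4)) (abs_brPow_le (by norm_num))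
    (hV.memLp_weight j) (hV.memLp_weight k)
  have i' : Integrable (fun x => D₁ x * V j x * V j x + 2 * (brPow (9 / 4) x * V j x * V (j + 1) x)) :=
    i1.add ((i0 _).const_mul 2)
  have key := abs_le_integral_abs_deriv (F := fun x => brPow (9 / 4) x * V j x * V j x)
    (fun x => ((((d₁ x).fun_mul (hV.hasDerivAt j x)).fun_mul (hV.hasDerivAt j x)).congr_deriv
      (by ring : _ = D₁ x * V j x * V j x + 2 * (brPow (9 / 4) x * V j x * V (j + 1) x))))
    (i0 _) i' x
  have hI : ∫ x, |D₁ x * V j x * V j x + 2 * (brPow (9 / 4) x * V j x * V (j + 1) x)| ≤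
      (C + 1) * wInt V j + wInt V (j + 1) := by
    rw [wInt, wInt, ← integral_const_mul, ← integral_add]
    rotate_left
    · exact (hV.integrable (by linarith) j).const_mul _
    · exact hV.integrable (by push_cast; linarith) _
    refine integral_mono i'.abs (((hV.integrable (by linarith) j).const_mul _).add
      (hV.integrable (by push_cast; linarith) _)) fun x => ?_
    have h := two_mul_le_of_split one_pos (brPow (5 / 4) x) (brPow 1 x) (V j x) (V (j + 1) x)
    rw [pow_two (brPow _ _), pow_two (brPow _ _), ← brPow_add, ← brPow_add, ← brPow_add,
      one_mul, inv_one, one_mul] at h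
    have h1 : brPow (1 + 1) x ≤ brPow (4 - ((j + 1 : ℕ) : ℝ) / 2) x :=
      brPow_mono (by push_cast; linarith) x
    have h2 : brPow (5 / 4 + 5 / 4) x ≤ brPow (4 - (j : ℝ) / 2) x := brPow_mono (by linarith) x
    have h3 : brPow (9 / 4) x ≤ brPow (4 - (j : ℝ) / 2) x := brPow_mono (by linarith) x
    have e : (5 / 4 + 1 : ℝ) = 9 / 4 := by norm_num
    rw [e] at h
    have a1 : |D₁ x * V j x * V j x| ≤ C * brPow (4 - (j : ℝ) / 2) x * V j x ^ 2 := by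
      rw [mul_assoc, abs_mul, ← pow_two, abs_of_nonneg (sq_nonneg (V j x))]
      exact mul_le_mul_of_nonneg_right ((hD1 x).trans (mul_le_mul_of_nonneg_left h3 hC))
        (sq_nonneg _)
    have a2 : |2 * (brPow (9 / 4) x * V j x * V (j + 1) x)| =
        2 * (brPow (9 / 4) x * |V j x * V (j + 1) x|) := by
      rw [abs_mul, abs_two, mul_assoc, abs_mul, abs_of_pos (brPow_pos _ x)]
    have h4 := mul_le_mul_of_nonneg_right h1 (sq_nonneg (V (j + 1) x))
    have h5 := mul_le_mul_of_nonneg_right h2 (sq_nonneg (V j x))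
    change |D₁ x * V j x * V j x + 2 * (brPow (9 / 4) x * V j x * V (j + 1) x)| ≤
      (C + 1) * (brPow (4 - (j : ℝ) / 2) x * V j x ^ 2) +
        brPow (4 - ((j + 1 : ℕ) : ℝ) / 2) x * V (j + 1) x ^ 2
    refine (abs_add_le _ _).trans ?_
    rw [a2]
    linarith
  have h0 := wInt_nonneg V j
  have h1 := wInt_nonneg V (j + 1)
  have key2 : brPow (9 / 4) x * V j x ^ 2 ≤ (C + 1) * (wInt V j + wInt V (j + 1)) := by
    have := (le_abs_self _).trans (key.trans hI)
    nlinarith [mul_nonneg hC h1]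
  calc V j x ^ 2 = decay x ^ 2 * (brPow (9 / 4) x * V j x ^ 2) := by
        rw [← mul_assoc, decay_sq, one_mul]
    _ ≤ decay x ^ 2 * ((C + 1) * (wInt V j + wInt V (j + 1))) :=
        mul_le_mul_of_nonneg_left key2 (sq_nonneg _)
    _ = _ := by ring

/-- Bounds for `∫ ⟨x⟩⁴ v²` and `∫ (∂⁸v)²` imply pointwise decay. -/
lemma exists_decayBound (M : ℝ) : ∃ C : ℝ, 1 ≤ C ∧ ∀ V, WTower V → wInt V 0 ≤ M →
    ∫ x, V 8 x ^ 2 ≤ M → DecayBound C V := by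
  obtain ⟨C₁, hC₁, h₁⟩ := wInt_step
  obtain ⟨K, hK⟩ := exists_bound_of_interpolation C₁ hC₁ 8
  obtain ⟨K₂, hK₂, h₂⟩ := WTower.exists_pointwise_decay
  set B : ℝ := |K| * (2 * |M|) with hB
  have hB0 : 0 ≤ B := by positivity
  refine ⟨1 + B + (1 + 2 * K₂ * B + 2 * B), by nlinarith [mul_nonneg hK₂ hB0], fun V hV h0 h8 => ?_⟩
  -- At order eight the exponent `4 - 8/2` of the weight vanishes, so the interpolation ends in an
  -- unweighted norm.
  have hw8 : wInt V 8 = ∫ x, V 8 x ^ 2 := by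
    rw [wInt]; congr 1; ext x; norm_num [brPow_zero]
  have hA : ∀ j ≤ 8, wInt V j ≤ B := fun j hj => by
    refine (hK (wInt V) (wInt_nonneg V) (fun j hj => h₁ V hV j (by lia)) j hj).trans ?_
    have e0 := wInt_nonneg V 0
    have e8 := wInt_nonneg V 8
    have e1 := le_abs_self M
    refine mul_le_mul (le_abs_self K) ?_ (add_nonneg e0 e8) (abs_nonneg K)
    rw [hw8] at e8 ⊢
    linarith
  have sq_le : ∀ {a b : ℝ}, 0 ≤ b → a ^ 2 ≤ b → |a| ≤ 1 + b := fun {a b} hb h => by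
    rw [← sq_abs] at h
    nlinarith [abs_nonneg a]
  refine ⟨fun j hj => (hA j hj).trans (by nlinarith [mul_nonneg hK₂ hB0]), fun j hj x => ?_,
    fun j hj x => ?_⟩
  · have h := h₂ V hV j hj x
    have hd := decay_pos x
    have e1 : (V j x / decay x) ^ 2 ≤ 2 * K₂ * B := by
      rw [div_pow, div_le_iff₀ (by positivity)]
      refine h.trans (mul_le_mul_of_nonneg_right ?_ (sq_nonneg _))
      have a1 := hA j (by lia)
      have a2 := hA (j + 1) (by lia)
      nlinarith
    have e2 := sq_le (by positivity) e1
    rw [abs_div, abs_of_pos hd, div_le_iff₀ hd] at e2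
    refine e2.trans (mul_le_mul_of_nonneg_right (by linarith) hd.le)
  · have h := sq_le_integral_sq_add (hV.hasDerivAt j) (hV.memLp j) (hV.memLp (j + 1)) x
    have a1 := (hV.integral_sq_le_wInt (j := j) (by lia)).trans (hA j (by lia))
    have a2 := (hV.integral_sq_le_wInt (j := j + 1) (by lia)).trans (hA (j + 1) (by lia))
    have := sq_le (by positivity) (h.trans (by linarith : _ ≤ 2 * B))
    have := mul_nonneg hK₂ hB0
    linarith

/-! ### Bounds of the nonlinearity and the a priori estimate of the weighted norm. -/

variable {V W : ℕ → ℝ → ℝ}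

/-- The constant of the Lipschitz bound of a differential polynomial. -/
def DiffPoly.lip (C : ℝ) (P : DiffPoly) : ℝ :=
  (P.map fun p => |p.1| * (p.2.length * C ^ p.2.length)).sum

lemma DiffPoly.lip_nonneg {C : ℝ} (hC : 0 ≤ C) (P : DiffPoly) : 0 ≤ P.lip C :=
  List.sum_nonneg fun y hy => by
    obtain ⟨p, -, rfl⟩ := List.mem_map.1 hy
    positivity

lemma DiffPoly.abs_eval_sub_le_mul {C θ d x : ℝ} (hC : 1 ≤ C) (hθ0 : 0 ≤ θ) (hθ : θ ≤ 1)
    {P : DiffPoly} (hP : ∀ p ∈ P, 2 ≤ p.2.length)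
    (h : ∀ p ∈ P, ∀ i ∈ p.2, |V i x| ≤ C * θ) (h' : ∀ p ∈ P, ∀ i ∈ p.2, |W i x| ≤ C * θ)
    (hd : ∀ p ∈ P, ∀ i ∈ p.2, |V i x - W i x| ≤ d) :
    |DiffPoly.eval V P x - DiffPoly.eval W P x| ≤ P.lip C * θ * d := by
  induction P with
  | nil => simp [DiffPoly.lip]
  | cons p P ih =>
    simp only [List.mem_cons, forall_eq_or_imp] at hP h h' hd
    have h1 := abs_monEval_sub_le_mul hC hθ0 hθ hP.1 h.1 h'.1 hd.1
    have h2 := ih hP.2 h.2 h'.2 hd.2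
    rw [DiffPoly.eval_cons, DiffPoly.eval_cons]
    have e : p.1 * monEval V p.2 x + DiffPoly.eval V P x -
        (p.1 * monEval W p.2 x + DiffPoly.eval W P x) =
        p.1 * (monEval V p.2 x - monEval W p.2 x) +
          (DiffPoly.eval V P x - DiffPoly.eval W P x) := by ring
    have e2 : DiffPoly.lip C (p :: P) = |p.1| * (p.2.length * C ^ p.2.length) + DiffPoly.lip C P := by
      simp [DiffPoly.lip]
    rw [e, e2]
    refine (abs_add_le _ _).trans ?_
    rw [abs_mul]
    have := mul_le_mul_of_nonneg_left h1 (abs_nonneg p.1)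
    linarith

lemma DiffPoly.abs_eval_sub_le {C d x : ℝ} (hC : 1 ≤ C) {P : DiffPoly}
    (h : ∀ p ∈ P, ∀ i ∈ p.2, |V i x| ≤ C) (h' : ∀ p ∈ P, ∀ i ∈ p.2, |W i x| ≤ C)
    (hd : ∀ p ∈ P, ∀ i ∈ p.2, |V i x - W i x| ≤ d) :
    |DiffPoly.eval V P x - DiffPoly.eval W P x| ≤ P.lip C * d := by
  induction P with
  | nil => simp [DiffPoly.lip]
  | cons p P ih =>
    simp only [List.mem_cons, forall_eq_or_imp] at h h' hd
    have h1 := abs_monEval_sub_le hC h.1 h'.1 hd.1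
    have h2 := ih h.2 h'.2 hd.2
    rw [DiffPoly.eval_cons, DiffPoly.eval_cons]
    have e : p.1 * monEval V p.2 x + DiffPoly.eval V P x -
        (p.1 * monEval W p.2 x + DiffPoly.eval W P x) =
        p.1 * (monEval V p.2 x - monEval W p.2 x) +
          (DiffPoly.eval V P x - DiffPoly.eval W P x) := by ring
    have e2 : DiffPoly.lip C (p :: P) = |p.1| * (p.2.length * C ^ p.2.length) + DiffPoly.lip C P := by
      simp [DiffPoly.lip]
    rw [e, e2]
    refine (abs_add_le _ _).trans ?_
    rw [abs_mul]
    have := mul_le_mul_of_nonneg_left h1 (abs_nonneg p.1)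
    linarith

lemma monEval_zero {l : List ℕ} (h : 1 ≤ l.length) (x : ℝ) :
    monEval (fun _ _ => (0 : ℝ)) l x = 0 := by
  cases l with
  | nil => simp at h
  | cons i l => simp

lemma DiffPoly.eval_zero {P : DiffPoly} (hP : ∀ p ∈ P, 1 ≤ p.2.length) (x : ℝ) :
    DiffPoly.eval (fun _ _ => (0 : ℝ)) P x = 0 := by
  induction P with
  | nil => rfl
  | cons p P ih =>
    simp only [List.mem_cons, forall_eq_or_imp] at hP
    rw [DiffPoly.eval_cons, ih hP.2, monEval_zero hP.1]; ring

lemma continuous_monEval (hV : ∀ i, Continuous (V i)) (l : List ℕ) : Continuous (monEval V l) := by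
  induction l with
  | nil => exact continuous_const
  | cons i l ih =>
    have : monEval V (i :: l) = fun x => V i x * monEval V l x := by ext; simp
    rw [this]
    exact (hV i).mul ih

lemma L2Tower.bddCont_monEval (hV : L2Tower V) (l : List ℕ) : BddCont (monEval V l) := by
  induction l with
  | nil => exact BddCont.const 1
  | cons i l ih =>
    have : monEval V (i :: l) = fun x => V i x * monEval V l x := by ext; simp
    rw [this]
    exact (hV.bddCont i).mul ih

lemma L2Tower.bddCont_eval (hV : L2Tower V) (P : DiffPoly) : BddCont (DiffPoly.eval V P) := by
  induction P with
  | nil => exact BddCont.const 0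
  | cons p P ih =>
    have : DiffPoly.eval V (p :: P) = fun x => p.1 * monEval V p.2 x + DiffPoly.eval V P x := by
      ext; simp
    rw [this]
    exact ((hV.bddCont_monEval p.2).const_mul p.1).add ih

lemma L2Tower.memLp_monEval (hV : L2Tower V) {l : List ℕ} (hl : 1 ≤ l.length) :
    MemLp (monEval V l) 2 volume := by
  cases l with
  | nil => simp at hl
  | cons i l =>
    refine ((hV.bddCont_monEval l).memLp_mul (hV.memLp i)).congr_norm
      (continuous_monEval hV.continuous _).aestronglyMeasurable (ae_of_all _ fun x => ?_)
    rw [monEval_cons, mul_comm]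

lemma L2Tower.memLp_eval (hV : L2Tower V) {P : DiffPoly} (hP : ∀ p ∈ P, 1 ≤ p.2.length) :
    MemLp (DiffPoly.eval V P) 2 volume := by
  induction P with
  | nil => exact MemLp.zero'
  | cons p P ih =>
    simp only [List.mem_cons, forall_eq_or_imp] at hP
    have : DiffPoly.eval V (p :: P) = fun x => p.1 * monEval V p.2 x + DiffPoly.eval V P x := by
      ext; simp
    rw [this]
    exact ((hV.memLp_monEval hP.1).const_mul p.1).add (ih hP.2)

lemma L2Tower.eval_iterate (hV : L2Tower V) {P : DiffPoly} (hP : ∀ p ∈ P, 1 ≤ p.2.length) :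
    L2Tower (fun k => DiffPoly.eval V (DiffPoly.D^[k] P)) := by
  refine ⟨fun k x => hasDerivAt_eval_iterate hV.hasDerivAt P k x, fun k => hV.memLp_eval ?_⟩
  intro p hp
  by_contra hlt
  have h0 : ∀ k, ∀ p ∈ DiffPoly.D^[k] P, 1 ≤ p.2.length := fun k => by
    induction k with
    | zero => exact hP
    | succ k ih =>
      intro q hq
      rw [Function.iterate_succ_apply'] at hq
      obtain ⟨p, hp, hm⟩ := DiffPoly.exists_of_mem_D hq
      exact (length_of_mem_monDeriv hm).symm ▸ ih p hp
  exact hlt (h0 k p hp)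

/-- The sum of the absolute values of the first derivatives. -/
def jetNorm (V : ℕ → ℝ → ℝ) (n : ℕ) (x : ℝ) : ℝ := ∑ i ∈ Finset.range n, |V i x|

lemma abs_le_jetNorm (V : ℕ → ℝ → ℝ) {i n : ℕ} (h : i < n) (x : ℝ) : |V i x| ≤ jetNorm V n x :=
  Finset.single_le_sum (f := fun i => |V i x|) (fun _ _ => abs_nonneg _) (Finset.mem_range.2 h)

lemma jetNorm_nonneg (V : ℕ → ℝ → ℝ) (n : ℕ) (x : ℝ) : 0 ≤ jetNorm V n x :=
  Finset.sum_nonneg fun _ _ => abs_nonneg _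

/-- Pointwise bound of the nonlinearity. -/
lemma DecayBound.abs_eval_le {C : ℝ} (hC : 1 ≤ C) (hV : DecayBound C V) {P : DiffPoly}
    (hP : ∀ p ∈ P, 2 ≤ p.2.length ∧ ∀ i ∈ p.2, i ≤ 3) (x : ℝ) :
    |DiffPoly.eval V P x| ≤ P.lip C * decay x * jetNorm V 4 x := by
  have h := DiffPoly.abs_eval_sub_le_mul (V := V) (W := fun _ _ => (0 : ℝ)) (P := P) (x := x)
    (d := jetNorm V 4 x) hC (decay_pos x).le (decay_le_one x) (fun p hp => (hP p hp).1)
    (fun p hp i hi => hV.abs_le_decay i ((hP p hp).2 i hi) x)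
    (fun p hp i hi => by
      rw [abs_zero]; exact mul_nonneg (by linarith) (decay_pos x).le)
    (fun p hp i hi => by
      rw [sub_zero]
      exact abs_le_jetNorm V (by have := (hP p hp).2 i hi; lia) x)
  rwa [DiffPoly.eval_zero fun p hp => le_trans (by norm_num) (hP p hp).1, sub_zero] at h

lemma WTower.integral_le_of_le (hV : WTower V) {s : ℝ} {j : ℕ} (hs : s ≤ 4 - j / 2) {C : ℝ}
    (hC : 0 ≤ C) {κ : ℝ → ℝ} (hκ : Continuous κ) (h : ∀ x, |κ x| ≤ C * brPow s x) :
    |∫ x, κ x * V j x * V j x| ≤ C * wInt V j := by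
  have hj : (0 : ℝ) ≤ j / 2 := by positivity
  have hs4 : s ≤ 4 := by linarith
  refine (abs_integral_le_integral_abs).trans ?_
  refine le_trans ?_ (mul_le_mul_of_nonneg_left (hV.integral_le_wInt hs) hC)
  rw [← integral_const_mul]
  refine integral_mono (integrable_weight_mul hκ (fun x => (h x).trans (mul_le_mul_of_nonneg_left
    (brPow_mono hs4 x) hC)) (hV.memLp_weight j) (hV.memLp_weight j)).abs
    ((hV.integrable hs4 j).const_mul _) fun x => ?_
  change |κ x * V j x * V j x| ≤ C * (brPow s x * V j x ^ 2)
  rw [mul_assoc, ← pow_two, abs_mul, abs_of_nonneg (sq_nonneg (V j x)), ← mul_assoc]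
  exact mul_le_mul_of_nonneg_right (h x) (sq_nonneg _)

/-- The a priori estimate for the weighted norm. -/
lemma exists_weighted_energy_bound {P : DiffPoly}
    (hP : ∀ p ∈ P, 2 ≤ p.2.length ∧ ∀ i ∈ p.2, i ≤ 3) {C B : ℝ} (hC : 1 ≤ C) (hB : 0 ≤ B) :
    ∃ K : ℝ, ∀ V, WTower V → DecayBound C V → ∀ χ : ℕ → ℝ → ℝ, BddTower 5 χ →
      (∀ x, |χ 0 x| ≤ brPow 4 x) → (∀ k x, k ≤ 4 → |χ (k + 1) x| ≤ B * brPow 3 x) →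
      2 * (∫ x, χ 0 x * V 0 x * V 5 x) - 2 * (∫ x, χ 0 x * V 0 x * DiffPoly.eval V P x) ≤ K := by
  have hL := DiffPoly.lip_nonneg (zero_le_one.trans hC) P
  refine ⟨5 * (B * C) + 5 * (B * C) + B * C + P.lip C * (4 * C + 4 * C),
    fun V hV hd χ hχ h0 h1 => ?_⟩
  -- No sign is needed in the linear part: the derivatives of `χ` are `O(⟨x⟩³)`, and `3 ≤ 4 - j/2`
  -- for `j ≤ 2`, so all three terms are controlled by `wInt`.
  have e := hV.integral_mul_five hχ le_rfl 0
  simp only [zero_add] at e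
  have b2 := hV.integral_le_of_le (s := 3) (j := 2) (by norm_num) hB (hχ.bddCont 1 (by lia)).1
    (fun x => h1 0 x (by lia))
  have b1 := hV.integral_le_of_le (s := 3) (j := 1) (by norm_num) hB (hχ.bddCont 3 (by lia)).1
    (fun x => h1 2 x (by lia))
  have b0 := hV.integral_le_of_le (s := 3) (j := 0) (by norm_num) hB (hχ.bddCont 5 (by lia)).1
    (fun x => h1 4 x (by lia))
  have c2 := mul_le_mul_of_nonneg_left (hd.wInt_le 2 (by lia)) hB
  have c1 := mul_le_mul_of_nonneg_left (hd.wInt_le 1 (by lia)) hB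
  have c0 := mul_le_mul_of_nonneg_left (hd.wInt_le 0 (by lia)) hB
  have hN : |2 * ∫ x, χ 0 x * V 0 x * DiffPoly.eval V P x| ≤ P.lip C * (4 * C + 4 * C) := by
    have iN := (hχ.bddCont 0 (by lia)).integrable_mul_mul (hV.memLp 0)
      (hV.memLp_eval fun p hp => le_trans (by norm_num) (hP p hp).1)
    have iS : ∀ i ∈ Finset.range 4, Integrable (fun x => brPow (7 / 4) x * V i x ^ 2) :=
      fun i _ => hV.integrable (by norm_num) i
    have i4 := hV.integrable (s := 4) le_rfl 0
    have hbound : ∀ x, |2 * (χ 0 x * V 0 x * DiffPoly.eval V P x)| ≤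
        P.lip C * (4 * (brPow 4 x * V 0 x ^ 2) +
          ∑ i ∈ Finset.range 4, brPow (7 / 4) x * V i x ^ 2) := fun x => by
      have h2 := hd.abs_eval_le hC hP x
      have hdx := decay_pos x
      have hw4 := brPow_pos 4 x
      -- The decay of the nonlinearity is used to balance the weights: after the splitting, `v²`
      -- carries `⟨x⟩⁴` and `(∂^i v)²` carries `⟨x⟩^{7/4}`, which is admissible for `i ≤ 3`.
      have h3 : brPow 4 x * decay x = brPow 2 x * brPow (7 / 8) x := by
        have : decay x = brPow (-(9 / 8)) x := rfl
        rw [this, ← brPow_add, ← brPow_add]; norm_num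
      have e4 : brPow 4 x = brPow 2 x ^ 2 := by rw [pow_two, ← brPow_add]; norm_num
      have e74 : brPow (7 / 4) x = brPow (7 / 8) x ^ 2 := by rw [pow_two, ← brPow_add]; norm_num
      calc |2 * (χ 0 x * V 0 x * DiffPoly.eval V P x)|
          = 2 * (|χ 0 x| * |V 0 x| * |DiffPoly.eval V P x|) := by
            rw [abs_mul, abs_mul, abs_mul, abs_two]
        _ ≤ 2 * (brPow 4 x * |V 0 x| * (P.lip C * decay x * jetNorm V 4 x)) := by
            have := h0 x
            gcongr
        _ = P.lip C * (∑ i ∈ Finset.range 4, 2 * ((brPow 4 x * decay x) * |V 0 x * V i x|)) := by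
            rw [jetNorm, ← Finset.mul_sum, ← Finset.mul_sum]
            simp only [abs_mul]
            rw [← Finset.mul_sum]
            ring
        _ ≤ P.lip C * (∑ i ∈ Finset.range 4,
              (brPow 4 x * V 0 x ^ 2 + brPow (7 / 4) x * V i x ^ 2)) := by
            refine mul_le_mul_of_nonneg_left (Finset.sum_le_sum fun i _ => ?_) hL
            have := two_mul_le_of_split one_pos (brPow 2 x) (brPow (7 / 8) x) (V 0 x) (V i x)
            rw [h3, e4, e74]
            linarith
        _ = _ := by
            rw [Finset.sum_add_distrib]; simp
    have iR : Integrable (fun x => P.lip C * (4 * (brPow 4 x * V 0 x ^ 2) +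
          ∑ i ∈ Finset.range 4, brPow (7 / 4) x * V i x ^ 2)) :=
      ((i4.const_mul 4).add (integrable_finsetSum _ iS)).const_mul _
    rw [← integral_const_mul]
    refine abs_integral_le_integral_abs.trans
      ((integral_mono (iN.const_mul 2).abs iR hbound).trans ?_)
    rw [integral_const_mul, integral_add (i4.const_mul 4) (integrable_finsetSum _ iS),
      integral_const_mul, integral_finsetSum _ iS]
    refine mul_le_mul_of_nonneg_left (add_le_add ?_ ?_) hL
    · exact mul_le_mul_of_nonneg_left ((hV.integral_le_wInt (s := 4) (j := 0) (by norm_num)).trans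
        (hd.wInt_le 0 (by lia))) (by norm_num)
    · calc ∑ i ∈ Finset.range 4, ∫ x, brPow (7 / 4) x * V i x ^ 2 ≤ ∑ i ∈ Finset.range 4, C := by
            refine Finset.sum_le_sum fun i hi => ?_
            have hi3 : (i : ℝ) ≤ 3 := by
              have := Finset.mem_range.1 hi
              exact_mod_cast (by lia : i ≤ 3)
            exact (hV.integral_le_wInt (by linarith)).trans
              (hd.wInt_le i (by have := Finset.mem_range.1 hi; lia))
        _ = 4 * C := by simp
  have := abs_le.1 b2
  have := abs_le.1 b1
  have := abs_le.1 b0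
  have := abs_le.1 hN
  linarith [this.1, this.2]

/-! ### The a priori estimate of order eight. -/

variable {V : ℕ → ℝ → ℝ}

/-- The first three derivatives of a product. -/
def mulTower (φ ψ : ℕ → ℝ → ℝ) : ℕ → ℝ → ℝ
  | 0 => fun x => φ 0 x * ψ 0 x
  | 1 => fun x => φ 1 x * ψ 0 x + φ 0 x * ψ 1 x
  | 2 => fun x => φ 2 x * ψ 0 x + 2 * (φ 1 x * ψ 1 x) + φ 0 x * ψ 2 x
  | 3 => fun x => φ 3 x * ψ 0 x + 3 * (φ 2 x * ψ 1 x) + 3 * (φ 1 x * ψ 2 x) + φ 0 x * ψ 3 x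
  | _ => 0

lemma BddTower.mulTower {φ ψ : ℕ → ℝ → ℝ} (hφ : BddTower 3 φ) (hψ : BddTower 3 ψ) :
    BddTower 3 (mulTower φ ψ) := by
  have d := hφ.hasDerivAt
  have d' := hψ.hasDerivAt
  have m : ∀ i j, i ≤ 3 → j ≤ 3 → BddCont (fun x => φ i x * ψ j x) := fun i j hi hj =>
    (hφ.bddCont i hi).mul (hψ.bddCont j hj)
  have dm : ∀ i j, i < 3 → j < 3 → ∀ x, HasDerivAt (fun x => φ i x * ψ j x)
      (φ (i + 1) x * ψ j x + φ i x * ψ (j + 1) x) x := fun i j hi hj x =>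
    (d i hi x).fun_mul (d' j hj x)
  refine ⟨fun k hk x => ?_, fun k hk => ?_⟩
  · interval_cases k
    · exact dm 0 0 (by lia) (by lia) x
    · exact ((dm 1 0 (by lia) (by lia) x).fun_add (dm 0 1 (by lia) (by lia) x)).congr_deriv
        (by simp only [FifthOrder.mulTower]; ring)
    · exact (((dm 2 0 (by lia) (by lia) x).fun_add
        ((dm 1 1 (by lia) (by lia) x).const_mul 2)).fun_add
        (dm 0 2 (by lia) (by lia) x)).congr_deriv (by simp only [FifthOrder.mulTower]; ring)
  · interval_cases k
    · exact m 0 0 (by lia) (by lia)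
    · exact (m 1 0 (by lia) (by lia)).add (m 0 1 (by lia) (by lia))
    · exact ((m 2 0 (by lia) (by lia)).add ((m 1 1 (by lia) (by lia)).const_mul 2)).add
        (m 0 2 (by lia) (by lia))
    · exact (((m 3 0 (by lia) (by lia)).add ((m 2 1 (by lia) (by lia)).const_mul 3)).add
        ((m 1 2 (by lia) (by lia)).const_mul 3)).add (m 0 3 (by lia) (by lia))

lemma abs_integral_mul_sq_le {κ φ f : ℝ → ℝ} (hκ : BddCont κ) (hφ : BddCont φ)
    (hf : MemLp f 2 volume) {K : ℝ} (h : ∀ x, |κ x| ≤ K * φ x) :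
    |∫ x, κ x * f x * f x| ≤ K * ∫ x, φ x * f x * f x := by
  refine abs_integral_le_integral_abs.trans ?_
  rw [← integral_const_mul]
  refine integral_mono (hκ.integrable_mul_mul hf hf).abs
    ((hφ.integrable_mul_mul hf hf).const_mul K) fun x => ?_
  change |κ x * f x * f x| ≤ K * (φ x * f x * f x)
  rw [mul_assoc, abs_mul, abs_of_nonneg (mul_self_nonneg (f x)), mul_assoc (φ x),
    ← mul_assoc K]
  exact mul_le_mul_of_nonneg_right (h x) (mul_self_nonneg _)

lemma abs_integral_mul_sq_le_const {κ f : ℝ → ℝ} (hκ : BddCont κ)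
    (hf : MemLp f 2 volume) {K : ℝ} (h : ∀ x, |κ x| ≤ K) :
    |∫ x, κ x * f x * f x| ≤ K * ∫ x, f x ^ 2 := by
  have := abs_integral_mul_sq_le hκ (BddCont.const 1) hf (K := K) (by simpa using h)
  simpa [pow_two] using this

lemma abs_integral_mul_mul_le {κ f g : ℝ → ℝ} (hκ : BddCont κ)
    (hf : MemLp f 2 volume) (hg : MemLp g 2 volume) {K : ℝ} (h : ∀ x, |κ x| ≤ K) :
    |∫ x, κ x * f x * g x| ≤ K * ((∫ x, f x ^ 2) + ∫ x, g x ^ 2) := by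
  refine abs_integral_le_integral_abs.trans ?_
  rw [← integral_add hf.integrable_sq hg.integrable_sq, ← integral_const_mul]
  refine integral_mono (hκ.integrable_mul_mul hf hg).abs
    ((hf.integrable_sq.add hg.integrable_sq).const_mul K) fun x => ?_
  change |κ x * f x * g x| ≤ K * (f x ^ 2 + g x ^ 2)
  rw [mul_assoc, abs_mul]
  refine mul_le_mul (h x) ?_ (abs_nonneg _) ((abs_nonneg _).trans (h x))
  rw [abs_mul, ← sq_abs (f x), ← sq_abs (g x)]
  nlinarith [sq_nonneg (|f x| - |g x|)]

/-- The smoothing weight: increasing and bounded, with derivative comparable to `⟨x⟩^{-9/8}`. -/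
structure SmoothingWeight (B c : ℝ) (φ : ℕ → ℝ → ℝ) : Prop where
  tower : BddTower 5 φ
  c_pos : 0 < c
  one_le : ∀ x, 1 ≤ φ 0 x
  le_two : ∀ x, φ 0 x ≤ 2
  decay_le : ∀ x, c * decay x ≤ φ 1 x
  abs_le_deriv : ∀ k x, k ≤ 4 → |φ (k + 1) x| ≤ B * φ 1 x
  abs_le : ∀ k x, k ≤ 5 → |φ k x| ≤ B

lemma exists_smoothingWeight : ∃ (B c : ℝ) (φ : ℕ → ℝ → ℝ), SmoothingWeight B c φ := by
  obtain ⟨C, c, φ, hC, hc, ht, h12, hd, h⟩ := exists_smoothing_weight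
  have hb : ∀ k : ℕ, ∃ K : ℝ, 0 ≤ K ∧ (k ≤ 5 → ∀ x, |φ k x| ≤ K) := fun k => by
    by_cases hk : k ≤ 5
    · obtain ⟨-, K, hK⟩ := ht.bddCont k hk
      exact ⟨K, (abs_nonneg _).trans (hK 0), fun _ => hK⟩
    · exact ⟨0, le_rfl, fun h => absurd h hk⟩
  choose K hK0 hK using hb
  have hS : 0 ≤ ∑ k ∈ Finset.range 6, K k := Finset.sum_nonneg fun k _ => hK0 k
  have hφ1 : ∀ x, 0 ≤ φ 1 x := fun x =>
    (mul_nonneg hc.le (decay_pos x).le).trans (hd x)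
  refine ⟨C + ∑ k ∈ Finset.range 6, K k, c, φ, ht, hc, fun x => (h12 x).1, fun x => (h12 x).2, hd,
    fun k x hk => (h k x hk).trans (mul_le_mul_of_nonneg_right (by linarith) (hφ1 x)),
    fun k x hk => (hK k hk x).trans ?_⟩
  have := Finset.single_le_sum (f := K) (fun k _ => hK0 k) (Finset.mem_range.2 (by lia : k < 6))
  linarith

namespace SmoothingWeight

variable {B c : ℝ} {φ : ℕ → ℝ → ℝ}

lemma deriv_nonneg (hφ : SmoothingWeight B c φ) (x : ℝ) : 0 ≤ φ 1 x :=
  (mul_nonneg hφ.c_pos.le (decay_pos x).le).trans (hφ.decay_le x)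

lemma nonneg (hφ : SmoothingWeight B c φ) : 0 ≤ B := (abs_nonneg _).trans (hφ.abs_le 0 0 (by lia))

lemma decay_le_div (hφ : SmoothingWeight B c φ) (x : ℝ) : decay x ≤ c⁻¹ * φ 1 x := by
  rw [← div_eq_inv_mul, le_div_iff₀ hφ.c_pos, mul_comm]
  exact hφ.decay_le x

lemma integral_nonneg (hφ : SmoothingWeight B c φ) (f : ℝ → ℝ) : 0 ≤ ∫ x, φ 1 x * f x * f x :=
  MeasureTheory.integral_nonneg fun x => by
    change 0 ≤ φ 1 x * f x * f x
    rw [mul_assoc]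
    exact mul_nonneg (hφ.deriv_nonneg x) (mul_self_nonneg _)

end SmoothingWeight

lemma abs_mulTower_le {φ ψ : ℕ → ℝ → ℝ} {B E x : ℝ} {n : ℕ} (hn : n ≤ 3) (hB : 0 ≤ B)
    (hφ : ∀ k ≤ n, |φ k x| ≤ B) (hψ : ∀ k ≤ n, |ψ k x| ≤ E) :
    |mulTower φ ψ n x| ≤ 8 * (B * E) := by
  have hE : 0 ≤ E := (abs_nonneg _).trans (hψ 0 (by lia))
  have m : ∀ i ≤ n, ∀ j ≤ n, |φ i x * ψ j x| ≤ B * E := fun i hi j hj => by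
    rw [abs_mul]
    exact mul_le_mul (hφ i hi) (hψ j hj) (abs_nonneg _) hB
  have hBE : 0 ≤ B * E := mul_nonneg hB hE
  interval_cases n
  · have h1 := abs_le.1 (m 0 (by lia) 0 (by lia))
    simp only [mulTower, abs_le]
    constructor <;> linarith [h1.1, h1.2]
  · have h1 := abs_le.1 (m 1 (by lia) 0 (by lia))
    have h2 := abs_le.1 (m 0 (by lia) 1 (by lia))
    simp only [mulTower, abs_le]
    constructor <;> linarith [h1.1, h1.2, h2.1, h2.2]
  · have h1 := abs_le.1 (m 2 (by lia) 0 (by lia))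
    have h2 := abs_le.1 (m 1 (by lia) 1 (by lia))
    have h3 := abs_le.1 (m 0 (by lia) 2 (by lia))
    simp only [mulTower, abs_le]
    constructor <;> linarith [h1.1, h1.2, h2.1, h2.2, h3.1, h3.2]
  · have h1 := abs_le.1 (m 3 (by lia) 0 (by lia))
    have h2 := abs_le.1 (m 2 (by lia) 1 (by lia))
    have h3 := abs_le.1 (m 1 (by lia) 2 (by lia))
    have h4 := abs_le.1 (m 0 (by lia) 3 (by lia))
    simp only [mulTower, abs_le]
    constructor <;> linarith [h1.1, h1.2, h2.1, h2.2, h3.1, h3.2, h4.1, h4.2]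

/-- The contribution of one monomial to the energy estimate of order eight. -/
lemma exists_monomial_energy_bound {l : List ℕ} {j : ℕ} (hl : 1 ≤ l.length) (hj : j ≤ 11)
    (h : ∀ i ∈ l, i ≤ 7 ∧ (9 ≤ j → i + j ≤ 13)) {C : ℝ} (hC : 1 ≤ C) {B c : ℝ}
    {φ : ℕ → ℝ → ℝ} (hφ : SmoothingWeight B c φ) :
    ∃ K : ℝ, 0 ≤ K ∧ ∀ V, WTower V → DecayBound C V →
      |∫ x, φ 0 x * V 8 x * (V j x * monEval V l x)| ≤ K * ((∫ x, φ 1 x * V 9 x * V 9 x) + 1) := by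
  set P : DiffPoly := [(1, l)] with hP
  have hC0 : 0 ≤ C := by linarith
  have hbd : ∀ k, 0 ≤ DiffPoly.bound C (DiffPoly.D^[k] P) := fun k => DiffPoly.bound_nonneg hC0 _
  set E : ℝ := ∑ k ∈ Finset.range 4, DiffPoly.bound C (DiffPoly.D^[k] P) with hE
  have hE0 : 0 ≤ E := Finset.sum_nonneg fun k _ => hbd k
  have hEk : ∀ k ≤ 3, DiffPoly.bound C (DiffPoly.D^[k] P) ≤ E := fun k hk =>
    Finset.single_le_sum (f := fun k => DiffPoly.bound C (DiffPoly.D^[k] P)) (fun k _ => hbd k)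
      (Finset.mem_range.2 (by lia))
  have hmem : ∀ N, (∀ i ∈ l, i ≤ N) → ∀ k, ∀ p ∈ DiffPoly.D^[k] P,
      1 ≤ p.2.length ∧ ∀ i ∈ p.2, i ≤ N + k := fun N hN k p hp => by
    have := DiffPoly.of_mem_iterate_D (P := P) (a := 1) (b := excess l) (N := N) (by
      simp only [hP, List.mem_singleton, forall_eq]
      exact ⟨hl, le_rfl, hN⟩) k p hp
    exact ⟨this.1, this.2.2⟩
  have hB := hφ.nonneg
  have hc := hφ.c_pos
  have hci : 0 ≤ c⁻¹ := inv_nonneg.2 hc.le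
  refine ⟨3 / 2 * (E + 2 * (E * c⁻¹)) + 8 * (B * E) * C + 2 * (E * c⁻¹) + B * E * (C + C), by positivity,
    fun V hV hd => ?_⟩
  set T := ∫ x, φ 1 x * V 9 x * V 9 x with hT
  have hT0 : 0 ≤ T := hφ.integral_nonneg _
  have hV8 : ∫ x, V 8 x ^ 2 ≤ C := (hV.integral_sq_le_wInt (by lia)).trans (hd.wInt_le 8 (by lia))
  have hV80 : 0 ≤ ∫ x, V 8 x ^ 2 := integral_nonneg fun x => sq_nonneg _
  set e : ℕ → ℝ → ℝ := fun k => DiffPoly.eval V (DiffPoly.D^[k] P) with he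
  have he0 : ∀ x, e 0 x = monEval V l x := fun x => by simp [he, hP]
  have heT : BddTower 3 e := ⟨fun k _ x => hasDerivAt_eval_iterate hV.hasDerivAt P k x,
    fun k _ => hV.bddCont_eval _⟩
  have heb : ∀ N, (∀ i ∈ l, i ≤ N) → ∀ k ≤ 3, N + k ≤ 7 → ∀ x, |e k x| ≤ E := by
    intro N hN k hk hNk x
    refine (DiffPoly.abs_eval_le_bound fun p hp i hi => hd.abs_le i ?_ x).trans (hEk k hk)
    exact ((hmem N hN k p hp).2 i hi).trans hNk
  have hed : ∀ N, (∀ i ∈ l, i ≤ N) → ∀ k, N + k ≤ 3 → ∀ x, |e k x| ≤ E * decay x := by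
    intro N hN k hNk x
    refine (DiffPoly.abs_eval_le_bound_mul hC0 (decay_le_one x) (fun p hp => (hmem N hN k p hp).1)
      fun p hp i hi => hd.abs_le_decay i ?_ x).trans
        (mul_le_mul_of_nonneg_right (hEk k (by lia)) (decay_pos x).le)
    exact ((hmem N hN k p hp).2 i hi).trans hNk
  have hκ := (hφ.tower.mono (by lia : 3 ≤ 5)).mulTower heT
  have hφb : ∀ {n x}, n ≤ 3 → ∀ k ≤ n, |φ k x| ≤ B := fun {n x} hn k hk => hφ.abs_le k x (by lia)
  have hφ0 : ∀ x, |φ 0 x| ≤ 2 := fun x => by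
    rw [abs_of_nonneg (zero_le_one.trans (hφ.one_le x))]; exact hφ.le_two x
  have hdecφ : ∀ x a, |a| ≤ E * decay x → |φ 0 x * a| ≤ 2 * (E * c⁻¹) * φ 1 x := fun x a ha => by
    rw [abs_mul]
    calc |φ 0 x| * |a| ≤ 2 * (E * (c⁻¹ * φ 1 x)) := mul_le_mul (hφ0 x)
          (ha.trans (mul_le_mul_of_nonneg_left (hφ.decay_le_div x) hE0)) (abs_nonneg _) (by norm_num)
      _ = _ := by ring
  have hint : ∀ k, ∫ x, φ 0 x * V 8 x * (V k x * monEval V l x) =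
      ∫ x, mulTower φ e 0 x * V 8 x * V k x := fun k => by
    congr 1; ext x; simp only [mulTower, he0]; ring
  rw [hint]
  have hEc : 0 ≤ E * c⁻¹ := by positivity
  have hBE : 0 ≤ B * E := by positivity
  have hBEC : 0 ≤ B * E * C := by positivity
  have t1 := mul_nonneg hE0 hT0
  have t2 := mul_nonneg hEc hT0
  have t3 := mul_nonneg hBE hT0
  have t4 := mul_nonneg hBEC hT0
  have b8 : 8 * (B * E) * (∫ x, V 8 x ^ 2) ≤ 8 * (B * E) * C :=
    mul_le_mul_of_nonneg_left hV8 (by positivity)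
  -- Let `κ = φ e`, with `e` the product of the other factors. For `j = 11` and `j = 10` integration
  -- by parts leaves `(∂⁹v)²` with coefficient `κ'` or `κ`, which must be dominated by `φ'`. This
  -- holds since `i + j ≤ 13` keeps the factors of `e'`, respectively `e`, of order at most three,
  -- where the pointwise decay is available. For `j = 9` only `(∂⁸v)²` remains, and for `j ≤ 8` no
  -- integration by parts is needed. The constant `K` is large enough for all four cases.
  rcases (by lia : j = 11 ∨ j = 10 ∨ j = 9 ∨ j ≤ 8) with rfl | rfl | rfl | hj8
  · have hN2 : ∀ i ∈ l, i ≤ 2 := fun i hi => by have := (h i hi).2; lia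
    have k1 : ∀ x, |mulTower φ e 1 x| ≤ (E + 2 * (E * c⁻¹)) * φ 1 x := fun x => by
      simp only [mulTower]
      refine (abs_add_le _ _).trans ?_
      rw [add_mul]
      refine add_le_add ?_ (hdecφ x _ (hed 2 hN2 1 (by lia) x))
      rw [abs_mul, mul_comm, abs_of_nonneg (hφ.deriv_nonneg x)]
      exact mul_le_mul_of_nonneg_right (heb 2 hN2 0 (by lia) (by lia) x) (hφ.deriv_nonneg x)
    have k3 : ∀ x, |mulTower φ e 3 x| ≤ 8 * (B * E) := fun x =>
      abs_mulTower_le le_rfl hB (hφb le_rfl) fun k hk => heb 2 hN2 k hk (by lia) x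
    have i1 := abs_integral_mul_sq_le (hκ.bddCont 1 (by lia)) (hφ.tower.bddCont 1 (by lia))
      (hV.memLp 9) k1
    have i3 := abs_integral_mul_sq_le_const (hκ.bddCont 3 le_rfl) (hV.memLp 8) k3
    rw [hV.integral_mul_three hκ le_rfl 8, abs_le]
    have i1' := abs_le.1 i1
    have i3' := abs_le.1 i3
    constructor <;> linarith [i1'.1, i1'.2, i3'.1, i3'.2]
  · have hN3 : ∀ i ∈ l, i ≤ 3 := fun i hi => by have := (h i hi).2; lia
    have k0 : ∀ x, |mulTower φ e 0 x| ≤ 2 * (E * c⁻¹) * φ 1 x := fun x =>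
      hdecφ x _ (hed 3 hN3 0 (by lia) x)
    have k2 : ∀ x, |mulTower φ e 2 x| ≤ 8 * (B * E) := fun x =>
      abs_mulTower_le (by lia) hB (hφb (by lia)) fun k hk => heb 3 hN3 k (by lia) (by lia) x
    have i1 := abs_integral_mul_sq_le (hκ.bddCont 0 (by lia)) (hφ.tower.bddCont 1 (by lia))
      (hV.memLp 9) k0
    have i3 := abs_integral_mul_sq_le_const (hκ.bddCont 2 (by lia)) (hV.memLp 8) k2
    rw [hV.integral_mul_two hκ (by lia) 8, abs_le]
    have i1' := abs_le.1 i1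
    have i3' := abs_le.1 i3
    constructor <;> linarith [i1'.1, i1'.2, i3'.1, i3'.2]
  · have hN4 : ∀ i ∈ l, i ≤ 4 := fun i hi => by have := (h i hi).2; lia
    have k1 : ∀ x, |mulTower φ e 1 x| ≤ 8 * (B * E) := fun x =>
      abs_mulTower_le (by lia) hB (hφb (by lia)) fun k hk => heb 4 hN4 k (by lia) (by lia) x
    have i3 := abs_integral_mul_sq_le_const (hκ.bddCont 1 (by lia)) (hV.memLp 8) k1
    rw [hV.integral_mul_one hκ (by lia) 8, abs_le]
    have i3' := abs_le.1 i3
    constructor <;> linarith [i3'.1, i3'.2]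
  · have hN7 : ∀ i ∈ l, i ≤ 7 := fun i hi => (h i hi).1
    have k0 : ∀ x, |mulTower φ e 0 x| ≤ B * E := fun x => by
      simp only [mulTower]
      rw [abs_mul]
      exact mul_le_mul (hφ.abs_le 0 x (by lia)) (heb 7 hN7 0 (by lia) (by lia) x) (abs_nonneg _) hB
    have i0 := abs_integral_mul_mul_le (hκ.bddCont 0 (by lia)) (hV.memLp 8) (hV.memLp j) k0
    have hVj := (hV.integral_sq_le_wInt hj8).trans (hd.wInt_le j hj8)
    have := mul_le_mul_of_nonneg_left (add_le_add hV8 hVj) hBE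
    refine i0.trans (this.trans ?_)
    linarith

/-- The a priori estimate for the derivative of order eight. -/
lemma exists_top_energy_bound {P : DiffPoly} (hP : ∀ p ∈ P, 2 ≤ p.2.length ∧ excess p.2 ≤ 1)
    {C : ℝ} (hC : 1 ≤ C) {B c : ℝ} {φ : ℕ → ℝ → ℝ} (hφ : SmoothingWeight B c φ) :
    ∃ K : ℝ, ∀ V, WTower V → DecayBound C V →
      2 * (∫ x, φ 0 x * V 8 x * V 13 x) -
        2 * (∫ x, φ 0 x * V 8 x * DiffPoly.eval V (DiffPoly.D^[8] P) x) ≤ K := by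
  have hB := hφ.nonneg
  have key : ∀ L : DiffPoly, (∀ p ∈ L, 2 ≤ p.2.length ∧ excess p.2 ≤ 9) → ∃ K : ℝ, 0 ≤ K ∧
      ∀ V, WTower V → DecayBound C V → |∫ x, φ 0 x * V 8 x * DiffPoly.eval V L x| ≤
        K * ((∫ x, φ 1 x * V 9 x * V 9 x) + 1) := by
    intro L hL
    induction L with
    | nil => exact ⟨0, le_rfl, fun V _ _ => by simp⟩
    | cons p L ih =>
      simp only [List.mem_cons, forall_eq_or_imp] at hL
      obtain ⟨K, hK, h⟩ := ih hL.2
      obtain ⟨j, hj, hj11, hlen, hi⟩ := exists_top_factor hL.1.1 hL.1.2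
      obtain ⟨K', hK', h'⟩ := exists_monomial_energy_bound hlen hj11 hi hC hφ
      refine ⟨|p.1| * K' + K, by positivity, fun V hV hd => ?_⟩
      have h1 := h' V hV hd
      have h2 := h V hV hd
      have b0 := hφ.tower.bddCont 0 (by lia)
      have hm : 1 ≤ p.2.length := le_trans (by norm_num) hL.1.1
      have e : ∫ x, φ 0 x * V 8 x * DiffPoly.eval V (p :: L) x =
          p.1 * (∫ x, φ 0 x * V 8 x * (V j x * monEval V (p.2.erase j) x)) +
            ∫ x, φ 0 x * V 8 x * DiffPoly.eval V L x := by
        rw [← integral_const_mul, ← integral_add]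
        · congr 1
          ext x
          rw [DiffPoly.eval_cons, monEval_erase hj]
          ring
        · refine Integrable.const_mul ?_ _
          refine (b0.integrable_mul_mul (hV.memLp 8) (hV.memLp_monEval hm)).congr
            (ae_of_all _ fun x => ?_)
          change φ 0 x * V 8 x * monEval V p.2 x = _
          rw [monEval_erase hj]
        · exact b0.integrable_mul_mul (hV.memLp 8)
            (hV.memLp_eval fun p hp => le_trans (by norm_num) (hL.2 p hp).1)
      rw [e]
      refine (abs_add_le _ _).trans ?_
      rw [abs_mul, add_mul, mul_assoc]
      exact add_le_add (mul_le_mul_of_nonneg_left h1 (abs_nonneg _)) h2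
  obtain ⟨K, hK, h⟩ := key (DiffPoly.D^[8] P) fun p hp => by
    -- Only the length and the excess matter here; the maximal order occurring in `P` serves as some
    -- admissible `N`.
    have := DiffPoly.of_mem_iterate_D (P := P) (a := 2) (b := 1) (N := P.foldr (fun p n =>
      max (p.2.foldr max 0) n) 0) (fun p hp => ⟨(hP p hp).1, (hP p hp).2, fun i hi => ?_⟩) 8 p hp
    · exact ⟨this.1, this.2.1⟩
    · have h1 : ∀ l : List ℕ, ∀ i ∈ l, i ≤ l.foldr max 0 := fun l => by
        induction l with
        | nil => simp
        | cons a l ih =>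
          simp only [List.mem_cons, forall_eq_or_imp, List.foldr_cons]
          exact ⟨le_max_left _ _, fun i hi => (ih i hi).trans (le_max_right _ _)⟩
      have h2 : ∀ L : DiffPoly, ∀ p ∈ L, p.2.foldr max 0 ≤ L.foldr (fun p n =>
          max (p.2.foldr max 0) n) 0 := fun L => by
        induction L with
        | nil => simp
        | cons a l ih =>
          simp only [List.mem_cons, forall_eq_or_imp, List.foldr_cons]
          exact ⟨le_max_left _ _, fun i hi => (ih i hi).trans (le_max_right _ _)⟩
      exact (h1 _ i hi).trans (h2 _ _ hp)
  -- The total coefficient of `T = ∫ φ' (∂⁹v)²`: the linear part contributes `5B` through `φ'''`,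
  -- the nonlinear part `2K`. The term `a T` is interpolated between `S = ∫ φ' (∂¹⁰v)²`, of which
  -- `-5 S` is available, and `∫ (∂⁸v)²`.
  set a : ℝ := 5 * B + 2 * K with ha
  have ha0 : 0 ≤ a := by positivity
  refine ⟨a * (B * C + (a + 1) * C * B) + 2 * K + B * C, fun V hV hd => ?_⟩
  have hV8 : ∫ x, V 8 x ^ 2 ≤ C := (hV.integral_sq_le_wInt (by lia)).trans (hd.wInt_le 8 (by lia))
  have hV80 : 0 ≤ ∫ x, V 8 x ^ 2 := integral_nonneg fun x => sq_nonneg _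
  have h1 := abs_le.1 (h V hV hd)
  have e := hV.integral_mul_five hφ.tower le_rfl 8
  simp only [Nat.reduceAdd] at e
  set T := ∫ x, φ 1 x * V 9 x * V 9 x with hT
  set S := ∫ x, φ 1 x * V 10 x * V 10 x with hS
  have hS0 : 0 ≤ S := hφ.integral_nonneg _
  have hb := hφ.tower.bddCont
  have b3 := abs_le.1 (abs_integral_mul_sq_le (hb 3 (by lia)) (hb 1 (by lia)) (hV.memLp 9)
    (fun x => hφ.abs_le_deriv 2 x (by lia)))
  have b5 := abs_le.1 (abs_integral_mul_sq_le_const (hb 5 (by lia)) (hV.memLp 8)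
    (fun x => hφ.abs_le 5 x (by lia)))
  have b3' := abs_le.1 (abs_integral_mul_sq_le_const (hb 3 (by lia)) (hV.memLp 8)
    (fun x => hφ.abs_le 3 x (by lia)))
  have c8 : B * (∫ x, V 8 x ^ 2) ≤ B * C := mul_le_mul_of_nonneg_left hV8 hB
  have eT := hV.integral_mul_two ((hφ.tower.mono (by lia : 4 ≤ 5)).shift) (by lia) 8
  simp only [zero_add, Nat.reduceAdd] at eT
  have eS : -2 * (a + 1) * (∫ x, φ 1 x * V 8 x * V 10 x) ≤ S + (a + 1) ^ 2 * (B * C) := by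
    have i1 := (hb 1 (by lia)).integrable_mul_mul (hV.memLp 8) (hV.memLp 10)
    have i2 := (hb 1 (by lia)).integrable_mul_mul (hV.memLp 10) (hV.memLp 10)
    have i3 := (hb 1 (by lia)).integrable_mul_mul (hV.memLp 8) (hV.memLp 8)
    have b1 := abs_le.1 (abs_integral_mul_sq_le_const (hb 1 (by lia)) (hV.memLp 8)
      (fun x => hφ.abs_le 1 x (by lia)))
    have hle : -2 * (a + 1) * (∫ x, φ 1 x * V 8 x * V 10 x) ≤
        S + (a + 1) ^ 2 * ∫ x, φ 1 x * V 8 x * V 8 x := by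
      rw [hS, ← integral_const_mul, ← integral_const_mul, ← integral_add i2 (i3.const_mul _)]
      refine integral_mono (i1.const_mul _) (i2.add (i3.const_mul _)) fun x => ?_
      change -2 * (a + 1) * (φ 1 x * V 8 x * V 10 x) ≤ φ 1 x * V 10 x * V 10 x +
        (a + 1) ^ 2 * (φ 1 x * V 8 x * V 8 x)
      have := mul_nonneg (hφ.deriv_nonneg x) (sq_nonneg (V 10 x + (a + 1) * V 8 x))
      nlinarith
    refine hle.trans (add_le_add_right ?_ _)
    exact mul_le_mul_of_nonneg_left (b1.2.trans c8) (by positivity)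
  have hTa : (a + 1) * T ≤ 1 / 2 * (S + (a + 1) ^ 2 * (B * C)) + 1 / 2 * ((a + 1) * (B * C)) := by
    have e1 : T = 1 / 2 * (∫ x, φ 3 x * V 8 x * V 8 x) - ∫ x, φ 1 x * V 8 x * V 10 x := by
      linarith
    have e2 : (a + 1) * (∫ x, φ 3 x * V 8 x * V 8 x) ≤ (a + 1) * (B * C) :=
      mul_le_mul_of_nonneg_left (b3'.2.trans c8) (by positivity)
    rw [e1]
    linarith
  have hT0 : 0 ≤ T := hφ.integral_nonneg _
  have hBC : 0 ≤ B * C := by positivity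
  have hfin : a * T ≤ S + a * (B * C + (a + 1) * C * B) := by
    -- Young's inequality was applied with `a + 1`; the factor `a / (a + 1) ≤ 1` converts the result
    -- into a bound for `a T` with coefficient at most one in front of `S`.
    have e1 : a * T = a / (a + 1) * ((a + 1) * T) := by field_simp
    have h01 : a / (a + 1) ≤ 1 := (div_le_one (by positivity)).2 (by linarith)
    have h00 : 0 ≤ a / (a + 1) := by positivity
    have e2 : a / (a + 1) * (1 / 2 * (S + (a + 1) ^ 2 * (B * C)) + 1 / 2 * ((a + 1) * (B * C))) =
        a / (a + 1) * (1 / 2 * S) + a * (1 / 2 * ((a + 1) * (B * C)) + 1 / 2 * (B * C)) := by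
      field_simp
      ring
    rw [e1]
    refine (mul_le_mul_of_nonneg_left hTa h00).trans ?_
    rw [e2]
    have e3 := mul_le_mul_of_nonneg_right h01 (by positivity : 0 ≤ 1 / 2 * S)
    have e4 : 0 ≤ a * (a + 1) * (B * C) := by positivity
    have e5 : 0 ≤ a * (B * C) := by positivity
    linarith
  have : 5 * (B * T) + 2 * K * T = a * T := by rw [ha]; ring
  linarith [h1.1, h1.2, b3.1, b3.2, b5.1, b5.2]

/-! ### The quadratic form of the exponential energy estimate. -/

lemma mul_abs_mul_le {θ : ℝ} (hθ : 0 < θ) (c u v : ℝ) :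
    c * |u * v| ≤ θ * u ^ 2 + c ^ 2 / (4 * θ) * v ^ 2 := by
  have h : 0 ≤ θ * (|u| - c / (2 * θ) * |v|) ^ 2 := by positivity
  have e : θ * (|u| - c / (2 * θ) * |v|) ^ 2 =
      θ * u ^ 2 + c ^ 2 / (4 * θ) * v ^ 2 - c * |u * v| := by
    rw [abs_mul, ← sq_abs u, ← sq_abs v]
    field_simp
    ring
  linarith

/-- The principal quadratic form of the exponential energy estimate is negative definite. -/
lemma principal_form_le {b : ℝ} (hb : 0 < b) (X Y Z : ℝ) :
    -(11 / 16) * b ^ 5 * Z ^ 2 - 5 * b * X ^ 2 + 5 * b ^ 3 * Y ^ 2 - b ^ 5 * Z ^ 2 -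
      5 * (b ^ 3 * Y ^ 2 + 2 * b ^ 2 * (X * Y)) +
      1 / 20 * (b ^ 5 * Z ^ 2 + 2 * b ^ 4 * (Y * Z)) -
      51 / 10 * (b ^ 4 * (Y * Z) + b ^ 3 * Y ^ 2 + b ^ 3 * (X * Z)) ≤
    -(1 / 50) * (b * X ^ 2 + b ^ 3 * Y ^ 2 + b ^ 5 * Z ^ 2) := by
  -- In the variables `S = X + bY + b²Z/2`, `U = bY`, `T = b²Z`. With both large multipliers equal
  -- to `-5` the form would be `-5S² - (11/16 - 1/4)T²`, without any gain in `U`. Replacing the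
  -- second by `-51/10` produces `-U²/10`, and the multiplier `1/20` cancels the product `YZ` that
  -- this creates.
  have key : ∀ S U T : ℝ, -5 * S ^ 2 - 1 / 10 * (S * T) - 1 / 10 * U ^ 2 + 1 / 10 * (U * T) -
      27 / 80 * T ^ 2 + 1 / 50 * ((S - U - T / 2) ^ 2 + U ^ 2 + T ^ 2) ≤ 0 := fun S U T => by
    nlinarith [sq_nonneg (U - 5 / 2 * T), sq_nonneg (S - T / 2), sq_nonneg (S - U - T / 2),
      sq_nonneg (S + U), sq_nonneg (S + T / 2), sq_nonneg (U - T / 2), sq_nonneg S, sq_nonneg T,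
      sq_nonneg (U - T), sq_nonneg (S + T)]
  have h := mul_le_mul_of_nonneg_left (key (X + b * Y + b ^ 2 * Z / 2) (b * Y) (b ^ 2 * Z)) hb.le
  rw [mul_zero] at h
  refine sub_nonpos.1 (le_trans (le_of_eq ?_) h)
  ring

/-- Beyond the threshold `R` the fourth power dominates the lower ones and `b⁵` dominates the fourth
power. Since `b` has no bound uniform in the truncation, this is how lower-order terms are absorbed.
-/
lemma exists_pow_le (κ K : ℝ) (hκ : 0 < κ) (hK : 0 ≤ K) : ∃ C : ℝ, 0 ≤ C ∧ ∀ b : ℝ, 0 < b →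
    K * (b + b ^ 2 + b ^ 3 + b ^ 4) ≤ κ * b ^ 5 + C := by
  set R : ℝ := 4 * K / κ + 1 with hR
  have hR1 : 1 ≤ R := le_add_of_nonneg_left (by positivity)
  refine ⟨K * (R + R ^ 2 + R ^ 3 + R ^ 4), by positivity, fun b hb => ?_⟩
  rcases le_total b R with h | h
  · have : K * (b + b ^ 2 + b ^ 3 + b ^ 4) ≤ K * (R + R ^ 2 + R ^ 3 + R ^ 4) := by gcongr
    have : 0 ≤ κ * b ^ 5 := by positivity
    linarith
  · have hb1 : 1 ≤ b := hR1.trans h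
    have h1 : b ≤ b ^ 4 := le_self_pow₀ hb1 (by norm_num)
    have h2 : b ^ 2 ≤ b ^ 4 := pow_le_pow_right₀ hb1 (by norm_num)
    have h3 : b ^ 3 ≤ b ^ 4 := pow_le_pow_right₀ hb1 (by norm_num)
    have h4 : 4 * K ≤ κ * b := by
      have : 4 * K / κ ≤ b := by linarith
      rw [div_le_iff₀ hκ] at this
      linarith
    have h5 : K * (b + b ^ 2 + b ^ 3 + b ^ 4) ≤ K * (4 * b ^ 4) :=
      mul_le_mul_of_nonneg_left (by linarith) hK
    have h6 : 4 * K * b ^ 4 ≤ κ * b * b ^ 4 := mul_le_mul_of_nonneg_right h4 (by positivity)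
    have h7 : 0 ≤ K * (R + R ^ 2 + R ^ 3 + R ^ 4) := by positivity
    nlinarith

set_option maxHeartbeats 1000000 in
/-- The pointwise inequality behind the exponential energy estimate. -/
lemma exists_pointwise_bound (A N : ℝ) (hA : 1 ≤ A) (hN : 0 ≤ N) : ∃ L C : ℝ, 0 ≤ C ∧
    ∀ b l₁ l₂ l₃ l₄ X Y Z : ℝ, 0 < b → |l₁| ≤ A → |l₂| ≤ A → |l₃| ≤ A → |l₄| ≤ A →
    -(11 / 16) * b ^ 5 * Z ^ 2 - 5 * b * X ^ 2 + 5 * (b ^ 3 + 3 * b ^ 2 * l₁ + b * l₂) * Y ^ 2 -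
      (b ^ 5 + 10 * b ^ 4 * l₁ + b ^ 3 * (10 * l₂ + 15 * l₁ ^ 2) +
        b ^ 2 * (5 * l₃ + 10 * (l₁ * l₂)) + b * l₄) * Z ^ 2 -
      5 * ((b ^ 3 + 2 * b ^ 2 * l₁) * Y ^ 2 + 2 * b ^ 2 * (X * Y)) +
      1 / 20 * ((b ^ 5 + 4 * b ^ 4 * l₁) * Z ^ 2 + 2 * b ^ 4 * (Y * Z)) -
      51 / 10 * ((b ^ 4 + 3 * b ^ 3 * l₁) * (Y * Z) + b ^ 3 * Y ^ 2 + b ^ 3 * (X * Z)) -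
      L * ((b ^ 2 + b * l₁) * (Z * Y) + b * Y ^ 2 + b * (Z * X)) +
      N * b * (|Z * X| + |Y * X| + |Z * Y| + Z ^ 2) ≤ C * Z ^ 2 := by
  set κ : ℝ := 1 / 50 with hκ
  -- The null form with multiplier `-L` supplies `-L b Y²`, and `L` is the sum of the coefficients
  -- of `b Y²` created by the error terms below. Its other terms cost only multiples of `b Z²`,
  -- collected in `G`, which the fifth power absorbs afterwards; so `L` may be fixed before `G`.
  set L : ℝ := 5 * A + (5 * A) ^ 2 / (4 * (κ / 8)) + N ^ 2 / (4 * (κ / 8)) + 1 with hL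
  have hL0 : 0 ≤ L := by positivity
  set G : ℝ := (L + N) ^ 2 / (4 * (κ / 8)) + L ^ 2 / (4 * (κ / 8)) + (L * A + N) ^ 2 / 4 + N with hG
  have hG0 : 0 ≤ G := by positivity
  obtain ⟨C, hC0, hC⟩ := exists_pow_le κ (26 * A ^ 2 + (16 * A) ^ 2 / (4 * (κ / 8)) + G)
    (by norm_num) (by positivity)
  refine ⟨L, C, hC0, fun b l₁ l₂ l₃ l₄ X Y Z hb h1 h2 h3 h4 => ?_⟩
  have hM := principal_form_le hb X Y Z
  have hA2 : A ≤ A ^ 2 := le_self_pow₀ hA (by norm_num)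
  have b1 := abs_le.1 h1
  have b2 := abs_le.1 h2
  have b3 := abs_le.1 h3
  have b4 := abs_le.1 h4
  have hl11 : l₁ ^ 2 ≤ A ^ 2 := by rw [← sq_abs]; gcongr
  have hl12 : |l₁ * l₂| ≤ A ^ 2 := by
    rw [abs_mul, pow_two]; exact mul_le_mul h1 h2 (abs_nonneg _) (by linarith)
  have b12 := abs_le.1 hl12
  -- the terms with `Y ^ 2`
  have eY : 5 * (3 * b ^ 2 * l₁ + b * l₂) * Y ^ 2 - 5 * (2 * b ^ 2 * l₁) * Y ^ 2 ≤
      5 * A * (b ^ 2 * Y ^ 2) + 5 * A * (b * Y ^ 2) := by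
    have e1 : b ^ 2 * Y ^ 2 * l₁ ≤ b ^ 2 * Y ^ 2 * A :=
      mul_le_mul_of_nonneg_left b1.2 (by positivity)
    have e2 : b * Y ^ 2 * l₂ ≤ b * Y ^ 2 * A := mul_le_mul_of_nonneg_left b2.2 (by positivity)
    linarith
  have eY2 : 5 * A * (b ^ 2 * Y ^ 2) ≤ κ / 8 * (b ^ 3 * Y ^ 2) +
      (5 * A) ^ 2 / (4 * (κ / 8)) * (b * Y ^ 2) := by
    have := mul_le_mul_of_nonneg_left (mul_abs_mul_le (θ := κ / 8) (by norm_num) (5 * A) b 1)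
      (by positivity : 0 ≤ b * Y ^ 2)
    rw [mul_one, abs_of_pos hb] at this
    linarith
  -- the terms with `Z ^ 2`
  have eZ : -(10 * b ^ 4 * l₁ + b ^ 3 * (10 * l₂ + 15 * l₁ ^ 2) +
        b ^ 2 * (5 * l₃ + 10 * (l₁ * l₂)) + b * l₄) * Z ^ 2 + 1 / 20 * (4 * b ^ 4 * l₁) * Z ^ 2 ≤
      26 * A ^ 2 * (b + b ^ 2 + b ^ 3 + b ^ 4) * Z ^ 2 := by
    rw [← add_mul]
    refine mul_le_mul_of_nonneg_right ?_ (sq_nonneg Z)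
    have e1 : b ^ 4 * (-l₁) ≤ b ^ 4 * A ^ 2 :=
      mul_le_mul_of_nonneg_left (by linarith) (by positivity)
    have e2 : b ^ 3 * (-(10 * l₂ + 15 * l₁ ^ 2)) ≤ b ^ 3 * (26 * A ^ 2) :=
      mul_le_mul_of_nonneg_left (by linarith [sq_nonneg l₁, sq_nonneg A]) (by positivity)
    have e3 : b ^ 2 * (-(5 * l₃ + 10 * (l₁ * l₂))) ≤ b ^ 2 * (26 * A ^ 2) :=
      mul_le_mul_of_nonneg_left (by linarith [sq_nonneg l₁, sq_nonneg A]) (by positivity)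
    have e4 : b * (-l₄) ≤ b * (26 * A ^ 2) :=
      mul_le_mul_of_nonneg_left (by linarith [sq_nonneg l₁, sq_nonneg A]) (by positivity)
    have e5 : 0 ≤ b ^ 4 * A ^ 2 := by positivity
    linarith
  -- the mixed terms
  have eYZ : -(51 / 10) * (3 * b ^ 3 * l₁ * (Y * Z)) ≤ κ / 8 * (b ^ 3 * Y ^ 2) +
      (16 * A) ^ 2 / (4 * (κ / 8)) * (b ^ 3 * Z ^ 2) := by
    have := mul_le_mul_of_nonneg_left (mul_abs_mul_le (θ := κ / 8) (by norm_num) (16 * A) Y Z)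
      (by positivity : 0 ≤ b ^ 3)
    have e1 : -(l₁ * (Y * Z)) ≤ A * |Y * Z| := by
      refine (neg_le_abs _).trans ?_
      rw [abs_mul]
      exact mul_le_mul_of_nonneg_right h1 (abs_nonneg _)
    have e2 := mul_le_mul_of_nonneg_left e1 (by positivity : 0 ≤ b ^ 3)
    have e3 : 0 ≤ b ^ 3 * (A * |Y * Z|) := by positivity
    linarith
  have eXZ : -(L * (b * (Z * X))) + N * b * |Z * X| ≤ κ / 8 * (b * X ^ 2) +
      (L + N) ^ 2 / (4 * (κ / 8)) * (b * Z ^ 2) := by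
    have := mul_le_mul_of_nonneg_left (mul_abs_mul_le (θ := κ / 8) (by norm_num) (L + N) X Z) hb.le
    have e1 := mul_le_mul_of_nonneg_left (neg_le_abs (Z * X)) (mul_nonneg hL0 hb.le)
    rw [mul_comm X Z] at this
    linarith
  have eYX : N * b * |Y * X| ≤ κ / 8 * (b * X ^ 2) + N ^ 2 / (4 * (κ / 8)) * (b * Y ^ 2) := by
    have := mul_le_mul_of_nonneg_left (mul_abs_mul_le (θ := κ / 8) (by norm_num) N X Y) hb.le
    rw [mul_comm X Y] at this
    linarith
  have eZY : -(L * (b ^ 2 * (Z * Y))) ≤ κ / 8 * (b ^ 3 * Y ^ 2) +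
      L ^ 2 / (4 * (κ / 8)) * (b * Z ^ 2) := by
    have := mul_le_mul_of_nonneg_left (mul_abs_mul_le (θ := κ / 8) (by norm_num) L (b * Y) Z) hb.le
    have e1 := mul_le_mul_of_nonneg_left (neg_le_abs (b * Y * Z)) (mul_nonneg hL0 hb.le)
    linarith
  have eZY' : -(L * (b * l₁ * (Z * Y))) + N * b * |Z * Y| ≤ b * Y ^ 2 +
      (L * A + N) ^ 2 / 4 * (b * Z ^ 2) := by
    have := mul_le_mul_of_nonneg_left (mul_abs_mul_le (θ := 1) (by norm_num) (L * A + N) Y Z) hb.le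
    have e1 : -(l₁ * (Z * Y)) ≤ A * |Z * Y| := by
      refine (neg_le_abs _).trans ?_
      rw [abs_mul]
      exact mul_le_mul_of_nonneg_right h1 (abs_nonneg _)
    have e2 := mul_le_mul_of_nonneg_left e1 (mul_nonneg hL0 hb.le)
    rw [mul_comm Y Z] at this
    linarith
  have eb := mul_le_mul_of_nonneg_right (hC b hb) (sq_nonneg Z)
  have p1 : 0 ≤ G * (b ^ 2 + b ^ 3 + b ^ 4) * Z ^ 2 := by positivity
  have p2 : 0 ≤ (16 * A) ^ 2 / (4 * (κ / 8)) * (b + b ^ 2 + b ^ 4) * Z ^ 2 := by positivity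
  have p3 : 0 ≤ b * X ^ 2 := by positivity
  have p4 : 0 ≤ b ^ 3 * Y ^ 2 := by positivity
  have eL : L * (b * Y ^ 2) = 5 * A * (b * Y ^ 2) + (5 * A) ^ 2 / (4 * (κ / 8)) * (b * Y ^ 2) +
    N ^ 2 / (4 * (κ / 8)) * (b * Y ^ 2) + b * Y ^ 2 := by rw [hL]; ring
  have eG : G * (b * Z ^ 2) = (L + N) ^ 2 / (4 * (κ / 8)) * (b * Z ^ 2) +
    L ^ 2 / (4 * (κ / 8)) * (b * Z ^ 2) + (L * A + N) ^ 2 / 4 * (b * Z ^ 2) + N * (b * Z ^ 2) := by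
    rw [hG]; ring
  -- With the constants turned into atoms, the claim is a linear combination of the inequalities
  -- collected above.
  clear_value L G κ
  generalize (5 * A) ^ 2 / (4 * (κ / 8)) = c1 at *
  generalize (16 * A) ^ 2 / (4 * (κ / 8)) = c2 at *
  generalize N ^ 2 / (4 * (κ / 8)) = c3 at *
  generalize (L + N) ^ 2 / (4 * (κ / 8)) = c4 at *
  generalize L ^ 2 / (4 * (κ / 8)) = c5 at *
  generalize (L * A + N) ^ 2 / 4 = c6 at *
  subst hκ
  linarith

/-! ### Derivatives of the exponential weight and integrands of vanishing integral. -/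

lemma BddCont.pow {κ : ℝ → ℝ} (h : BddCont κ) (n : ℕ) : BddCont (fun x => κ x ^ n) := by
  induction n with
  | zero => simpa using BddCont.const 1
  | succ n ih => simpa only [pow_succ] using ih.mul h

/-- The derivatives of a function `φ` with `φ' = φ B₀`, where `B (k + 1)` is the derivative
of `B k`. -/
def bellTower (φ : ℝ → ℝ) (B : ℕ → ℝ → ℝ) : ℕ → ℝ → ℝ
  | 0 => φ
  | 1 => fun x => φ x * B 0 x
  | 2 => fun x => φ x * (B 0 x ^ 2 + B 1 x)
  | 3 => fun x => φ x * (B 0 x ^ 3 + 3 * (B 0 x * B 1 x) + B 2 x)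
  | 4 => fun x => φ x * (B 0 x ^ 4 + 6 * (B 0 x ^ 2 * B 1 x) + 4 * (B 0 x * B 2 x) +
      3 * B 1 x ^ 2 + B 3 x)
  | 5 => fun x => φ x * (B 0 x ^ 5 + 10 * (B 0 x ^ 3 * B 1 x) + 10 * (B 0 x ^ 2 * B 2 x) +
      15 * (B 0 x * B 1 x ^ 2) + 5 * (B 0 x * B 3 x) + 10 * (B 1 x * B 2 x) + B 4 x)
  | _ => 0

lemma bddTower_bellTower {φ : ℝ → ℝ} {B : ℕ → ℝ → ℝ} (dφ : ∀ x, HasDerivAt φ (φ x * B 0 x) x)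
    (dB : ∀ k x, HasDerivAt (B k) (B (k + 1) x) x) (hφ : BddCont φ)
    (hB : ∀ k ≤ 4, BddCont (B k)) : BddTower 5 (bellTower φ B) := by
  refine ⟨fun k hk x => ?_, fun k hk => ?_⟩
  · have d0 := dB 0 x
    have d1 := dB 1 x
    have d2 := dB 2 x
    have d3 := dB 3 x
    interval_cases k
    · exact dφ x
    · exact ((dφ x).fun_mul d0).congr_deriv (by simp only [bellTower]; ring)
    · exact ((dφ x).fun_mul ((d0.fun_pow 2).fun_add d1)).congr_deriv
        (by simp only [bellTower]; norm_num; ring)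
    · exact ((dφ x).fun_mul (((d0.fun_pow 3).fun_add ((d0.fun_mul d1).const_mul 3)).fun_add
        d2)).congr_deriv (by simp only [bellTower]; norm_num; ring)
    · exact ((dφ x).fun_mul (((((d0.fun_pow 4).fun_add
        (((d0.fun_pow 2).fun_mul d1).const_mul 6)).fun_add ((d0.fun_mul d2).const_mul 4)).fun_add
        ((d1.fun_pow 2).const_mul 3)).fun_add d3)).congr_deriv
        (by simp only [bellTower]; norm_num; ring)
  · have b0 := hB 0 (by lia)
    have b1 := hB 1 (by lia)
    have b2 := hB 2 (by lia)
    have b3 := hB 3 (by lia)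
    have b4 := hB 4 (by lia)
    interval_cases k
    · exact hφ
    · exact hφ.mul b0
    · exact hφ.mul ((b0.pow 2).add b1)
    · exact hφ.mul (((b0.pow 3).add ((b0.mul b1).const_mul 3)).add b2)
    · exact hφ.mul (((((b0.pow 4).add (((b0.pow 2).mul b1).const_mul 6)).add
        ((b0.mul b2).const_mul 4)).add ((b1.pow 2).const_mul 3)).add b3)
    · exact hφ.mul (((((((b0.pow 5).add (((b0.pow 3).mul b1).const_mul 10)).add
        (((b0.pow 2).mul b2).const_mul 10)).add ((b0.mul (b1.pow 2)).const_mul 15)).add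
        ((b0.mul b3).const_mul 5)).add ((b1.mul b2).const_mul 10)).add b4)

/-- An integrable function whose integral vanishes. -/
def ZeroInt (g : ℝ → ℝ) : Prop := Integrable g ∧ ∫ x, g x = 0

lemma ZeroInt.add {f g : ℝ → ℝ} (hf : ZeroInt f) (hg : ZeroInt g) :
    ZeroInt (fun x => f x + g x) :=
  ⟨hf.1.add hg.1, by rw [integral_add hf.1 hg.1, hf.2, hg.2, add_zero]⟩

lemma ZeroInt.const_mul {f : ℝ → ℝ} (c : ℝ) (hf : ZeroInt f) : ZeroInt (fun x => c * f x) :=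
  ⟨hf.1.const_mul c, by rw [integral_const_mul, hf.2, mul_zero]⟩

/-- An exact derivative may be added to the integrand at no cost. This turns the energy inequality
into a pointwise inequality between quadratic forms, with freely chosen multipliers. -/
lemma ZeroInt.integral_le {F g R : ℝ → ℝ} (hg : ZeroInt g) (hF : Integrable F)
    (hR : Integrable R) (h : ∀ x, F x + g x ≤ R x) : ∫ x, F x ≤ ∫ x, R x := by
  have h1 : ∫ x, (F x + g x) = ∫ x, F x := by rw [integral_add hF hg.1, hg.2, add_zero]
  rw [← h1]
  exact integral_mono (hF.add hg.1) hR h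

lemma zeroInt_deriv {κ κ' f f' g g' : ℝ → ℝ} (dκ : ∀ x, HasDerivAt κ (κ' x) x)
    (df : ∀ x, HasDerivAt f (f' x) x) (dg : ∀ x, HasDerivAt g (g' x) x)
    (hκ : BddCont κ) (hκ' : BddCont κ') (hf : MemLp f 2 volume) (hf' : MemLp f' 2 volume)
    (hg : MemLp g 2 volume) (hg' : MemLp g' 2 volume) :
    ZeroInt (fun x => κ' x * f x * g x + κ x * f' x * g x + κ x * f x * g' x) := by
  have i1 := hκ'.integrable_mul_mul hf hg
  have i2 := hκ.integrable_mul_mul hf' hg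
  have i3 := hκ.integrable_mul_mul hf hg'
  refine ⟨(i1.add i2).add i3, ?_⟩
  have i12 : Integrable (fun x => κ' x * f x * g x + κ x * f' x * g x) := i1.add i2
  rw [integral_add i12 i3, integral_add i1 i2]
  exact integral_deriv_mul_mul dκ df dg hκ hκ' hf hf' hg hg'

lemma L2Tower.zeroInt_five {V : ℕ → ℝ → ℝ} (hV : L2Tower V) {φ : ℕ → ℝ → ℝ}
    (hφ : BddTower 5 φ) :
    ZeroInt (fun x => -2 * (φ 0 x * V 0 x * V 5 x) + -5 * (φ 1 x * V 2 x * V 2 x) +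
      5 * (φ 3 x * V 1 x * V 1 x) + -1 * (φ 5 x * V 0 x * V 0 x)) := by
  have i0 := ((hφ.bddCont 0 (by lia)).integrable_mul_mul (hV.memLp 0) (hV.memLp 5)).const_mul (-2)
  have i1 := ((hφ.bddCont 1 (by lia)).integrable_mul_mul (hV.memLp 2) (hV.memLp 2)).const_mul (-5)
  have i3 := ((hφ.bddCont 3 (by lia)).integrable_mul_mul (hV.memLp 1) (hV.memLp 1)).const_mul 5
  have i5 := ((hφ.bddCont 5 (by lia)).integrable_mul_mul (hV.memLp 0) (hV.memLp 0)).const_mul (-1)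
  have i01 : Integrable (fun x => -2 * (φ 0 x * V 0 x * V 5 x) + -5 * (φ 1 x * V 2 x * V 2 x)) :=
    i0.add i1
  have i013 : Integrable (fun x => -2 * (φ 0 x * V 0 x * V 5 x) + -5 * (φ 1 x * V 2 x * V 2 x) +
      5 * (φ 3 x * V 1 x * V 1 x)) := i01.add i3
  refine ⟨i013.add i5, ?_⟩
  rw [integral_add i013 i5, integral_add i01 i3, integral_add i0 i1, integral_const_mul,
    integral_const_mul, integral_const_mul, integral_const_mul]
  have := hV.integral_mul_five hφ le_rfl 0
  simp only [zero_add] at this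
  linarith

section ExponentialWeight

variable {δ : ℝ}

lemma bddCont_qW (hδ : 0 < δ) : BddCont (qW δ) := by
  refine ⟨continuous_of_forall_hasDerivAt (hasDerivAt_qW hδ), 1 + (5 / 4) ^ 5 * (10 / δ),
    fun x => ?_⟩
  have hq := qW_pos hδ x
  have h1 := (qW_pow_five_le hδ x).trans
    (mul_le_mul_of_nonneg_left (pW_le_const hδ x) (by norm_num))
  have h2 : 0 ≤ (5 / 4 : ℝ) ^ 5 * (10 / δ) := by positivity
  rw [abs_of_pos hq]
  rcases le_total (qW δ x) 1 with h | h
  · linarith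
  · have := le_self_pow₀ h (by norm_num : 5 ≠ 0)
    linarith

lemma bddCont_exp_pW (hδ : 0 < δ) (a : ℝ) : BddCont (fun x => Real.exp (a * pW δ x)) := by
  have hc : Continuous (pW δ) := continuous_of_forall_hasDerivAt (hasDerivAt_pW hδ)
  refine ⟨by fun_prop, Real.exp (|a| * (10 / δ)), fun x => ?_⟩
  rw [abs_of_pos (Real.exp_pos _), Real.exp_le_exp]
  exact mul_le_mul (le_abs_self a) (pW_le_const hδ x) (pW_nonneg hδ x) (abs_nonneg a)

lemma bddCont_pW (hδ : 0 < δ) : BddCont (pW δ) :=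
  ⟨continuous_of_forall_hasDerivAt (hasDerivAt_pW hδ), 10 / δ, fun x => by
    rw [abs_of_nonneg (pW_nonneg hδ x)]; exact pW_le_const hδ x⟩

/-- The exponential weight absorbs decaying coefficients. -/
lemma exp_mul_decay_le (hδ : 0 < δ) (hδ1 : δ ≤ 1) {a₁ a₀ a : ℝ} (h1 : 0 < a₁) (ha1 : a₁ ≤ a)
    (ha0 : a ≤ a₀) (x : ℝ) : Real.exp (a * pW δ x) * decay x ≤
      (16 / a₁ + Real.exp a₀) * (Real.exp (a * pW δ x) * (a * qW δ x) + 1) := by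
  have hE := Real.exp_pos (a * pW δ x)
  have ha : 0 < a := h1.trans_le ha1
  have hb : 0 < a * qW δ x := mul_pos ha (qW_pos hδ x)
  have hE0 := Real.exp_pos a₀
  -- On the right, `decay ≤ (16/a₁) a q` by `decay_le_qW`. On the left, `yW ≤ 1`, and the weight
  -- itself is at most `exp a₀`.
  rcases le_total 0 x with hx | hx
  · have h2 := decay_le_qW hδ hδ1 hx
    have h3 : decay x ≤ 16 / a₁ * (a * qW δ x) := by
      have : a₁ * decay x ≤ 16 * (a * qW δ x) := by
        have := mul_le_mul ha1 h2 (by have := decay_pos x; positivity) ha.le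
        linarith
      rw [div_mul_eq_mul_div, le_div_iff₀ h1]; linarith
    calc _ ≤ Real.exp (a * pW δ x) * (16 / a₁ * (a * qW δ x)) :=
          mul_le_mul_of_nonneg_left h3 hE.le
      _ = 16 / a₁ * (Real.exp (a * pW δ x) * (a * qW δ x)) := by ring
      _ ≤ _ := by gcongr <;> linarith
  · have h2 : Real.exp (a * pW δ x) ≤ Real.exp a₀ := by
      rw [Real.exp_le_exp]
      have := (pW_le_yW hδ x).trans (yW_le_one hx)
      have := pW_nonneg hδ x
      nlinarith
    calc _ ≤ Real.exp a₀ * 1 := mul_le_mul h2 (decay_le_one x) (decay_pos x).le hE0.le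
      _ ≤ _ := by
        have : 0 ≤ 16 / a₁ := by positivity
        have := mul_pos hE hb
        gcongr <;> linarith

end ExponentialWeight

/-! ### The exponential energy estimate. -/

/-- The remainder of the difference of the nonlinearities after the principal term. -/
lemma exists_difference_bound {L₀ L₁ : DiffPoly}
    (h₀ : ∀ p ∈ L₀, 1 ≤ p.2.length ∧ ∀ i ∈ p.2, i ≤ 2)
    (h₁ : ∀ p ∈ L₁, 2 ≤ p.2.length ∧ ∀ i ∈ p.2, i ≤ 2) {C : ℝ} (hC : 1 ≤ C) :
    ∃ K : ℝ, 0 ≤ K ∧ ∀ V V' : ℕ → ℝ → ℝ, DecayBound C V → DecayBound C V' → ∀ x,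
      |DiffPoly.eval V L₀ x| ≤ K * decay x ∧ |DiffPoly.eval V L₀.D x| ≤ K * decay x ∧
      |(DiffPoly.eval V L₀ x - DiffPoly.eval V' L₀ x) * V' 3 x +
        (DiffPoly.eval V L₁ x - DiffPoly.eval V' L₁ x)| ≤
        K * decay x * jetNorm (fun k x => V k x - V' k x) 3 x := by
  have hC0 : 0 ≤ C := by linarith
  have n1 := DiffPoly.bound_nonneg hC0 L₀
  have n2 := DiffPoly.bound_nonneg hC0 (DiffPoly.D L₀)
  have n3 := mul_nonneg (DiffPoly.lip_nonneg hC0 L₀) hC0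
  have n4 := DiffPoly.lip_nonneg hC0 L₁
  refine ⟨DiffPoly.bound C L₀ + DiffPoly.bound C L₀.D + DiffPoly.lip C L₀ * C + DiffPoly.lip C L₁,
    by positivity, fun V V' hV hV' x => ?_⟩
  have hd := decay_pos x
  have hd1 := decay_le_one x
  have hj := jetNorm_nonneg (fun k x => V k x - V' k x) 3 x
  have hdiff : ∀ i ≤ 2, |V i x - V' i x| ≤ jetNorm (fun k x => V k x - V' k x) 3 x := fun i hi =>
    abs_le_jetNorm (fun k x => V k x - V' k x) (by lia) x
  refine ⟨?_, ?_, ?_⟩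
  · refine (DiffPoly.abs_eval_le_bound_mul hC0 hd1 (fun p hp => (h₀ p hp).1) fun p hp i hi =>
      hV.abs_le_decay i (((h₀ p hp).2 i hi).trans (by lia)) x).trans ?_
    gcongr
    linarith
  · refine (DiffPoly.abs_eval_le_bound_mul hC0 hd1 (fun q hq => ?_) fun q hq i hi =>
      hV.abs_le_decay i ?_ x).trans ?_
    · obtain ⟨p, hp, hm⟩ := DiffPoly.exists_of_mem_D hq
      exact (length_of_mem_monDeriv hm).symm ▸ (h₀ p hp).1
    · obtain ⟨p, hp, hm⟩ := DiffPoly.exists_of_mem_D hq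
      exact le_of_mem_monDeriv hm (h₀ p hp).2 i hi
    · gcongr
      linarith
  · have e1 := DiffPoly.abs_eval_sub_le (V := V) (W := V') (P := L₀) (x := x) hC
      (fun p hp i hi => hV.abs_le i (((h₀ p hp).2 i hi).trans (by lia)) x)
      (fun p hp i hi => hV'.abs_le i (((h₀ p hp).2 i hi).trans (by lia)) x)
      (fun p hp i hi => hdiff i ((h₀ p hp).2 i hi))
    have e2 := DiffPoly.abs_eval_sub_le_mul (V := V) (W := V') (P := L₁) (x := x) hC hd.le hd1
      (fun p hp => (h₁ p hp).1)
      (fun p hp i hi => hV.abs_le_decay i (((h₁ p hp).2 i hi).trans (by lia)) x)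
      (fun p hp i hi => hV'.abs_le_decay i (((h₁ p hp).2 i hi).trans (by lia)) x)
      (fun p hp i hi => hdiff i ((h₁ p hp).2 i hi))
    have e3 := hV'.abs_le_decay 3 le_rfl x
    refine (abs_add_le _ _).trans ?_
    rw [abs_mul]
    have e4 := mul_le_mul e1 e3 (abs_nonneg _) ((abs_nonneg _).trans e1)
    have e5 : 0 ≤ decay x * jetNorm (fun k x => V k x - V' k x) 3 x := mul_nonneg hd.le hj
    nlinarith [mul_nonneg n1 e5, mul_nonneg n2 e5]

lemma WTower.integral_jets_le {V V' : ℕ → ℝ → ℝ} (hV : WTower V) (hV' : WTower V') {C : ℝ}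
    (hd : DecayBound C V) (hd' : DecayBound C V') {k : ℕ} (hk : k ≤ 8) :
    ∫ x, (V k x - V' k x) ^ 2 ≤ 4 * C := by
  have h1 := (hV.integral_sq_le_wInt hk).trans (hd.wInt_le k hk)
  have h2 := (hV'.integral_sq_le_wInt hk).trans (hd'.wInt_le k hk)
  have i1 := hV.integrable_sq k
  have i2 := hV'.integrable_sq k
  calc ∫ x, (V k x - V' k x) ^ 2 ≤ ∫ x, (2 * V k x ^ 2 + 2 * V' k x ^ 2) :=
        integral_mono (hV.toL2Tower.sub hV'.toL2Tower |>.integrable_sq k)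
          ((i1.const_mul 2).add (i2.const_mul 2)) fun x => by
            change (V k x - V' k x) ^ 2 ≤ 2 * V k x ^ 2 + 2 * V' k x ^ 2
            nlinarith [sq_nonneg (V k x + V' k x)]
    _ = 2 * (∫ x, V k x ^ 2) + 2 * ∫ x, V' k x ^ 2 := by
        rw [integral_add (i1.const_mul 2) (i2.const_mul 2), integral_const_mul, integral_const_mul]
    _ ≤ 4 * C := by linarith

/-- The error terms coming from coefficients absorbed by the exponential weight. -/
lemma coefficient_terms_le {φ b c c' g d K H X Y Z : ℝ} (hφ : 0 < φ) (hb : 0 < b) (hK : 0 ≤ K)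
    (hd1 : d ≤ 1) (hφd : φ * d ≤ H * (φ * b + 1)) (hc : |c| ≤ K * d)
    (hc' : |c'| ≤ K * d) (hg : |g| ≤ K * d * (|Z| + |Y| + |X|)) :
    φ * (2 * ((b * c + c') * Z * X + c * Y * X) - 2 * Z * g) ≤
      φ * (2 * K * (2 * H + 1) * b * (|Z * X| + |Y * X| + |Z * Y| + Z ^ 2)) +
        6 * K * H * (X ^ 2 + Y ^ 2 + Z ^ 2) := by
  have hH : 0 ≤ H ∨ H < 0 := le_or_gt 0 H
  have hd0 : 0 ≤ K * d := (abs_nonneg c).trans hc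
  rw [abs_mul, abs_mul, abs_mul, ← sq_abs Z, ← sq_abs X, ← sq_abs Y]
  set x := |X|
  set y := |Y|
  set z := |Z|
  have hx : 0 ≤ x := abs_nonneg X
  have hy : 0 ≤ y := abs_nonneg Y
  have hz : 0 ≤ z := abs_nonneg Z
  have t1 : b * c * Z * X ≤ b * K * (z * x) := by
    calc b * c * Z * X ≤ |b * c * Z * X| := le_abs_self _
      _ = b * |c| * (z * x) := by rw [abs_mul, abs_mul, abs_mul, abs_of_pos hb]; ring
      _ ≤ b * K * (z * x) := by
        have : |c| ≤ K := hc.trans (mul_le_of_le_one_right hK hd1)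
        gcongr
  have t2 : c' * Z * X ≤ K * d * (z * x) := by
    calc c' * Z * X ≤ |c' * Z * X| := le_abs_self _
      _ = |c'| * (z * x) := by rw [abs_mul, abs_mul]; ring
      _ ≤ _ := by gcongr
  have t3 : c * Y * X ≤ K * d * (y * x) := by
    calc c * Y * X ≤ |c * Y * X| := le_abs_self _
      _ = |c| * (y * x) := by rw [abs_mul, abs_mul]; ring
      _ ≤ _ := by gcongr
  have t4 : -(Z * g) ≤ z * (K * d * (z + y + x)) := by
    calc -(Z * g) ≤ |Z * g| := neg_le_abs _
      _ = z * |g| := abs_mul _ _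
      _ ≤ _ := by gcongr
  have s1 : φ * (2 * ((b * c + c') * Z * X + c * Y * X) - 2 * Z * g) ≤
      φ * (2 * b * K * (z * x)) + 2 * K * (φ * d) * (2 * (z * x) + y * x + z * y + z ^ 2) := by
    have : 2 * ((b * c + c') * Z * X + c * Y * X) - 2 * Z * g ≤
      2 * b * K * (z * x) + 2 * K * d * (2 * (z * x) + y * x + z * y + z ^ 2) := by linarith
    have := mul_le_mul_of_nonneg_left this hφ.le
    linarith
  have s2 : 2 * K * (φ * d) * (2 * (z * x) + y * x + z * y + z ^ 2) ≤
      2 * K * (H * (φ * b + 1)) * (2 * (z * x) + y * x + z * y + z ^ 2) := by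
    gcongr
  -- The sign of `H` is not assumed. If `H < 0`, then `hφd` forces `d < 0`, and `0 ≤ K d` leaves
  -- only `K = 0`.
  have hKH : 0 ≤ K * H := by
    rcases hH with h | h
    · positivity
    · have h1 : H * (φ * b + 1) < 0 := mul_neg_of_neg_of_pos h (by positivity)
      have h2 : d < 0 := by
        by_contra h3
        have := mul_nonneg hφ.le (not_lt.1 h3)
        linarith
      have : K = 0 := by
        by_contra h3
        have : 0 < K := lt_of_le_of_ne hK (Ne.symm h3)
        have := mul_neg_of_pos_of_neg this h2
        linarith
      simp [this]
  have s3 : 2 * (z * x) + y * x + z * y + z ^ 2 ≤ 3 * (x ^ 2 + y ^ 2 + z ^ 2) := by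
    nlinarith [sq_nonneg (z - x), sq_nonneg (y - x), sq_nonneg (z - y), sq_nonneg x, sq_nonneg y]
  have s4 := mul_le_mul_of_nonneg_left s3 hKH
  have s5 : 0 ≤ φ * b * K * (y * x + z * y + z ^ 2) := by positivity
  have s6 : 0 ≤ (K * H) * (φ * b * (y * x + z * y + z ^ 2)) :=
    mul_nonneg hKH (by positivity)
  nlinarith

/-- The exponential energy estimate for the difference of two solutions at a fixed time. -/
theorem exists_exponential_energy_bound {L₀ L₁ : DiffPoly}
    (h₀ : ∀ p ∈ L₀, 1 ≤ p.2.length ∧ ∀ i ∈ p.2, i ≤ 2)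
    (h₁ : ∀ p ∈ L₁, 2 ≤ p.2.length ∧ ∀ i ∈ p.2, i ≤ 2) {C : ℝ} (hC : 1 ≤ C)
    {a₁ a₀ : ℝ} (ha₁ : 0 < a₁) :
    ∃ K : ℝ, 0 ≤ K ∧ ∀ δ : ℝ, 0 < δ → δ ≤ 1 → ∀ a a' : ℝ, a₁ ≤ a → a ≤ a₀ →
      a' ≤ -(11 / 16) * (5 / 4) ^ 5 * a ^ 5 → ∀ V V' : ℕ → ℝ → ℝ, WTower V → WTower V' →
      DecayBound C V → DecayBound C V' → ∀ r : ℝ → ℝ, MemLp r 2 volume →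
      a' * (∫ x, pW δ x * Real.exp (a * pW δ x) * (V 0 x - V' 0 x) ^ 2) +
        2 * (∫ x, Real.exp (a * pW δ x) * (V 0 x - V' 0 x) * ((V 5 x - V' 5 x) -
          ((DiffPoly.eval V L₀ x * V 3 x + DiffPoly.eval V L₁ x) -
          (DiffPoly.eval V' L₀ x * V' 3 x + DiffPoly.eval V' L₁ x)) + r x)) ≤
      K * (∫ x, Real.exp (a * pW δ x) * (V 0 x - V' 0 x) ^ 2) + K +
        ∫ x, Real.exp (a * pW δ x) * r x ^ 2 := by
  obtain ⟨A, hA1, hA⟩ := exists_deriv_qW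
  obtain ⟨K, hK, hdiff⟩ := exists_difference_bound h₀ h₁ hC
  set H : ℝ := 16 / a₁ + Real.exp a₀ with hHdef
  have hH : 0 ≤ H := by have := Real.exp_pos a₀; positivity
  obtain ⟨L, G, hG, hpt⟩ := exists_pointwise_bound A (2 * K * (2 * H + 1)) hA1 (by positivity)
  -- The unweighted error is `6KH` times the sum of three square integrals, each at most `4C`,
  -- whence `72`. The extra `1` comes from Young's inequality for the error term `r`.
  refine ⟨G + 1 + 72 * K * H * C, by positivity,
    fun δ hδ hδ1 a a' haa ha0 ha' V V' hV hV' dV dV' r hr => ?_⟩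
  have ha : 0 < a := ha₁.trans_le haa
  obtain ⟨l, l0, lc, lb, ld⟩ := hA δ hδ
  set w : ℕ → ℝ → ℝ := fun k x => V k x - V' k x with hwdef
  have hw : L2Tower w := hV.toL2Tower.sub hV'.toL2Tower
  set φ : ℝ → ℝ := fun x => Real.exp (a * pW δ x) with hφdef
  have hφ0 : ∀ x, 0 < φ x := fun x => Real.exp_pos _
  have bφ : BddCont φ := bddCont_exp_pW hδ a
  -- With `b = a q` the successive derivatives of the exponent are `b l_k` with `l_k` bounded
  -- uniformly in `δ`. All derivatives of the weight are thus `φ` times polynomials in `b` and the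
  -- `l_k`.
  set B : ℕ → ℝ → ℝ := fun k x => a * (qW δ x * l k x) with hBdef
  have hB0 : ∀ x, B 0 x = a * qW δ x := fun x => by simp [hBdef, l0]
  have dB : ∀ k x, HasDerivAt (B k) (B (k + 1) x) x := fun k x => (ld k x).const_mul a
  have bB : ∀ k ≤ 4, BddCont (B k) := fun k hk =>
    ((bddCont_qW hδ).mul ⟨lc k, A, lb k hk⟩).const_mul a
  have dφ : ∀ x, HasDerivAt φ (φ x * B 0 x) x := fun x => by
    rw [hB0]; exact ((hasDerivAt_pW hδ x).const_mul a).exp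
  have tφ := bddTower_bellTower dφ dB bφ bB
  set c := DiffPoly.eval V L₀ with hcdef
  set c' := DiffPoly.eval V L₀.D with hc'def
  have bc : BddCont c := hV.toL2Tower.bddCont_eval L₀
  have bc' : BddCont c' := hV.toL2Tower.bddCont_eval L₀.D
  have dc : ∀ x, HasDerivAt c (c' x) x := fun x =>
    DiffPoly.hasDerivAt_eval hV.hasDerivAt L₀ x
  have b0 := bB 0 (by lia)
  have b1 := bB 1 (by lia)
  have dpow : ∀ n : ℕ, ∀ x, HasDerivAt (fun x => φ x * B 0 x ^ (n + 1))
      (φ x * (B 0 x ^ (n + 2) + (n + 1) * (B 0 x ^ n * B 1 x))) x := fun n x =>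
    ((dφ x).fun_mul ((dB 0 x).fun_pow (n + 1))).congr_deriv (by rw [Nat.add_sub_cancel]; push_cast; ring)
  have bpow : ∀ n : ℕ, BddCont (fun x => φ x * B 0 x ^ (n + 1)) := fun n => bφ.mul (b0.pow _)
  have bpow' : ∀ n : ℕ, BddCont
      (fun x => φ x * (B 0 x ^ (n + 2) + (n + 1) * (B 0 x ^ n * B 1 x))) := fun n =>
    bφ.mul ((b0.pow _).add (((b0.pow _).mul b1).const_mul _))
  have z5 := hw.zeroInt_five tφ
  -- The exact derivatives of `φb²Y²`, `φb⁴Z²`, `φb³ZY` and `φbZY`, with the multipliers of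
  -- `principal_form_le` and `exists_pointwise_bound`.
  have z2 := (zeroInt_deriv (dpow 1) (hw.hasDerivAt 1) (hw.hasDerivAt 1) (bpow 1) (bpow' 1)
    (hw.memLp 1) (hw.memLp 2) (hw.memLp 1) (hw.memLp 2)).const_mul (-5)
  have z4 := (zeroInt_deriv (dpow 3) (hw.hasDerivAt 0) (hw.hasDerivAt 0) (bpow 3) (bpow' 3)
    (hw.memLp 0) (hw.memLp 1) (hw.memLp 0) (hw.memLp 1)).const_mul (1 / 20)
  have z3 := (zeroInt_deriv (dpow 2) (hw.hasDerivAt 0) (hw.hasDerivAt 1) (bpow 2) (bpow' 2)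
    (hw.memLp 0) (hw.memLp 1) (hw.memLp 1) (hw.memLp 2)).const_mul (-51 / 10)
  have z1 := (zeroInt_deriv (dpow 0) (hw.hasDerivAt 0) (hw.hasDerivAt 1) (bpow 0) (bpow' 0)
    (hw.memLp 0) (hw.memLp 1) (hw.memLp 1) (hw.memLp 2)).const_mul (-L)
  -- The exact derivative of `φ c Z X` removes the third derivative of `w` from the nonlinear term.
  have zc := (zeroInt_deriv (fun x => (dφ x).fun_mul (dc x)) (hw.hasDerivAt 0)
    (hw.hasDerivAt 2) (bφ.mul bc) (((bφ.mul b0).mul bc).add (bφ.mul bc'))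
    (hw.memLp 0) (hw.memLp 1) (hw.memLp 2) (hw.memLp 3)).const_mul 2
  have z := ((((z5.add z2).add z4).add z3).add z1).add zc
  -- The difference of the nonlinearities is `c w₃ + g`. The coefficient `c` involves `V` only, and
  -- `g` is bounded by the jet of `w` up to order two.
  set g : ℝ → ℝ := fun x => (c x - DiffPoly.eval V' L₀ x) * V' 3 x +
    (DiffPoly.eval V L₁ x - DiffPoly.eval V' L₁ x) with hgdef
  have bL₁ : ∀ {U : ℕ → ℝ → ℝ}, WTower U → MemLp (DiffPoly.eval U L₁) 2 volume := fun hU =>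
    hU.toL2Tower.memLp_eval fun p hp => by have := (h₁ p hp).1; lia
  have hN : ∀ {U : ℕ → ℝ → ℝ}, WTower U → MemLp
      (fun x => DiffPoly.eval U L₀ x * U 3 x + DiffPoly.eval U L₁ x) 2 volume := fun hU =>
    ((hU.toL2Tower.bddCont_eval L₀).memLp_mul (hU.memLp 3)).add (bL₁ hU)
  have hR : MemLp (fun x => (V 5 x - V' 5 x) -
      ((DiffPoly.eval V L₀ x * V 3 x + DiffPoly.eval V L₁ x) -
      (DiffPoly.eval V' L₀ x * V' 3 x + DiffPoly.eval V' L₁ x)) + r x) 2 volume :=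
    ((hw.memLp 5).sub ((hN hV).sub (hN hV'))).add hr
  have iF1 : Integrable (fun x => a' * (pW δ x * φ x * w 0 x ^ 2)) :=
    (((bddCont_pW hδ).mul bφ).integrable_mul_sq (hw.memLp 0)).const_mul a'
  have iF2 := ((bφ.integrable_mul_mul (hw.memLp 0) hR).const_mul 2)
  have iR1 : Integrable (fun x => (G + 1) * (φ x * w 0 x ^ 2)) :=
    (bφ.integrable_mul_sq (hw.memLp 0)).const_mul (G + 1)
  have iR2 : Integrable (fun x => φ x * r x ^ 2) := bφ.integrable_mul_sq hr
  have iw0 := hw.integrable_sq 0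
  have iw1 := hw.integrable_sq 1
  have iw2 := hw.integrable_sq 2
  have iw21 : Integrable (fun x => w 2 x ^ 2 + w 1 x ^ 2) := iw2.add iw1
  have iw210 : Integrable (fun x => w 2 x ^ 2 + w 1 x ^ 2 + w 0 x ^ 2) := iw21.add iw0
  have iR3 : Integrable (fun x => 6 * K * H * (w 2 x ^ 2 + w 1 x ^ 2 + w 0 x ^ 2)) :=
    iw210.const_mul _
  have iR12 : Integrable (fun x => (G + 1) * (φ x * w 0 x ^ 2) + φ x * r x ^ 2) := iR1.add iR2
  have key := ZeroInt.integral_le (F := fun x => a' * (pW δ x * φ x * w 0 x ^ 2) +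
    2 * (φ x * w 0 x * ((V 5 x - V' 5 x) -
      ((DiffPoly.eval V L₀ x * V 3 x + DiffPoly.eval V L₁ x) -
      (DiffPoly.eval V' L₀ x * V' 3 x + DiffPoly.eval V' L₁ x)) + r x)))
    (R := fun x => (G + 1) * (φ x * w 0 x ^ 2) + φ x * r x ^ 2 +
      6 * K * H * (w 2 x ^ 2 + w 1 x ^ 2 + w 0 x ^ 2)) z (iF1.add iF2) (iR12.add iR3) ?_
  · rw [integral_add iF1 iF2, integral_const_mul, integral_const_mul,
      integral_add iR12 iR3, integral_add iR1 iR2, integral_const_mul, integral_const_mul,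
      integral_add iw21 iw0, integral_add iw2 iw1] at key
    have j0 : ∫ x, w 0 x ^ 2 ≤ 4 * C := hV.integral_jets_le hV' dV dV' (by lia)
    have j1 : ∫ x, w 1 x ^ 2 ≤ 4 * C := hV.integral_jets_le hV' dV dV' (by lia)
    have j2 : ∫ x, w 2 x ^ 2 ≤ 4 * C := hV.integral_jets_le hV' dV dV' (by lia)
    have j3 := mul_le_mul_of_nonneg_left (add_le_add (add_le_add j2 j1) j0)
      (by positivity : 0 ≤ 6 * K * H)
    have j4 : 0 ≤ ∫ x, φ x * w 0 x ^ 2 :=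
      integral_nonneg fun x => mul_nonneg (hφ0 x).le (sq_nonneg _)
    have j5 : 0 ≤ 72 * K * H * C * ∫ x, φ x * w 0 x ^ 2 := by positivity
    refine key.trans ?_
    change _ ≤ (G + 1 + 72 * K * H * C) * (∫ x, φ x * w 0 x ^ 2) + (G + 1 + 72 * K * H * C) +
      ∫ x, φ x * r x ^ 2
    linarith
  · intro x
    obtain ⟨k1, k2, k3⟩ := hdiff V V' dV dV' x
    have hq := qW_pos hδ x
    have hb : 0 < a * qW δ x := mul_pos ha hq
    have hf := hφ0 x
    have e1 : φ x * decay x ≤ H * (φ x * (a * qW δ x) + 1) :=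
      exp_mul_decay_le hδ hδ1 ha₁ haa ha0 x
    have e2 := coefficient_terms_le (X := w 2 x) (Y := w 1 x) (Z := w 0 x) (g := g x) hf hb hK
      (decay_le_one x) e1 k1 k2
      (by
        refine k3.trans_eq ?_
        rw [jetNorm]
        simp only [Finset.sum_range_succ, Finset.sum_range_zero, zero_add]
        rfl)
    have e3 := mul_le_mul_of_nonneg_left (hpt (a * qW δ x) (l 1 x) (l 2 x) (l 3 x) (l 4 x)
      (w 2 x) (w 1 x) (w 0 x) hb (lb 1 (by lia) x) (lb 2 (by lia) x) (lb 3 (by lia) x)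
      (lb 4 (by lia) x)) hf.le
    -- The only place where the decrease of the rate `a` is used: it becomes a multiple of `b⁵`.
    have e4 : a' * pW δ x ≤ -(11 / 16) * (a * qW δ x) ^ 5 := by
      have h1 := mul_le_mul_of_nonneg_right ha' (pW_nonneg hδ x)
      have h2 := mul_le_mul_of_nonneg_left (qW_pow_five_le hδ x) (by positivity : 0 ≤ a ^ 5)
      rw [mul_pow]
      linarith
    have e5 := mul_le_mul_of_nonneg_right e4
      (mul_nonneg hf.le (sq_nonneg (w 0 x)) : 0 ≤ φ x * w 0 x ^ 2)
    have e6 : 2 * (φ x * w 0 x * r x) ≤ φ x * w 0 x ^ 2 + φ x * r x ^ 2 := by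
      have := mul_nonneg hf.le (sq_nonneg (w 0 x - r x))
      linarith
    have eB : ∀ k, B k x = a * qW δ x * l k x := fun k => by simp only [hBdef]; ring
    have hN3 : (DiffPoly.eval V L₀ x * V 3 x + DiffPoly.eval V L₁ x) -
      (DiffPoly.eval V' L₀ x * V' 3 x + DiffPoly.eval V' L₁ x) = c x * w 3 x + g x := by
      simp only [hgdef, hcdef, hwdef]; ring
    have hw5 : V 5 x - V' 5 x = w 5 x := rfl
    simp only [hN3, hw5, bellTower, eB, l0]
    push_cast
    generalize hEb : a * qW δ x = b at *
    generalize φ x = f at *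
    generalize w 0 x = Z at *
    generalize w 1 x = Y at *
    generalize w 2 x = X at *
    generalize w 3 x = w3 at *
    generalize w 5 x = w5 at *
    norm_num only [zero_add]
    linarith

/-! ### Square integrable limits, convolutions and mollification. -/

lemma lintegral_enorm_sq {f : ℝ → ℝ} (hf : MemLp f 2 volume) :
    ∫⁻ x, ‖f x‖ₑ ^ 2 = ENNReal.ofReal (∫ x, f x ^ 2) := by
  rw [ofReal_integral_eq_lintegral_ofReal hf.integrable_sq (Eventually.of_forall fun x => sq_nonneg _)]
  congr 1
  ext x
  rw [Real.enorm_eq_ofReal_abs, ← ENNReal.ofReal_pow (abs_nonneg _), sq_abs]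

lemma eLpNorm_two_sq (f : ℝ → ℝ) : eLpNorm f 2 volume ^ 2 = ∫⁻ x, ‖f x‖ₑ ^ 2 := by
  rw [eLpNorm_eq_lintegral_rpow_enorm_toReal (by norm_num) (by norm_num), ← ENNReal.rpow_natCast,
    ← ENNReal.rpow_mul]
  norm_num

lemma memLp_two_of_lintegral_le {f : ℝ → ℝ} (hf : AEStronglyMeasurable f volume) {A : ℝ}
    (hA : 0 ≤ A) (h : ∫⁻ x, ‖f x‖ₑ ^ 2 ≤ ENNReal.ofReal A) :
    MemLp f 2 volume ∧ ∫ x, f x ^ 2 ≤ A := by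
  have hm : MemLp f 2 volume := by
    refine ⟨hf, ?_⟩
    have : eLpNorm f 2 volume ^ 2 < ⊤ := by
      rw [eLpNorm_two_sq]; exact h.trans_lt ENNReal.ofReal_lt_top
    by_contra hc
    rw [not_lt, top_le_iff] at hc
    simp [hc] at this
  refine ⟨hm, ?_⟩
  rw [lintegral_enorm_sq hm] at h
  exact (ENNReal.ofReal_le_ofReal_iff hA).1 h

/-- Fatou's lemma in `L²`. -/
lemma memLp_two_of_tendsto {F : ℕ → ℝ → ℝ} {f : ℝ → ℝ} {A : ℝ} (hA : 0 ≤ A)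
    (hF : ∀ n, MemLp (F n) 2 volume) (hAF : ∀ n, ∫ x, F n x ^ 2 ≤ A)
    (h : ∀ᵐ x, Tendsto (fun n => F n x) atTop (𝓝 (f x))) :
    MemLp f 2 volume ∧ ∫ x, f x ^ 2 ≤ A := by
  refine memLp_two_of_lintegral_le
    (aestronglyMeasurable_of_tendsto_ae atTop (fun n => (hF n).1) h) hA ?_
  calc ∫⁻ x, ‖f x‖ₑ ^ 2 = ∫⁻ x, liminf (fun n => ‖F n x‖ₑ ^ 2) atTop := by
        refine lintegral_congr_ae (h.mono fun x hx => ?_)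
        exact ((ENNReal.continuous_pow 2).tendsto _ |>.comp hx.enorm).liminf_eq.symm
    _ ≤ liminf (fun n => ∫⁻ x, ‖F n x‖ₑ ^ 2) atTop :=
        lintegral_liminf_le' fun n => (hF n).1.enorm.pow_const 2
    _ ≤ ENNReal.ofReal A := by
        refine liminf_le_of_le (by isBoundedDefault) fun b hb => ?_
        obtain ⟨n, hn⟩ := hb.exists
        refine hn.trans ?_
        rw [lintegral_enorm_sq (hF n)]
        exact ENNReal.ofReal_le_ofReal (hAF n)

/-- Young's inequality for the convolution of an integrable kernel with a function in `L²`. -/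
lemma lintegral_convolution_sq_le {κ f : ℝ → ℝ≥0∞} (hκ : AEMeasurable κ volume)
    (hf : AEMeasurable f volume) :
    ∫⁻ x, (∫⁻ y, κ (x - y) * f y) ^ 2 ≤ (∫⁻ x, κ x) ^ 2 * ∫⁻ x, f x ^ 2 := by
  have hκ1 : ∀ x, AEMeasurable (fun y => κ (x - y)) volume := fun x =>
    hκ.comp_quasiMeasurePreserving
      (Measure.measurePreserving_sub_left volume x).quasiMeasurePreserving
  -- The Cauchy–Schwarz inequality for the splitting `κ f = κ^{1/2} (κ^{1/2} f)`.
  have h1 : ∀ x, (∫⁻ y, κ (x - y) * f y) ^ 2 ≤ (∫⁻ z, κ z) * ∫⁻ y, κ (x - y) * f y ^ 2 := by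
    intro x
    have h := ENNReal.lintegral_mul_le_Lp_mul_Lq volume Real.HolderConjugate.two_two
      ((hκ1 x).pow_const (1 / 2 : ℝ)) (((hκ1 x).pow_const (1 / 2 : ℝ)).mul hf)
    have e1 : ∀ y, κ (x - y) ^ (1 / 2 : ℝ) * (κ (x - y) ^ (1 / 2 : ℝ) * f y) =
        κ (x - y) * f y := fun y => by
      rw [← mul_assoc, ← ENNReal.rpow_add_of_nonneg _ _ (by norm_num) (by norm_num)]
      norm_num
    have e2 : ∀ y, (κ (x - y) ^ (1 / 2 : ℝ)) ^ (2 : ℝ) = κ (x - y) := fun y => by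
      rw [← ENNReal.rpow_mul]; norm_num
    have e3 : ∀ y, (κ (x - y) ^ (1 / 2 : ℝ) * f y) ^ (2 : ℝ) = κ (x - y) * f y ^ 2 := fun y => by
      rw [ENNReal.mul_rpow_of_nonneg _ _ (by norm_num), e2, ENNReal.rpow_two]
    simp only [Pi.mul_apply, e1, e2, e3] at h
    rw [lintegral_sub_left_eq_self] at h
    calc _ ≤ ((∫⁻ z, κ z) ^ (1 / 2 : ℝ) * (∫⁻ y, κ (x - y) * f y ^ 2) ^ (1 / 2 : ℝ)) ^ 2 :=
          pow_le_pow_left' h 2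
      _ = _ := by
          rw [mul_pow, ← ENNReal.rpow_natCast, ← ENNReal.rpow_natCast, ← ENNReal.rpow_mul,
            ← ENNReal.rpow_mul]
          norm_num
  have hm : AEMeasurable (fun p : ℝ × ℝ => κ (p.1 - p.2) * f p.2 ^ 2)
      ((volume : Measure ℝ).prod volume) :=
    (hκ.comp_quasiMeasurePreserving (quasiMeasurePreserving_sub_of_right_invariant volume
      volume)).mul ((hf.pow_const 2).comp_quasiMeasurePreserving
        Measure.quasiMeasurePreserving_snd)
  calc _ ≤ ∫⁻ x, (∫⁻ z, κ z) * ∫⁻ y, κ (x - y) * f y ^ 2 := lintegral_mono h1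
    _ = (∫⁻ z, κ z) * ∫⁻ x, ∫⁻ y, κ (x - y) * f y ^ 2 := by
        rw [lintegral_const_mul'' _ hm.lintegral_prod_right']
    _ = (∫⁻ z, κ z) * ∫⁻ y, ∫⁻ x, κ (x - y) * f y ^ 2 := by
        rw [lintegral_lintegral_swap hm]
    _ = (∫⁻ z, κ z) * ∫⁻ y, (∫⁻ z, κ z) * f y ^ 2 := by
        congr 1
        refine lintegral_congr fun y => ?_
        rw [lintegral_mul_const'', lintegral_sub_right_eq_self]
        exact hκ.comp_quasiMeasurePreserving
          (measurePreserving_sub_right volume y).quasiMeasurePreserving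
    _ = _ := by
        rw [lintegral_const_mul'' _ (hf.pow_const 2)]; ring

/-- A function dominated by a convolution with an integrable kernel. -/
lemma memLp_of_abs_le_convolution {κ g F : ℝ → ℝ} (hκ : Integrable κ) (hg : MemLp g 2 volume)
    (hF : AEStronglyMeasurable F volume) (h : ∀ x, |F x| ≤ |∫ y, κ (x - y) * g y|) :
    MemLp F 2 volume ∧ ∫ x, F x ^ 2 ≤ (∫ x, |κ x|) ^ 2 * ∫ x, g x ^ 2 := by
  have i0 : 0 ≤ ∫ x, |κ x| := integral_nonneg fun _ => abs_nonneg _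
  have i1 : 0 ≤ ∫ x, g x ^ 2 := integral_nonneg fun _ => sq_nonneg _
  refine memLp_two_of_lintegral_le hF (by positivity) ?_
  calc ∫⁻ x, ‖F x‖ₑ ^ 2 ≤ ∫⁻ x, (∫⁻ y, ‖κ (x - y)‖ₑ * ‖g y‖ₑ) ^ 2 := by
        refine lintegral_mono fun x => pow_le_pow_left' ?_ 2
        calc ‖F x‖ₑ ≤ ‖∫ y, κ (x - y) * g y‖ₑ := by
              rw [enorm_le_iff_norm_le]; exact h x
          _ ≤ _ := by
              refine (enorm_integral_le_lintegral_enorm _).trans_eq ?_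
              simp only [enorm_mul]
    _ ≤ (∫⁻ x, ‖κ x‖ₑ) ^ 2 * ∫⁻ x, ‖g x‖ₑ ^ 2 :=
        lintegral_convolution_sq_le hκ.1.enorm hg.1.enorm
    _ = _ := by
        rw [lintegral_enorm_sq hg, ENNReal.ofReal_mul (by positivity),
          ENNReal.ofReal_pow i0]
        congr 2
        exact (ofReal_integral_norm_eq_lintegral_enorm hκ).symm

/-- The convolution of a kernel and a function. -/
def moll (κ f : ℝ → ℝ) (x : ℝ) : ℝ := ∫ y, κ (x - y) * f y

/-- Smooth kernels supported in `[-1,1]`. -/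
structure IsKernel (κ : ℝ → ℝ) : Prop where
  contDiff : ContDiff ℝ ∞ κ
  eq_zero : ∀ z, 1 < |z| → κ z = 0

namespace IsKernel

variable {κ f g : ℝ → ℝ}

lemma hasCompactSupport (h : IsKernel κ) : HasCompactSupport κ :=
  HasCompactSupport.intro (isCompact_Icc (a := -1) (b := 1)) fun z hz => h.eq_zero z <| by
    by_contra hc
    exact hz (abs_le.1 (not_lt.1 hc))

lemma continuous (h : IsKernel κ) : Continuous κ := h.contDiff.continuous

lemma integrable (h : IsKernel κ) : Integrable κ :=
  h.continuous.integrable_of_hasCompactSupport h.hasCompactSupport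

lemma deriv (h : IsKernel κ) : IsKernel (deriv κ) := by
  refine ⟨h.contDiff.iterate_deriv 1, fun z hz => ?_⟩
  have h1 : tsupport κ ⊆ Icc (-1) 1 := closure_minimal (fun z hz => by
    by_contra hc
    exact hz (h.eq_zero z (by
      by_contra hc'
      exact hc (abs_le.1 (not_lt.1 hc'))))) isClosed_Icc
  by_contra hc
  exact absurd (abs_le.2 (h1 (support_deriv_subset hc))) (not_le.2 hz)

lemma iteratedDeriv (h : IsKernel κ) (k : ℕ) : IsKernel (iteratedDeriv k κ) := by
  induction k with
  | zero => rwa [iteratedDeriv_zero]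
  | succ k ih => rw [iteratedDeriv_succ]; exact ih.deriv

lemma isTest (h : IsKernel κ) (x : ℝ) : IsTest (fun y => κ (x - y)) := by
  refine ⟨h.contDiff.comp (contDiff_const.sub contDiff_id), ?_⟩
  exact h.hasCompactSupport.comp_homeomorph (Homeomorph.subLeft x)

lemma memLp_sub (h : IsKernel κ) (x : ℝ) : MemLp (fun y => κ (x - y)) 2 volume :=
  (h.isTest x).1.continuous.memLp_of_hasCompactSupport (h.isTest x).2

lemma moll_eq_convolution (κ f : ℝ → ℝ) :
    moll κ f = convolution κ f (ContinuousLinearMap.lsmul ℝ ℝ) volume := by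
  ext x
  rw [convolution_eq_swap]
  rfl

lemma hasDerivAt_moll (h : IsKernel κ) (hf : LocallyIntegrable f volume) (x : ℝ) :
    HasDerivAt (moll κ f) (moll (_root_.deriv κ) f x) x := by
  rw [moll_eq_convolution, moll_eq_convolution]
  exact h.hasCompactSupport.hasDerivAt_convolution_left _ (h.contDiff.of_le (by simp)) hf x

lemma hasDerivAt_moll_iteratedDeriv (h : IsKernel κ) (hf : LocallyIntegrable f volume) (k : ℕ)
    (x : ℝ) :
    HasDerivAt (moll (_root_.iteratedDeriv k κ) f) (moll (_root_.iteratedDeriv (k + 1) κ) f x) x := by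
  rw [iteratedDeriv_succ]
  exact (h.iteratedDeriv k).hasDerivAt_moll hf x

lemma continuous_moll (h : IsKernel κ) (hf : LocallyIntegrable f volume) :
    Continuous (moll κ f) := continuous_of_forall_hasDerivAt (h.hasDerivAt_moll hf)

/-- The translates `κ (x - ·)` are test functions, and the signs from the reflection and from the
definition of the weak derivative cancel. -/
lemma moll_iteratedDeriv (h : IsKernel κ) {k : ℕ} (hfg : IsWeakDeriv k f g) :
    moll (_root_.iteratedDeriv k κ) f = moll κ g := by
  ext x
  have h1 := hfg.2.2 _ (h.isTest x)
  have h2 : ∀ y, _root_.iteratedDeriv k (fun y => κ (x - y)) y =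
      (-1) ^ k * _root_.iteratedDeriv k κ (x - y) := fun y => by
    rw [iteratedDeriv_comp_const_sub]; simp
  have e1 : ∫ y, f y * _root_.iteratedDeriv k (fun y => κ (x - y)) y =
      (-1) ^ k * moll (_root_.iteratedDeriv k κ) f x := by
    rw [moll, ← integral_const_mul]
    congr 1; ext y; rw [h2]; ring
  have e2 : ∫ y, g y * κ (x - y) = moll κ g x := by
    rw [moll]; congr 1; ext y; ring
  rw [e1, e2] at h1
  exact mul_left_cancel₀ (by positivity : ((-1 : ℝ) ^ k) ≠ 0) h1

lemma memLp_moll (h : IsKernel κ) (hf : MemLp f 2 volume) :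
    MemLp (moll κ f) 2 volume ∧ ∫ x, moll κ f x ^ 2 ≤ (∫ x, |κ x|) ^ 2 * ∫ x, f x ^ 2 :=
  memLp_of_abs_le_convolution h.integrable hf
    (h.continuous_moll (hf.locallyIntegrable (by norm_num))).aestronglyMeasurable fun _ => le_rfl

lemma _root_.FifthOrder.bracket_sq_le_of_abs_sub_le {x y : ℝ} (h : |x - y| ≤ 1) :
    bracket x ^ 2 ≤ 3 * bracket y ^ 2 := by
  rw [bracket_sq, bracket_sq]
  have := abs_le.1 h
  nlinarith [sq_nonneg (x - 2 * y), sq_abs (x - y), abs_nonneg (x - y)]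

/-- On the support of the kernel `|x - y| ≤ 1`, so the weight may be moved inside the integral at
the cost of the factor `3`. -/
lemma bracket_sq_mul_abs_moll_le (h : IsKernel κ)
    (hf : MemLp (fun x => bracket x ^ 2 * f x) 2 volume) (x : ℝ) :
    |bracket x ^ 2 * moll κ f x| ≤
      abs (∫ y, (3 * |κ (x - y)|) * |bracket y ^ 2 * f y|) := by
  have i1 : Integrable (fun y => 3 * |κ (x - y)| * |bracket y ^ 2 * f y|) :=
    integrable_mul_of_memLp ((h.memLp_sub x).abs.const_mul 3) hf.abs
  have e : bracket x ^ 2 * moll κ f x = ∫ y, bracket x ^ 2 * (κ (x - y) * f y) := by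
    rw [moll, integral_const_mul]
  rw [e]
  refine (abs_integral_le_integral_abs).trans ((integral_mono_of_nonneg
    (Eventually.of_forall fun _ => abs_nonneg _) i1 (Eventually.of_forall fun y => ?_)).trans
    (le_abs_self _))
  have hb : 0 ≤ bracket y ^ 2 := sq_nonneg _
  rcases le_or_gt |x - y| 1 with h1 | h1
  · have := bracket_sq_le_of_abs_sub_le h1
    calc |bracket x ^ 2 * (κ (x - y) * f y)| = bracket x ^ 2 * (|κ (x - y)| * |f y|) := by
          rw [abs_mul, abs_mul, abs_of_nonneg (sq_nonneg (bracket x))]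
      _ ≤ 3 * bracket y ^ 2 * (|κ (x - y)| * |f y|) := by gcongr
      _ = _ := by
        change _ = 3 * |κ (x - y)| * |bracket y ^ 2 * f y|
        rw [abs_mul (bracket y ^ 2), abs_of_nonneg hb]; ring
  · simp [h.eq_zero _ h1]

lemma memLp_weight_moll (h : IsKernel κ)
    (hf : MemLp (fun x => bracket x ^ 2 * f x) 2 volume) (hl : LocallyIntegrable f volume) :
    MemLp (fun x => bracket x ^ 2 * moll κ f x) 2 volume ∧
      ∫ x, (bracket x ^ 2 * moll κ f x) ^ 2 ≤
        9 * (∫ x, |κ x|) ^ 2 * ∫ x, (bracket x ^ 2 * f x) ^ 2 := by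
  have hb : Continuous fun x => bracket x ^ 2 := by
    have : (fun x => bracket x ^ 2) = fun x => 1 + x ^ 2 := by ext x; rw [bracket_sq]
    rw [this]; fun_prop
  obtain ⟨h1, h2⟩ := memLp_of_abs_le_convolution (κ := fun z => 3 * |κ z|)
    (g := fun y => |bracket y ^ 2 * f y|) (h.integrable.abs.const_mul 3) hf.abs
    (hb.mul (h.continuous_moll hl)).aestronglyMeasurable (h.bracket_sq_mul_abs_moll_le hf)
  refine ⟨h1, h2.trans_eq ?_⟩
  have e : ∀ z, abs (3 * |κ z|) = 3 * |κ z| := fun z => abs_of_nonneg (by positivity)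
  simp only [e, sq_abs, integral_const_mul]
  ring

/-- Pointwise decay of mollified functions. -/
lemma bracket_sq_mul_abs_moll_le_const (h : IsKernel κ)
    (hf : MemLp (fun x => bracket x ^ 2 * f x) 2 volume) (x : ℝ) :
    bracket x ^ 2 * |moll κ f x| ≤ 9 * (∫ z, κ z ^ 2) + ∫ y, (bracket y ^ 2 * f y) ^ 2 := by
  have h1 := h.bracket_sq_mul_abs_moll_le hf x
  rw [abs_mul, abs_of_nonneg (sq_nonneg (bracket x))] at h1
  refine h1.trans ?_
  rw [abs_of_nonneg (integral_nonneg fun y => by positivity)]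
  have i1 := ((h.memLp_sub x).integrable_sq).const_mul 9
  have i2 := hf.integrable_sq
  calc _ ≤ ∫ y, (9 * κ (x - y) ^ 2 + (bracket y ^ 2 * f y) ^ 2) := by
        refine integral_mono (integrable_mul_of_memLp ((h.memLp_sub x).abs.const_mul 3) hf.abs)
          (i1.add i2) fun y => ?_
        change 3 * |κ (x - y)| * |bracket y ^ 2 * f y| ≤ 9 * κ (x - y) ^ 2 + (bracket y ^ 2 * f y) ^ 2
        rw [← sq_abs (κ _), ← sq_abs (bracket y ^ 2 * f y)]
        nlinarith [sq_nonneg (3 * |κ (x - y)| - |bracket y ^ 2 * f y|), sq_nonneg |κ (x - y)|,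
          sq_nonneg |bracket y ^ 2 * f y|]
    _ = _ := by
        rw [integral_add i1 i2, integral_const_mul, integral_sub_left_eq_self (fun z => κ z ^ 2)]

lemma abs_moll_le_of_ae_abs_le (h : IsKernel κ) {C : ℝ} (hf : ∀ᵐ x, |f x| ≤ C) (x : ℝ) :
    |moll κ f x| ≤ C * ∫ z, |κ z| := by
  have i1 : Integrable (fun y => C * |κ (x - y)|) := (h.integrable.comp_sub_left x).abs.const_mul C
  calc |moll κ f x| ≤ ∫ y, C * |κ (x - y)| := by
        refine (abs_integral_le_integral_abs).trans (integral_mono_of_nonneg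
          (Eventually.of_forall fun _ => abs_nonneg _) i1 (hf.mono fun y hy => ?_))
        change |κ (x - y) * f y| ≤ C * |κ (x - y)|
        rw [abs_mul, mul_comm]
        gcongr
    _ = _ := by
        rw [integral_const_mul, integral_sub_left_eq_self (fun z => |κ z|)]

lemma tendsto_moll (h : IsKernel κ) {F : ℕ → ℝ → ℝ} {C : ℝ}
    (hm : ∀ n, AEStronglyMeasurable (F n) volume) (hF : ∀ n, ∀ x, |F n x| ≤ C)
    (hlim : ∀ᵐ x, Tendsto (fun n => F n x) atTop (𝓝 (f x))) (x : ℝ) :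
    Tendsto (fun n => moll κ (F n) x) atTop (𝓝 (moll κ f x)) := by
  refine tendsto_integral_of_dominated_convergence (fun y => |κ (x - y)| * C)
    (fun n => ((h.isTest x).1.continuous.aestronglyMeasurable).mul (hm n))
    ((h.integrable.comp_sub_left x).abs.mul_const C) (fun n => Eventually.of_forall fun y => ?_)
    (hlim.mono fun y hy => hy.const_mul _)
  rw [Real.norm_eq_abs, abs_mul]
  exact mul_le_mul_of_nonneg_left (hF n y) (abs_nonneg _)

/-- The error of the mollification of a differentiable function. -/
lemma integral_moll_sub_sq_le (h : IsKernel κ) (h0 : ∀ z, 0 ≤ κ z) (h1 : ∫ z, κ z = 1) {ε : ℝ}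
    (hε : 0 < ε) (hκε : ∀ z, ε < |z| → κ z = 0) {f' : ℝ → ℝ} (df : ∀ x, HasDerivAt f (f' x) x)
    (cf' : Continuous f') (hf : MemLp f 2 volume) (hf' : MemLp f' 2 volume) :
    MemLp (fun x => moll κ f x - f x) 2 volume ∧
      ∫ x, (moll κ f x - f x) ^ 2 ≤ 4 * ε ^ 2 * ∫ x, f' x ^ 2 := by
  have cf : Continuous f := continuous_of_forall_hasDerivAt df
  -- By the fundamental theorem of calculus the error at `x` is at most the integral of `|f'|` over
  -- `[x - ε, x + ε]`, that is, the convolution of `χ` with `|f'|`. Young's inequality then gives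
  -- the factor `(2ε)²`.
  set χ : ℝ → ℝ := (Icc (-ε) ε).indicator fun _ => (1 : ℝ) with hχ
  have iχ : Integrable χ :=
    (integrable_indicator_iff measurableSet_Icc).2 (integrableOn_const (by simp))
  have hχ1 : ∫ x, |χ x| = 2 * ε := by
    have : ∀ x, |χ x| = χ x := fun x => abs_of_nonneg (indicator_nonneg (fun _ _ => zero_le_one) x)
    simp only [this]
    rw [hχ, integral_indicator measurableSet_Icc]
    simp [hε.le]; ring
  have hmem : MemLp (fun x => moll κ f x - f x) 2 volume := (h.memLp_moll hf).1.sub hf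
  refine ⟨hmem, ((memLp_of_abs_le_convolution (g := fun y => |f' y|) iχ hf'.abs hmem.1 fun x => ?_).2).trans_eq ?_⟩
  · have iκ := h.integrable.comp_sub_left x
    have e1 : moll κ f x - f x = ∫ y, κ (x - y) * (f y - f x) := by
      have i1 : Integrable (fun y => κ (x - y) * f y) := integrable_mul_of_memLp (h.memLp_sub x) hf
      have : ∫ y, κ (x - y) * f x = f x := by
        rw [integral_mul_const, integral_sub_left_eq_self κ, h1, one_mul]
      calc _ = (∫ y, κ (x - y) * f y) - ∫ y, κ (x - y) * f x := by rw [this]; rfl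
        _ = _ := by
          rw [← integral_sub i1 (iκ.mul_const _)]
          congr 1; ext y; ring
    set J := ∫ y, χ (x - y) * |f' y| with hJ
    have e2 : J = ∫ y in Icc (x - ε) (x + ε), |f' y| := by
      rw [hJ, ← integral_indicator measurableSet_Icc]
      congr 1; ext y
      by_cases hy : y ∈ Icc (x - ε) (x + ε)
      · have : x - y ∈ Icc (-ε) ε := ⟨by linarith [hy.2], by linarith [hy.1]⟩
        simp [hχ, indicator_of_mem hy, indicator_of_mem this]
      · have : x - y ∉ Icc (-ε) ε := fun hc => hy ⟨by linarith [hc.2], by linarith [hc.1]⟩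
        simp [hχ, indicator_of_notMem hy, indicator_of_notMem this]
    have hJ0 : 0 ≤ J := by
      rw [e2]; exact integral_nonneg fun _ => abs_nonneg _
    have hint : IntegrableOn (fun y => |f' y|) (Icc (x - ε) (x + ε)) :=
      cf'.abs.continuousOn.integrableOn_Icc
    have e3 : ∀ y, |x - y| ≤ ε → |f y - f x| ≤ J := by
      intro y hy
      have hy' := abs_le.1 hy
      have e4 : ∫ z in x..y, f' z = f y - f x :=
        intervalIntegral.integral_eq_sub_of_hasDerivAt (fun z _ => df z)
          (cf'.intervalIntegrable x y)
      rw [← e4, e2]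
      refine (intervalIntegral.norm_integral_le_integral_norm_uIoc (f := f')
        (μ := volume)).trans ?_
      refine setIntegral_mono_set hint (Eventually.of_forall fun _ => abs_nonneg _)
        (LE.le.eventuallyLE ?_)
      intro z hz
      rcases le_total x y with hxy | hxy
      · rw [uIoc_of_le hxy] at hz
        exact ⟨by linarith [hz.1], by linarith [hz.2]⟩
      · rw [uIoc_of_ge hxy] at hz
        exact ⟨by linarith [hz.1], by linarith [hz.2]⟩
    change |moll κ f x - f x| ≤ |J|
    rw [abs_of_nonneg hJ0, e1]
    calc _ ≤ ∫ y, κ (x - y) * J := by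
          refine (abs_integral_le_integral_abs).trans (integral_mono_of_nonneg
            (Eventually.of_forall fun _ => abs_nonneg _) (iκ.mul_const J)
            (Eventually.of_forall fun y => ?_))
          change |κ (x - y) * (f y - f x)| ≤ κ (x - y) * J
          rw [abs_mul, abs_of_nonneg (h0 _)]
          rcases le_or_gt |x - y| ε with hy | hy
          · exact mul_le_mul_of_nonneg_left (e3 y hy) (h0 _)
          · simp [hκε _ hy]
      _ = J := by
          rw [integral_mul_const, integral_sub_left_eq_self κ, h1, one_mul]
  · rw [hχ1]
    simp only [sq_abs]
    ring

end IsKernel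

/-! ### Mollifications of functions with controlled norms. -/

/-- The standard approximate identity. -/
def stdBump (n : ℕ) : ContDiffBump (0 : ℝ) where
  rIn := 1 / (n + 1) / 2
  rOut := 1 / (n + 1)
  rIn_pos := by positivity
  rIn_lt_rOut := half_lt_self (by positivity)

/-- The normalised kernels of the standard approximate identity. -/
def stdKernel (n : ℕ) : ℝ → ℝ := (stdBump n).normed volume

lemma stdKernel_nonneg (n : ℕ) (z : ℝ) : 0 ≤ stdKernel n z := (stdBump n).nonneg_normed z

lemma integral_stdKernel (n : ℕ) : ∫ z, stdKernel n z = 1 := (stdBump n).integral_normed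

lemma integral_abs_stdKernel (n : ℕ) : ∫ z, |stdKernel n z| = 1 := by
  simp only [abs_of_nonneg (stdKernel_nonneg n _), integral_stdKernel]

lemma stdKernel_eq_zero (n : ℕ) {z : ℝ} (hz : 1 / ((n : ℝ) + 1) < |z|) : stdKernel n z = 0 := by
  by_contra hc
  have : z ∈ Function.support ((stdBump n).normed volume) := hc
  rw [ContDiffBump.support_normed_eq, Metric.mem_ball, dist_zero_right] at this
  exact absurd this (not_lt.2 hz.le)

lemma isKernel_stdKernel (n : ℕ) : IsKernel (stdKernel n) :=
  ⟨(stdBump n).contDiff_normed, fun z hz => stdKernel_eq_zero n (lt_of_le_of_lt (by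
    rw [div_le_one (by positivity)]; linarith [(Nat.cast_nonneg n : (0 : ℝ) ≤ n)]) hz)⟩

lemma ae_tendsto_moll_stdKernel {f : ℝ → ℝ} (hf : LocallyIntegrable f volume) :
    ∀ᵐ x, Tendsto (fun n => moll (stdKernel n) f x) atTop (𝓝 (f x)) := by
  have := ContDiffBump.ae_convolution_tendsto_right_of_locallyIntegrable (φ := stdBump)
    (l := atTop) (K := 2) (μ := volume) (g := f) tendsto_one_div_add_atTop_nhds_zero_nat
    (Eventually.of_forall fun n => by simp only [stdBump]; linarith) hf
  simp only [IsKernel.moll_eq_convolution]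
  exact this

/-- The weak derivatives of a function, the function itself being its derivative of order `0`. -/
def jet (f : ℝ → ℝ) : ℕ → ℝ → ℝ
  | 0 => f
  | k + 1 => weakDeriv (k + 1) f

/-- The functions of `H^{10} ∩ L²(⟨x⟩⁴ dx)` with norms controlled by `M`. -/
structure Controlled (M : ℝ) (f : ℝ → ℝ) : Prop where
  isWeakDeriv : ∀ k ≤ 10, IsWeakDeriv k f (jet f k)
  memLp : ∀ k ≤ 10, MemLp (jet f k) 2 volume
  integral_le : ∀ k ≤ 10, ∫ x, jet f k x ^ 2 ≤ M
  memLp_weight : MemLp (fun x => bracket x ^ 2 * f x) 2 volume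
  weight_le : ∫ x, (bracket x ^ 2 * f x) ^ 2 ≤ M

/-- The derivatives of the mollifications of a function. -/
def mollTower (n : ℕ) (f : ℝ → ℝ) (k : ℕ) : ℝ → ℝ := moll (iteratedDeriv k (stdKernel n)) f

lemma nonlinearity_eq_eval (Q₀ Q₁ : MvPolynomial (Fin 3) ℝ) (f : ℝ → ℝ) (x : ℝ) :
    nonlinearity Q₀ Q₁ f x = DiffPoly.eval (jet f) (nonlin Q₀ Q₁) x := by
  rw [eval_nonlin]; rfl

lemma jetNorm_sq_le (V : ℕ → ℝ → ℝ) (n : ℕ) (x : ℝ) :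
    jetNorm V n x ^ 2 ≤ n * ∑ i ∈ Finset.range n, V i x ^ 2 := by
  have := sq_sum_le_card_mul_sum_sq (s := Finset.range n) (f := fun i => |V i x|)
  simpa only [jetNorm, sq_abs, Finset.card_range] using this

lemma L2Tower.memLp_jetNorm {V : ℕ → ℝ → ℝ} (hV : L2Tower V) (n : ℕ) :
    MemLp (jetNorm V n) 2 volume :=
  memLp_finsetSum _ fun i _ => (hV.memLp i).abs

lemma L2Tower.integral_jetNorm_sq_le {V : ℕ → ℝ → ℝ} (hV : L2Tower V) {n : ℕ} {A : ℝ}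
    (h : ∀ i < n, ∫ x, V i x ^ 2 ≤ A) : ∫ x, jetNorm V n x ^ 2 ≤ n * (n * A) := by
  have i1 : ∀ i ∈ Finset.range n, Integrable (fun x => V i x ^ 2) := fun i _ => hV.integrable_sq i
  calc ∫ x, jetNorm V n x ^ 2 ≤ ∫ x, n * ∑ i ∈ Finset.range n, V i x ^ 2 :=
        integral_mono (hV.memLp_jetNorm n).integrable_sq
          ((integrable_finsetSum _ i1).const_mul _) fun x => jetNorm_sq_le V n x
    _ = n * ∑ i ∈ Finset.range n, ∫ x, V i x ^ 2 := by
        rw [integral_const_mul, integral_finsetSum _ i1]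
    _ ≤ _ := by
        gcongr
        refine (Finset.sum_le_sum fun i hi => h i (Finset.mem_range.1 hi)).trans_eq ?_
        simp

lemma integral_sq_le_of_abs_le {f g : ℝ → ℝ} (hg : MemLp g 2 volume) {K A : ℝ}
    (h : ∀ x, |f x| ≤ K * |g x|) (hA : ∫ x, g x ^ 2 ≤ A) : ∫ x, f x ^ 2 ≤ K ^ 2 * A := by
  calc ∫ x, f x ^ 2 ≤ ∫ x, K ^ 2 * g x ^ 2 := by
        refine integral_mono_of_nonneg (Eventually.of_forall fun _ => sq_nonneg _)
          (hg.integrable_sq.const_mul _) (Eventually.of_forall fun x => ?_)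
        change f x ^ 2 ≤ K ^ 2 * g x ^ 2
        rw [← sq_abs (f x), ← sq_abs (g x), ← mul_pow]
        exact pow_le_pow_left₀ (abs_nonneg _) (h x) 2
    _ ≤ _ := by rw [integral_const_mul]; gcongr

lemma integral_add_sq_le {f g : ℝ → ℝ} (hf : MemLp f 2 volume) (hg : MemLp g 2 volume) :
    ∫ x, (f x + g x) ^ 2 ≤ 2 * (∫ x, f x ^ 2) + 2 * ∫ x, g x ^ 2 := by
  have i1 := hf.integrable_sq.const_mul 2
  have i2 := hg.integrable_sq.const_mul 2
  calc ∫ x, (f x + g x) ^ 2 ≤ ∫ x, (2 * f x ^ 2 + 2 * g x ^ 2) := by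
        refine integral_mono (hf.add hg).integrable_sq (i1.add i2) fun x => ?_
        change (f x + g x) ^ 2 ≤ 2 * f x ^ 2 + 2 * g x ^ 2
        nlinarith [sq_nonneg (f x - g x)]
    _ = _ := by rw [integral_add i1 i2, integral_const_mul, integral_const_mul]

/-- A differential polynomial in which at most one factor is not bounded. -/
lemma DiffPoly.abs_eval_le_jetNorm {V : ℕ → ℝ → ℝ} {C x : ℝ} (hC : 1 ≤ C) {P : DiffPoly}
    (hP : ∀ p ∈ P, 2 ≤ p.2.length ∧ excess p.2 ≤ 8 ∧ ∀ i ∈ p.2, i ≤ 10)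
    (h : ∀ i ≤ 9, |V i x| ≤ C) : |DiffPoly.eval V P x| ≤ P.bound C * jetNorm V 11 x := by
  refine (DiffPoly.abs_eval_le (b := fun p => C ^ p.2.length * jetNorm V 11 x)
    fun p hp => ?_).trans_eq ?_
  · obtain ⟨h1, h2, h3⟩ := hP p hp
    obtain ⟨j, hj, -, -, h4⟩ := exists_top_factor h1 (h2.trans (by lia))
    have e1 : |monEval V (p.2.erase j) x| ≤ C ^ (p.2.erase j).length :=
      abs_monEval_le fun i hi => h i ((h4 i hi).1.trans (by lia))
    have e2 : C ^ (p.2.erase j).length ≤ C ^ p.2.length :=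
      pow_le_pow_right₀ hC List.length_erase_le
    rw [monEval_erase hj, abs_mul, mul_comm]
    exact mul_le_mul (e1.trans e2) (abs_le_jetNorm V (by have := h3 j hj; lia) x) (abs_nonneg _)
      (by positivity)
  · rw [DiffPoly.bound, ← List.sum_map_mul_right]
    congr 1
    exact List.map_congr_left fun p _ => by ring

lemma L2Tower.moll_iteratedDeriv {F : ℕ → ℝ → ℝ} (hF : L2Tower F) {κ : ℝ → ℝ} (h : IsKernel κ)
    (k : ℕ) : moll (iteratedDeriv k κ) (F 0) = moll κ (F k) := by
  have step : ∀ (κ : ℝ → ℝ), IsKernel κ → ∀ k, moll (deriv κ) (F k) = moll κ (F (k + 1)) := by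
    intro κ h k
    ext x
    have d1 : ∀ y, HasDerivAt (fun y => κ (x - y)) (-deriv κ (x - y)) y := fun y => by
      have := ((h.contDiff.differentiable (by simp)) (x - y)).hasDerivAt.comp_const_sub x y
      exact this
    have e := integral_deriv_mul_mul (κ := fun _ => 1) (κ' := fun _ => 0)
      (fun x => hasDerivAt_const x (1 : ℝ)) d1 (hF.hasDerivAt k) (BddCont.const 1)
      (BddCont.const 0) (h.memLp_sub x) ((h.deriv.memLp_sub x).neg) (hF.memLp k)
      (hF.memLp (k + 1))
    have i1 := integrable_mul_of_memLp (h.deriv.memLp_sub x) (hF.memLp k)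
    have i2 := integrable_mul_of_memLp (h.memLp_sub x) (hF.memLp (k + 1))
    simp only [zero_mul, one_mul, integral_zero, zero_add, neg_mul, integral_neg] at e
    change ∫ y, deriv κ (x - y) * F k y = ∫ y, κ (x - y) * F (k + 1) y
    linarith
  induction k generalizing κ with
  | zero => rw [iteratedDeriv_zero]
  | succ k ih => rw [iteratedDeriv_succ', ih h.deriv, step κ h]

section

variable {M : ℝ} {f : ℝ → ℝ}

lemma Controlled.nonneg (hf : Controlled M f) : 0 ≤ M :=
  (integral_nonneg fun _ => sq_nonneg _).trans hf.weight_le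

lemma Controlled.locallyIntegrable (hf : Controlled M f) : LocallyIntegrable f volume :=
  (hf.isWeakDeriv 0 (by lia)).1

lemma Controlled.mollTower_eq (hf : Controlled M f) (n : ℕ) {k : ℕ} (hk : k ≤ 10) :
    mollTower n f k = moll (stdKernel n) (jet f k) :=
  (isKernel_stdKernel n).moll_iteratedDeriv (hf.isWeakDeriv k hk)

lemma Controlled.wTower (hf : Controlled M f) (n : ℕ) : WTower (mollTower n f) where
  hasDerivAt := (isKernel_stdKernel n).hasDerivAt_moll_iteratedDeriv hf.locallyIntegrable
  memLp k := (((isKernel_stdKernel n).iteratedDeriv k).memLp_moll (hf.memLp 0 (by lia))).1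
  memLp_weight k := by
    have h := (((isKernel_stdKernel n).iteratedDeriv k).memLp_weight_moll hf.memLp_weight
      hf.locallyIntegrable).1
    simp only [brPow, Real.rpow_two]
    exact h

lemma Controlled.integral_mollTower_sq_le_jet (hf : Controlled M f) (n : ℕ) {k : ℕ}
    (hk : k ≤ 10) : ∫ x, mollTower n f k x ^ 2 ≤ ∫ x, jet f k x ^ 2 := by
  rw [hf.mollTower_eq n hk]
  refine ((isKernel_stdKernel n).memLp_moll (hf.memLp k hk)).2.trans ?_
  rw [integral_abs_stdKernel, one_pow, one_mul]

lemma Controlled.integral_mollTower_sq_le (hf : Controlled M f) (n : ℕ) {k : ℕ} (hk : k ≤ 10) :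
    ∫ x, mollTower n f k x ^ 2 ≤ M :=
  (hf.integral_mollTower_sq_le_jet n hk).trans (hf.integral_le k hk)

lemma Controlled.wInt_mollTower_le (hf : Controlled M f) (n : ℕ) :
    wInt (mollTower n f) 0 ≤ 9 * ∫ x, (bracket x ^ 2 * f x) ^ 2 := by
  have h := ((isKernel_stdKernel n).memLp_weight_moll hf.memLp_weight hf.locallyIntegrable).2
  have e : wInt (mollTower n f) 0 = ∫ x, (bracket x ^ 2 * moll (stdKernel n) f x) ^ 2 := by
    rw [wInt]
    congr 1; ext x
    have : brPow (4 - (0 : ℕ) / 2) x = bracket x ^ 4 := by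
      rw [brPow, ← Real.rpow_natCast]; norm_num
    rw [this, mollTower, iteratedDeriv_zero]; ring
  rw [e]
  refine h.trans ?_
  rw [integral_abs_stdKernel, one_pow, mul_one]

lemma Controlled.abs_mollTower_le (hf : Controlled M f) (n : ℕ) {k : ℕ} (hk : k ≤ 9) (x : ℝ) :
    |mollTower n f k x| ≤ 1 + 2 * M := by
  have hV := (hf.wTower n).toL2Tower
  have h := sq_le_integral_sq_add (hV.hasDerivAt k) (hV.memLp k) (hV.memLp (k + 1)) x
  have h1 := hf.integral_mollTower_sq_le n (k := k) (by lia)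
  have h2 := hf.integral_mollTower_sq_le n (k := k + 1) (by lia)
  rw [← sq_abs] at h
  nlinarith [sq_nonneg (|mollTower n f k x| - 1)]

lemma Controlled.ae_tendsto_mollTower (hf : Controlled M f) {k : ℕ} (hk : k ≤ 10) :
    ∀ᵐ x, Tendsto (fun n => mollTower n f k x) atTop (𝓝 (jet f k x)) := by
  simp only [hf.mollTower_eq _ hk]
  exact ae_tendsto_moll_stdKernel (hf.isWeakDeriv k hk).2.1

lemma stdKernel_moll_sub_sq_le {F F' : ℝ → ℝ} (dF : ∀ x, HasDerivAt F (F' x) x)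
    (cF' : Continuous F') (hF : MemLp F 2 volume) (hF' : MemLp F' 2 volume) (n : ℕ) :
    MemLp (fun x => moll (stdKernel n) F x - F x) 2 volume ∧
      ∫ x, (moll (stdKernel n) F x - F x) ^ 2 ≤ 4 * (1 / ((n : ℝ) + 1)) ^ 2 * ∫ x, F' x ^ 2 :=
  (isKernel_stdKernel n).integral_moll_sub_sq_le (stdKernel_nonneg n) (integral_stdKernel n)
    (by positivity) (fun _ => stdKernel_eq_zero n) dF cF' hF hF'

/-- The weak derivatives need not be differentiable, so the error bound is applied to the
mollifications of index `m`, uniformly in `m`, and passes to the limit by Fatou's lemma. One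
derivative is spent, hence `k ≤ 9`. -/
lemma Controlled.integral_mollTower_sub_sq_le (hf : Controlled M f) (n : ℕ) {k : ℕ}
    (hk : k ≤ 9) :
    MemLp (fun x => mollTower n f k x - jet f k x) 2 volume ∧
      ∫ x, (mollTower n f k x - jet f k x) ^ 2 ≤ 4 * (1 / ((n : ℝ) + 1)) ^ 2 * M := by
  have hM := hf.nonneg
  have h : ∀ m, MemLp (fun x => moll (stdKernel n) (mollTower m f k) x - mollTower m f k x) 2
      volume ∧ ∫ x, (moll (stdKernel n) (mollTower m f k) x - mollTower m f k x) ^ 2 ≤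
      4 * (1 / ((n : ℝ) + 1)) ^ 2 * M := fun m => by
    have hV := (hf.wTower m).toL2Tower
    obtain ⟨h1, h2⟩ := stdKernel_moll_sub_sq_le (hV.hasDerivAt k) (hV.continuous (k + 1))
      (hV.memLp k) (hV.memLp (k + 1)) n
    exact ⟨h1, h2.trans (mul_le_mul_of_nonneg_left
      (hf.integral_mollTower_sq_le m (by lia)) (by positivity))⟩
  refine memLp_two_of_tendsto (by positivity) (fun m => (h m).1) (fun m => (h m).2) ?_
  have hl := hf.ae_tendsto_mollTower (k := k) (by lia)
  filter_upwards [hl] with x hx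
  refine Tendsto.sub ?_ hx
  rw [hf.mollTower_eq n (by lia)]
  exact (isKernel_stdKernel n).tendsto_moll
    (fun m => ((hf.wTower m).toL2Tower.continuous k).aestronglyMeasurable)
    (fun m => hf.abs_mollTower_le m hk) hl x

lemma Controlled.integral_mollTower_sub_mollTower_sq_le (hf : Controlled M f) {n m : ℕ}
    (hnm : n ≤ m) {k : ℕ} (hk : k ≤ 9) :
    ∫ x, (mollTower n f k x - mollTower m f k x) ^ 2 ≤ 16 * (1 / ((n : ℝ) + 1)) ^ 2 * M := by
  have hM := hf.nonneg
  obtain ⟨h1, h2⟩ := hf.integral_mollTower_sub_sq_le n hk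
  obtain ⟨h3, h4⟩ := hf.integral_mollTower_sub_sq_le m hk
  have h5 := integral_add_sq_le h1 h3.neg
  have h6 : (1 / ((m : ℝ) + 1)) ^ 2 ≤ (1 / ((n : ℝ) + 1)) ^ 2 := by
    have : (n : ℝ) ≤ m := by exact_mod_cast hnm
    gcongr
  have h7 := mul_le_mul_of_nonneg_right h6 hM
  have e1 : ∀ x, mollTower n f k x - jet f k x +
      (-fun x => mollTower m f k x - jet f k x) x = mollTower n f k x - mollTower m f k x :=
    fun x => by simp
  have e2 : ∫ x, (-fun x => mollTower m f k x - jet f k x) x ^ 2 =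
      ∫ x, (mollTower m f k x - jet f k x) ^ 2 := by
    congr 1; ext x; simp only [Pi.neg_apply, neg_sq]
  simp only [e1] at h5
  rw [e2] at h5
  linarith

end

/-! ### The error in the mollified equation. -/

/-- The error in the equation for the mollified solution. -/
def mollError (Q₀ Q₁ : MvPolynomial (Fin 3) ℝ) (n : ℕ) (f : ℝ → ℝ) (k : ℕ) (x : ℝ) : ℝ :=
  DiffPoly.eval (mollTower n f) (DiffPoly.D^[k] (nonlin Q₀ Q₁)) x -
    mollTower n (nonlinearity Q₀ Q₁ f) k x

lemma DiffPoly.tendsto_eval (P : DiffPoly) {G : ℕ → ℝ → ℝ} {F : ℕ → ℕ → ℝ → ℝ} {x : ℝ} {N : ℕ}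
    (hP : ∀ p ∈ P, ∀ i ∈ p.2, i ≤ N)
    (h : ∀ i ≤ N, Tendsto (fun n => F n i x) atTop (𝓝 (G i x))) :
    Tendsto (fun n => DiffPoly.eval (F n) P x) atTop (𝓝 (DiffPoly.eval G P x)) := by
  induction P with
  | nil => exact tendsto_const_nhds
  | cons p P ih =>
    simp only [List.mem_cons, forall_eq_or_imp] at hP
    simp only [DiffPoly.eval_cons]
    refine (Tendsto.const_mul _ ?_).add (ih hP.2)
    have : ∀ l : List ℕ, (∀ i ∈ l, i ≤ N) → Tendsto (fun n => monEval (F n) l x) atTop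
        (𝓝 (monEval G l x)) := by
      intro l
      induction l with
      | nil => intro _; exact tendsto_const_nhds
      | cons i l ih =>
        intro hl
        simp only [List.mem_cons, forall_eq_or_imp] at hl
        simp only [monEval_cons]
        exact (h i hl.1).mul (ih hl.2)
    exact this p.2 hP.1

lemma DiffPoly.abs_eval_le_lip_mul {V : ℕ → ℝ → ℝ} {C x d : ℝ} (hC : 1 ≤ C) {P : DiffPoly}
    (hP : ∀ p ∈ P, 1 ≤ p.2.length) (h : ∀ p ∈ P, ∀ i ∈ p.2, |V i x| ≤ C ∧ |V i x| ≤ d) :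
    |DiffPoly.eval V P x| ≤ P.lip C * d := by
  have h := DiffPoly.abs_eval_sub_le (V := V) (W := fun _ _ => (0 : ℝ)) (P := P) (x := x)
    (d := d) hC (fun p hp i hi => (h p hp i hi).1)
    (fun p hp i hi => by rw [abs_zero]; linarith)
    (fun p hp i hi => by rw [sub_zero]; exact (h p hp i hi).2)
  rwa [DiffPoly.eval_zero hP, sub_zero] at h

section

variable {Q₀ Q₁ : MvPolynomial (Fin 3) ℝ}

/-- The nonlinearity is the almost everywhere limit of the nonlinearities of the mollifications, for
which the bounds are uniform. -/
lemma Controlled.exists_nonlinearity_bound (hQ₀ : ∀ α ∈ Q₀.support, 1 ≤ α.degree)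
    (hQ₁ : ∀ α ∈ Q₁.support, 2 ≤ α.degree) (M : ℝ) : ∃ K : ℝ, 0 ≤ K ∧ ∀ f, Controlled M f →
      MemLp (nonlinearity Q₀ Q₁ f) 2 volume ∧ (∀ᵐ x, |nonlinearity Q₀ Q₁ f x| ≤ K) := by
  rcases lt_or_ge M 0 with hM | hM
  · exact ⟨0, le_rfl, fun f hf => absurd hf.nonneg (not_le.2 hM)⟩
  have hC : 1 ≤ 1 + 2 * M := by linarith
  have hP := fun (p : ℝ × List ℕ) (hp : p ∈ nonlin Q₀ Q₁) => of_mem_nonlin hQ₀ hQ₁ hp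
  refine ⟨_, DiffPoly.bound_nonneg (zero_le_one.trans hC) (nonlin Q₀ Q₁), fun f hf => ?_⟩
  have hlim : ∀ᵐ x, Tendsto (fun m => DiffPoly.eval (mollTower m f) (nonlin Q₀ Q₁) x) atTop
      (𝓝 (nonlinearity Q₀ Q₁ f x)) := by
    have := ae_all_iff.2 fun i : Fin 11 =>
      hf.ae_tendsto_mollTower (k := i) (Nat.lt_succ_iff.1 i.2)
    filter_upwards [this] with x hx
    rw [nonlinearity_eq_eval]
    exact DiffPoly.tendsto_eval _ (fun p hp => (hP p hp).2.2) fun i hi => hx ⟨i, by lia⟩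
  have hb : ∀ m x, |DiffPoly.eval (mollTower m f) (nonlin Q₀ Q₁) x| ≤
      (nonlin Q₀ Q₁).bound (1 + 2 * M) := fun m x =>
    DiffPoly.abs_eval_le_bound fun p hp i hi =>
      hf.abs_mollTower_le m (((hP p hp).2.2 i hi).trans (by lia)) x
  refine ⟨?_, hlim.mono fun x hx => le_of_tendsto hx.abs (Eventually.of_forall fun m => hb m x)⟩
  have h4 : ∀ m, ∫ x, DiffPoly.eval (mollTower m f) (nonlin Q₀ Q₁) x ^ 2 ≤
      (nonlin Q₀ Q₁).lip (1 + 2 * M) ^ 2 * ((4 : ℕ) * ((4 : ℕ) * M)) := fun m =>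
    integral_sq_le_of_abs_le ((hf.wTower m).toL2Tower.memLp_jetNorm 4) (fun x => by
      rw [abs_of_nonneg (jetNorm_nonneg _ _ _)]
      exact DiffPoly.abs_eval_le_lip_mul hC (fun p hp => le_trans (by lia) (hP p hp).1)
        fun p hp i hi => ⟨hf.abs_mollTower_le m (((hP p hp).2.2 i hi).trans (by lia)) x,
          abs_le_jetNorm _ (Nat.lt_succ_iff.2 ((hP p hp).2.2 i hi)) x⟩)
      ((hf.wTower m).toL2Tower.integral_jetNorm_sq_le fun i hi =>
        hf.integral_mollTower_sq_le m (by lia))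
  exact (memLp_two_of_tendsto (by positivity) (fun m => (hf.wTower m).toL2Tower.memLp_eval
    fun p hp => le_trans (by lia) (hP p hp).1) h4 hlim).1

/-- The error in the equation for the mollifications is small, up to its sixth derivative. -/
theorem Controlled.exists_mollError_bound (hQ₀ : ∀ α ∈ Q₀.support, 1 ≤ α.degree)
    (hQ₁ : ∀ α ∈ Q₁.support, 2 ≤ α.degree) (M : ℝ) : ∃ K : ℝ, 0 ≤ K ∧ ∀ f, Controlled M f →
      ∀ n, L2Tower (mollError Q₀ Q₁ n f) ∧
        ∀ k ≤ 6, ∫ x, mollError Q₀ Q₁ n f k x ^ 2 ≤ K * (1 / ((n : ℝ) + 1)) ^ 2 := by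
  rcases lt_or_ge M 0 with hM | hM
  · exact ⟨0, le_rfl, fun f hf => absurd hf.nonneg (not_le.2 hM)⟩
  have hC : 1 ≤ 1 + 2 * M := by linarith
  set P := nonlin Q₀ Q₁ with hPdef
  have hP : ∀ p ∈ P, 2 ≤ p.2.length ∧ excess p.2 ≤ 1 ∧ ∀ i ∈ p.2, i ≤ 3 := fun p hp =>
    of_mem_nonlin hQ₀ hQ₁ hp
  have hPk := DiffPoly.of_mem_iterate_D hP
  obtain ⟨K₀, -, hK₀⟩ := Controlled.exists_nonlinearity_bound hQ₀ hQ₁ M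
  -- The first term bounds the difference of the nonlinearities of two mollifications, which for `k
  -- ≤ 6` involves orders up to `9`. The second bounds the effect of mollifying the nonlinearity,
  -- where one more derivative is needed and the orders reach `10`. This is why six derivatives of
  -- the error are controlled.
  set B : ℕ → ℝ := fun k => 2 * ((DiffPoly.D^[k] P).lip (1 + 2 * M) ^ 2 *
    ((10 : ℕ) * ((10 : ℕ) * (16 * M)))) + 8 * ((DiffPoly.D^[k + 1] P).bound (1 + 2 * M) ^ 2 *
    ((11 : ℕ) * ((11 : ℕ) * M))) with hB
  have hB0 : ∀ k, 0 ≤ B k := fun k => by positivity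
  refine ⟨∑ k ∈ Finset.range 7, B k, Finset.sum_nonneg fun k _ => hB0 k, fun f hf n => ?_⟩
  set F : ℕ → ℕ → ℝ → ℝ := fun m k => DiffPoly.eval (mollTower m f) (DiffPoly.D^[k] P) with hF
  have tF : ∀ m, L2Tower (F m) := fun m =>
    (hf.wTower m).toL2Tower.eval_iterate fun p hp => le_trans (by lia) (hP p hp).1
  obtain ⟨hN, -⟩ := hK₀ f hf
  have hNl := hN.locallyIntegrable (by norm_num)
  have hκ := isKernel_stdKernel n
  refine ⟨(tF n).sub ⟨hκ.hasDerivAt_moll_iteratedDeriv hNl,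
    fun k => ((hκ.iteratedDeriv k).memLp_moll hN).1⟩, fun k hk => ?_⟩
  have hε : 0 ≤ (1 / ((n : ℝ) + 1)) ^ 2 := by positivity
  have hlim0 : ∀ᵐ x, Tendsto (fun m => F (m + n) 0 x) atTop (𝓝 (nonlinearity Q₀ Q₁ f x)) := by
    have := ae_all_iff.2 fun i : Fin 11 =>
      hf.ae_tendsto_mollTower (k := i) (Nat.lt_succ_iff.1 i.2)
    filter_upwards [this] with x hx
    rw [nonlinearity_eq_eval]
    exact (DiffPoly.tendsto_eval _ (fun p hp => (hP p hp).2.2) fun i hi =>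
      hx ⟨i, by lia⟩).comp (tendsto_add_atTop_nat n)
  have hlim : ∀ x, Tendsto (fun m => moll (stdKernel n) (F (m + n) k) x) atTop
      (𝓝 (mollTower n (nonlinearity Q₀ Q₁ f) k x)) := fun x => by
    have := (hκ.iteratedDeriv k).tendsto_moll (F := fun m => F (m + n) 0) (C := P.bound (1 + 2 * M))
      (fun m => ((tF (m + n)).continuous 0).aestronglyMeasurable) (fun m x =>
        DiffPoly.abs_eval_le_bound fun p hp i hi => hf.abs_mollTower_le (m + n)
          (((hP p hp).2.2 i hi).trans (by lia)) x) hlim0 x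
    simp only [(tF _).moll_iteratedDeriv hκ k] at this
    exact this
  -- The error is the limit as `m → ∞` of these expressions, in which everything is smooth and
  -- derivatives commute with the mollification. The shift by `n` ensures that the second index is
  -- the larger one.
  have hm : ∀ m, MemLp (fun x => F n k x - moll (stdKernel n) (F (m + n) k) x) 2 volume ∧
      ∫ x, (F n k x - moll (stdKernel n) (F (m + n) k) x) ^ 2 ≤
        B k * (1 / ((n : ℝ) + 1)) ^ 2 := fun m => by
    have hd := (hf.wTower n).toL2Tower.sub (hf.wTower (m + n)).toL2Tower
    obtain ⟨h1, h2⟩ := stdKernel_moll_sub_sq_le ((tF (m + n)).hasDerivAt k)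
      ((tF (m + n)).continuous (k + 1)) ((tF (m + n)).memLp k) ((tF (m + n)).memLp (k + 1)) n
    have h3 : MemLp (fun x => F n k x - F (m + n) k x) 2 volume :=
      ((tF n).memLp k).sub ((tF (m + n)).memLp k)
    have h4 : ∫ x, (F n k x - F (m + n) k x) ^ 2 ≤ (DiffPoly.D^[k] P).lip (1 + 2 * M) ^ 2 *
        ((10 : ℕ) * ((10 : ℕ) * (16 * (1 / ((n : ℝ) + 1)) ^ 2 * M))) :=
      integral_sq_le_of_abs_le (hd.memLp_jetNorm 10) (fun x => by
        rw [abs_of_nonneg (jetNorm_nonneg _ _ _)]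
        have hi9 : ∀ p ∈ DiffPoly.D^[k] P, ∀ i ∈ p.2, i ≤ 9 := fun p hp i hi =>
          ((hPk k p hp).2.2 i hi).trans (by lia)
        exact DiffPoly.abs_eval_sub_le hC
          (fun p hp i hi => hf.abs_mollTower_le n (hi9 p hp i hi) x)
          (fun p hp i hi => hf.abs_mollTower_le (m + n) (hi9 p hp i hi) x)
          (fun p hp i hi => abs_le_jetNorm (fun k x => mollTower n f k x - mollTower (m + n) f k x)
            (Nat.lt_succ_iff.2 (hi9 p hp i hi)) x))
        (hd.integral_jetNorm_sq_le fun i hi =>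
          hf.integral_mollTower_sub_mollTower_sq_le (by lia) (by lia))
    have h5 : ∫ x, F (m + n) (k + 1) x ^ 2 ≤ (DiffPoly.D^[k + 1] P).bound (1 + 2 * M) ^ 2 *
        ((11 : ℕ) * ((11 : ℕ) * M)) :=
      integral_sq_le_of_abs_le ((hf.wTower (m + n)).toL2Tower.memLp_jetNorm 11) (fun x => by
        rw [abs_of_nonneg (jetNorm_nonneg _ _ _)]
        refine DiffPoly.abs_eval_le_jetNorm hC (fun p hp => ?_)
          fun i hi => hf.abs_mollTower_le (m + n) hi x
        obtain ⟨q1, q2, q3⟩ := hPk (k + 1) p hp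
        exact ⟨q1, q2.trans (by lia), fun i hi => (q3 i hi).trans (by lia)⟩)
        ((hf.wTower (m + n)).toL2Tower.integral_jetNorm_sq_le fun i hi =>
          hf.integral_mollTower_sq_le (m + n) (by lia))
    have h6 := integral_add_sq_le h3 h1.neg
    have e1 : ∀ x, F n k x - F (m + n) k x +
        (-fun x => moll (stdKernel n) (F (m + n) k) x - F (m + n) k x) x =
        F n k x - moll (stdKernel n) (F (m + n) k) x := fun x => by simp
    have e2 : ∫ x, (-fun x => moll (stdKernel n) (F (m + n) k) x - F (m + n) k x) x ^ 2 =
        ∫ x, (moll (stdKernel n) (F (m + n) k) x - F (m + n) k x) ^ 2 := by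
      congr 1; ext x; simp only [Pi.neg_apply, neg_sq]
    simp only [e1] at h6
    rw [e2] at h6
    refine ⟨((tF n).memLp k).sub (hκ.memLp_moll ((tF (m + n)).memLp k)).1, h6.trans ?_⟩
    have h7 := h2.trans (mul_le_mul_of_nonneg_left h5 (by positivity))
    simp only [hB]
    linarith
  refine ((memLp_two_of_tendsto (mul_nonneg (hB0 k) hε) (fun m => (hm m).1) (fun m => (hm m).2)
    (f := mollError Q₀ Q₁ n f k)
    (Eventually.of_forall fun x => (hlim x).const_sub (F n k x))).2).trans ?_
  gcongr
  exact Finset.single_le_sum (fun k _ => hB0 k) (Finset.mem_range.2 (by lia))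

end

/-! ### Evolution of energies of mollified solutions. -/

/-- Gronwall's inequality. -/
lemma le_exp_mul_of_hasDerivAt_le {E E' : ℝ → ℝ} {T K L : ℝ} (hK : 0 ≤ K) (hL : 0 ≤ L)
    (hc : ContinuousOn E (Icc 0 T)) (hd : ∀ t ∈ Ioo 0 T, HasDerivAt E (E' t) t)
    (h : ∀ t ∈ Ioo 0 T, E' t ≤ K * E t + L) {t : ℝ} (ht : t ∈ Icc 0 T) :
    E t ≤ Real.exp (K * t) * (E 0 + L * t) := by
  set G : ℝ → ℝ := fun t => Real.exp (-(K * t)) * E t with hG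
  have hdG : ∀ t ∈ Ioo 0 T, HasDerivAt G (Real.exp (-(K * t)) * (E' t - K * E t)) t :=
    fun t ht => ((((hasDerivAt_id t).const_mul K).fun_neg.exp).fun_mul (hd t ht)).congr_deriv
      (by simp only [id_eq]; ring)
  have hcG : ContinuousOn G (Icc 0 T) :=
    ContinuousOn.mul (by fun_prop) hc
  have h1 := (convex_Icc 0 T).image_sub_le_mul_sub_of_deriv_le hcG
    (by
      rw [interior_Icc]
      exact fun t ht => (hdG t ht).differentiableAt.differentiableWithinAt)
    (C := L) (by
      rw [interior_Icc]
      intro t ht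
      rw [(hdG t ht).deriv]
      have e1 : Real.exp (-(K * t)) ≤ 1 := by
        rw [Real.exp_le_one_iff]
        have := mul_nonneg hK ht.1.le
        linarith
      have e2 := Real.exp_pos (-(K * t))
      have e3 := h t ht
      nlinarith)
    0 (left_mem_Icc.2 (ht.1.trans ht.2)) t ht ht.1
  simp only [hG, mul_zero, neg_zero, Real.exp_zero, one_mul, sub_zero] at h1
  have e : E t = Real.exp (K * t) * (Real.exp (-(K * t)) * E t) := by
    rw [← mul_assoc, ← Real.exp_add]; simp
  rw [e]
  exact mul_le_mul_of_nonneg_left (by linarith) (Real.exp_pos _).le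

/-- Differentiation of a weighted energy. -/
lemma hasDerivAt_energy {f f' W W' : ℝ → ℝ → ℝ} {T A : ℝ}
    (df : ∀ t ∈ Icc 0 T, ∀ x, HasDerivWithinAt (fun s => f s x) (f' t x) (Icc 0 T) t)
    (dW : ∀ t ∈ Icc 0 T, ∀ x, HasDerivWithinAt (fun s => W s x) (W' t x) (Icc 0 T) t)
    (cf : ∀ t ∈ Icc 0 T, Continuous (f t)) (cf' : ∀ t ∈ Icc 0 T, Continuous (f' t))
    (cW : ∀ t ∈ Icc 0 T, Continuous (W t)) (cW' : ∀ t ∈ Icc 0 T, Continuous (W' t))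
    (bf : ∀ t ∈ Icc 0 T, ∀ x, bracket x ^ 2 * |f t x| ≤ A)
    (bf' : ∀ t ∈ Icc 0 T, ∀ x, |f' t x| ≤ A)
    (bW : ∀ t ∈ Icc 0 T, ∀ x, |W t x| ≤ A) (bW' : ∀ t ∈ Icc 0 T, ∀ x, |W' t x| ≤ A) :
    ContinuousOn (fun t => ∫ x, W t x * f t x ^ 2) (Icc 0 T) ∧ ∀ t ∈ Ioo 0 T,
      HasDerivAt (fun t => ∫ x, W t x * f t x ^ 2)
        (∫ x, (W' t x * f t x ^ 2 + 2 * (W t x * f t x * f' t x))) t := by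
  have hb : ∀ x, 0 < bracket x ^ 2 := fun x => pow_pos (bracket_pos x) 2
  have hb1 : ∀ x, 1 ≤ bracket x ^ 2 := fun x => one_le_pow₀ (one_le_bracket x)
  -- One factor `f` with its decay `⟨x⟩^{-2}` provides the integrable majorant; all other factors
  -- are just bounded.
  have bf1 : ∀ t ∈ Icc 0 T, ∀ x, |f t x| ≤ A * (1 + x ^ 2)⁻¹ := fun t ht x => by
    rw [← bracket_sq, ← div_eq_mul_inv, le_div_iff₀ (hb x), mul_comm]
    exact bf t ht x
  have bf2 : ∀ t ∈ Icc 0 T, ∀ x, |f t x| ≤ A := fun t ht x =>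
    (le_mul_of_one_le_left (abs_nonneg _) (hb1 x)).trans (bf t ht x)
  have hint : ∀ c : ℝ, Integrable (fun x : ℝ => c * (1 + x ^ 2)⁻¹) := fun c =>
    integrable_inv_one_add_sq.const_mul c
  have hi : ∀ x : ℝ, 0 ≤ (1 + x ^ 2)⁻¹ := fun x => by positivity
  have b1 : ∀ t ∈ Icc 0 T, ∀ x, ‖W t x * f t x ^ 2‖ ≤ A ^ 3 * (1 + x ^ 2)⁻¹ := fun t ht x => by
    have hA : 0 ≤ A := (abs_nonneg _).trans (bf2 t ht x)
    rw [Real.norm_eq_abs, abs_mul, pow_two, abs_mul]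
    calc |W t x| * (|f t x| * |f t x|) ≤ A * (A * (A * (1 + x ^ 2)⁻¹)) := by
          have := bW t ht x
          have := bf1 t ht x
          have := bf2 t ht x
          gcongr
      _ = _ := by ring
  have b2 : ∀ t ∈ Icc 0 T, ∀ x, ‖W' t x * f t x ^ 2 + 2 * (W t x * f t x * f' t x)‖ ≤
      3 * A ^ 3 * (1 + x ^ 2)⁻¹ := fun t ht x => by
    have hA : 0 ≤ A := (abs_nonneg _).trans (bf2 t ht x)
    have h1 := bW t ht x
    have h2 := bf1 t ht x
    have h3 := bf2 t ht x
    have h4 := bW' t ht x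
    have h5 := bf' t ht x
    rw [Real.norm_eq_abs]
    refine (abs_add_le _ _).trans ?_
    simp only [abs_mul, pow_two, abs_two]
    calc |W' t x| * (|f t x| * |f t x|) + 2 * (|W t x| * |f t x| * |f' t x|)
        ≤ A * (A * (A * (1 + x * x)⁻¹)) + 2 * (A * (A * (1 + x * x)⁻¹) * A) := by
          rw [pow_two] at h2
          have h6 : 0 ≤ A * (A * (1 + x * x)⁻¹) := by
            have := hi x
            rw [pow_two] at this
            exact mul_nonneg hA (mul_nonneg hA this)
          gcongr
      _ = _ := by ring
  refine ⟨fun t ht => ?_, fun t ht => ?_⟩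
  · refine continuousWithinAt_of_dominated (bound := fun x => A ^ 3 * (1 + x ^ 2)⁻¹) ?_ ?_ (hint _) ?_
    · filter_upwards [self_mem_nhdsWithin] with s hs
      exact ((cW s hs).mul ((cf s hs).pow 2)).aestronglyMeasurable
    · filter_upwards [self_mem_nhdsWithin] with s hs
      exact Eventually.of_forall (b1 s hs)
    · exact Eventually.of_forall fun x =>
        (dW t ht x).continuousWithinAt.mul ((df t ht x).continuousWithinAt.pow 2)
  · have hn : Icc 0 T ∈ 𝓝 t := Icc_mem_nhds ht.1 ht.2
    have hn' : Ioo 0 T ∈ 𝓝 t := Ioo_mem_nhds ht.1 ht.2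
    have ht' := Ioo_subset_Icc_self ht
    refine (hasDerivAt_integral_of_dominated_loc_of_deriv_le (F := fun t x => W t x * f t x ^ 2)
      (F' := fun t x => W' t x * f t x ^ 2 + 2 * (W t x * f t x * f' t x))
      (bound := fun x => 3 * A ^ 3 * (1 + x ^ 2)⁻¹) hn' ?_ ?_ ?_ ?_ (hint _) ?_).2
    · filter_upwards [hn] with s hs
      exact ((cW s hs).mul ((cf s hs).pow 2)).aestronglyMeasurable
    · exact (hint (A ^ 3)).mono' ((cW t ht').mul ((cf t ht').pow 2)).aestronglyMeasurable
        (Eventually.of_forall (b1 t ht'))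
    · exact (((cW' t ht').mul ((cf t ht').pow 2)).add (continuous_const.mul
        (((cW t ht').mul (cf t ht')).mul (cf' t ht')))).aestronglyMeasurable
    · exact Eventually.of_forall fun x s hs => b2 s (Ioo_subset_Icc_self hs) x
    · refine Eventually.of_forall fun x s hs => ?_
      have hs' : Icc 0 T ∈ 𝓝 s := Icc_mem_nhds hs.1 hs.2
      have d1 := (df s (Ioo_subset_Icc_self hs) x).hasDerivAt hs'
      have d2 := (dW s (Ioo_subset_Icc_self hs) x).hasDerivAt hs'
      exact (d2.fun_mul (d1.fun_pow 2)).congr_deriv (by norm_num; ring)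

section

variable {Q₀ Q₁ : MvPolynomial (Fin 3) ℝ} {T M : ℝ} {u : ℝ → ℝ → ℝ}

/-- The equation for the mollifications of a solution. -/
lemma IsSolution.hasDerivWithinAt_mollTower (hQ₀ : ∀ α ∈ Q₀.support, 1 ≤ α.degree)
    (hQ₁ : ∀ α ∈ Q₁.support, 2 ≤ α.degree) (hu : IsSolution Q₀ Q₁ T u)
    (hM : ∀ t ∈ Icc 0 T, Controlled M (u t)) (n k : ℕ) {t : ℝ} (ht : t ∈ Icc 0 T) (x : ℝ) :
    HasDerivWithinAt (fun s => mollTower n (u s) k x)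
      (mollTower n (u t) (k + 5) x - mollTower n (nonlinearity Q₀ Q₁ (u t)) k x) (Icc 0 T) t := by
  have hκ := (isKernel_stdKernel n).iteratedDeriv k
  -- For fixed `x` the mollification at `x` is a pairing with a test function, so the distributional
  -- equation gives a genuine derivative in time.
  have h := hu.2 _ (hκ.isTest x) t ht
  have e1 : (fun s => ∫ y, u s y * iteratedDeriv k (stdKernel n) (x - y)) =
      fun s => mollTower n (u s) k x := by
    ext s; rw [mollTower, moll]; congr 1; ext y; ring
  rw [e1] at h
  refine h.congr_deriv ?_
  obtain ⟨K, -, hK⟩ := Controlled.exists_nonlinearity_bound hQ₀ hQ₁ M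
  have e2 : mollTower n (u t) (k + 5) = moll (iteratedDeriv k (stdKernel n)) (jet (u t) 5) := by
    rw [← hκ.moll_iteratedDeriv ((hM t ht).isWeakDeriv 5 (by lia)), mollTower]
    simp only [iteratedDeriv_eq_iterate, ← Function.iterate_add_apply, add_comm]
  rw [e2, mollTower, moll, moll, ← integral_sub
    (integrable_mul_of_memLp (hκ.memLp_sub x) ((hM t ht).memLp 5 (by lia)))
    (integrable_mul_of_memLp (hκ.memLp_sub x) (hK _ (hM t ht)).1)]
  congr 1; ext y
  change (weakDeriv 5 (u t) y - _) * _ = _ * weakDeriv 5 (u t) y - _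
  ring

lemma mollTower_sub_eq (n : ℕ) (f : ℝ → ℝ) (k : ℕ) (x : ℝ) :
    mollTower n f (k + 5) x - mollTower n (nonlinearity Q₀ Q₁ f) k x =
      mollTower n f (k + 5) x - DiffPoly.eval (mollTower n f) (DiffPoly.D^[k] (nonlin Q₀ Q₁)) x +
        mollError Q₀ Q₁ n f k x := by
  rw [mollError]; ring

/-- Uniform bounds for the mollifications. -/
lemma Controlled.exists_mollTower_bound (hQ₀ : ∀ α ∈ Q₀.support, 1 ≤ α.degree)
    (hQ₁ : ∀ α ∈ Q₁.support, 2 ≤ α.degree) (M : ℝ) (n k : ℕ) : ∃ A : ℝ, 0 ≤ A ∧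
      ∀ f, Controlled M f → (∀ x, bracket x ^ 2 * |mollTower n f k x| ≤ A) ∧
        Continuous (fun x => mollTower n f (k + 5) x - mollTower n (nonlinearity Q₀ Q₁ f) k x) ∧
        ∀ x, |mollTower n f (k + 5) x - mollTower n (nonlinearity Q₀ Q₁ f) k x| ≤ A := by
  obtain ⟨K, hK0, hK⟩ := Controlled.exists_nonlinearity_bound hQ₀ hQ₁ M
  rcases lt_or_ge M 0 with hM | hM
  · exact ⟨0, le_rfl, fun f hf => absurd hf.nonneg (not_le.2 hM)⟩
  have hκ := fun k => (isKernel_stdKernel n).iteratedDeriv k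
  set c : ℕ → ℝ := fun k => 9 * (∫ z, iteratedDeriv k (stdKernel n) z ^ 2) + M with hc
  have hc0 : ∀ k, 0 ≤ c k := fun k => by
    have : 0 ≤ ∫ z, iteratedDeriv k (stdKernel n) z ^ 2 := integral_nonneg fun _ => sq_nonneg _
    positivity
  have hk0 : 0 ≤ ∫ z, |iteratedDeriv k (stdKernel n) z| := integral_nonneg fun _ => abs_nonneg _
  have hKk := mul_nonneg hK0 hk0
  have hV : ∀ f, Controlled M f → ∀ k x, bracket x ^ 2 * |mollTower n f k x| ≤ c k :=
    fun f hf k x => ((hκ k).bracket_sq_mul_abs_moll_le_const hf.memLp_weight x).trans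
      (by have := hf.weight_le; simp only [hc]; linarith)
  refine ⟨c k + c (k + 5) + K * ∫ z, |iteratedDeriv k (stdKernel n) z|,
    by have := hc0 k; have := hc0 (k + 5); positivity, fun f hf => ⟨fun x => ?_, ?_, fun x => ?_⟩⟩
  · have := hV f hf k x
    have := hc0 (k + 5)
    linarith
  · exact ((hκ (k + 5)).continuous_moll hf.locallyIntegrable).sub
      ((hκ k).continuous_moll ((hK f hf).1.locallyIntegrable (by norm_num)))
  · have h1 := (hκ k).abs_moll_le_of_ae_abs_le (hK f hf).2 x
    have h2 : |mollTower n f (k + 5) x| ≤ c (k + 5) :=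
      (le_mul_of_one_le_left (abs_nonneg _) (one_le_pow₀ (one_le_bracket x))).trans
        (hV f hf (k + 5) x)
    have := hc0 k
    refine (abs_sub _ _).trans ?_
    change |mollTower n (nonlinearity Q₀ Q₁ f) k x| ≤ _ at h1
    linarith

end

/-- Convergence of weighted energies. -/
lemma tendsto_integral_mul_sq {κ f : ℝ → ℝ} (hκ : BddCont κ) (hf : MemLp f 2 volume)
    {F : ℕ → ℝ → ℝ} (hF : ∀ n, MemLp (F n) 2 volume) {K : ℝ}
    (h : ∀ n, ∫ x, (F n x - f x) ^ 2 ≤ K * (1 / ((n : ℝ) + 1)) ^ 2) :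
    Tendsto (fun n => ∫ x, κ x * F n x ^ 2) atTop (𝓝 (∫ x, κ x * f x ^ 2)) := by
  obtain ⟨C, hC⟩ := hκ.2
  have hC0 : 0 ≤ C := (abs_nonneg _).trans (hC 0)
  rw [tendsto_iff_norm_sub_tendsto_zero]
  have hlim : Tendsto (fun n : ℕ => C * ((K * (1 / ((n : ℝ) + 1)) + K + ∫ x, f x ^ 2) *
      (1 / ((n : ℝ) + 1)))) atTop (𝓝 0) := by
    have h0 := tendsto_one_div_add_atTop_nhds_zero_nat (𝕜 := ℝ)
    have := ((((h0.const_mul K).add_const K).add_const (∫ x, f x ^ 2)).mul h0).const_mul C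
    simpa using this
  refine squeeze_zero (fun _ => norm_nonneg _) (fun n => ?_) hlim
  set ε : ℝ := 1 / ((n : ℝ) + 1) with hε
  have hε0 : 0 < ε := by positivity
  have i1 := hκ.integrable_mul_sq (hF n)
  have i2 := hκ.integrable_mul_sq hf
  have i3 : Integrable (fun x => (F n x - f x) ^ 2) := ((hF n).sub hf).integrable_sq
  rw [← integral_sub i1 i2, Real.norm_eq_abs]
  -- Young's inequality for `F² - f² = (F - f)² + 2 f (F - f)`. As the squared error is `O(ε²)`, the
  -- factor `1/ε` is affordable.
  calc _ ≤ ∫ x, C * ((1 + ε⁻¹) * (F n x - f x) ^ 2 + ε * f x ^ 2) := by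
        refine abs_integral_le_integral_abs.trans (integral_mono (i1.sub i2).abs
          (((i3.const_mul _).add (hf.integrable_sq.const_mul _)).const_mul C) fun x => ?_)
        change |κ x * F n x ^ 2 - κ x * f x ^ 2| ≤ _
        rw [← mul_sub, abs_mul]
        refine mul_le_mul (hC x) ?_ (abs_nonneg _) hC0
        have e1 : 0 ≤ ε * (f x - ε⁻¹ * (F n x - f x)) ^ 2 := by positivity
        have e2 : 0 ≤ ε * (f x + ε⁻¹ * (F n x - f x)) ^ 2 := by positivity
        have e3 : ε * (f x - ε⁻¹ * (F n x - f x)) ^ 2 = ε * f x ^ 2 - 2 * (f x * (F n x - f x)) +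
          ε⁻¹ * (F n x - f x) ^ 2 := by field_simp; ring
        have e4 : ε * (f x + ε⁻¹ * (F n x - f x)) ^ 2 = ε * f x ^ 2 + 2 * (f x * (F n x - f x)) +
          ε⁻¹ * (F n x - f x) ^ 2 := by field_simp; ring
        change |F n x ^ 2 - f x ^ 2| ≤ (1 + ε⁻¹) * (F n x - f x) ^ 2 + ε * f x ^ 2
        rw [abs_le]
        constructor
        · nlinarith [sq_nonneg (F n x - f x)]
        · nlinarith [sq_nonneg (F n x - f x)]
    _ = C * ((1 + ε⁻¹) * (∫ x, (F n x - f x) ^ 2) + ε * ∫ x, f x ^ 2) := by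
        rw [integral_const_mul, integral_add (i3.const_mul _) (hf.integrable_sq.const_mul _),
          integral_const_mul, integral_const_mul]
    _ ≤ C * ((1 + ε⁻¹) * (K * ε ^ 2) + ε * ∫ x, f x ^ 2) := by
        have := h n
        gcongr
    _ = _ := by field_simp

/-! ### Weak derivatives and continuity in time. -/

section

variable {k : ℕ} {f g f' g' : ℝ → ℝ}

lemma IsWeakDeriv.ae_eq (h : IsWeakDeriv k f g) (h' : IsWeakDeriv k f g') :
    g =ᵐ[volume] g' := by
  refine ae_eq_of_integral_contDiff_smul_eq h.2.1 h'.2.1 fun ψ h1 h2 => ?_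
  have e := (h.2.2 ψ ⟨h1, h2⟩).symm.trans (h'.2.2 ψ ⟨h1, h2⟩)
  have e' := mul_left_cancel₀ (by positivity : ((-1 : ℝ) ^ k) ≠ 0) e
  simpa only [smul_eq_mul, mul_comm] using e'

lemma IsTest.iteratedDeriv {ψ : ℝ → ℝ} (h : IsTest ψ) (k : ℕ) :
    Continuous (iteratedDeriv k ψ) ∧ HasCompactSupport (iteratedDeriv k ψ) := by
  refine ⟨by rw [iteratedDeriv_eq_iterate]; exact (h.1.iterate_deriv k).continuous, ?_⟩
  induction k with
  | zero => rw [iteratedDeriv_zero]; exact h.2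
  | succ k ih => rw [iteratedDeriv_succ]; exact ih.deriv

lemma integrable_mul_test {ψ : ℝ → ℝ} (hf : LocallyIntegrable f volume) (hc : Continuous ψ)
    (hs : HasCompactSupport ψ) : Integrable (fun x => f x * ψ x) := by
  simpa only [smul_eq_mul, mul_comm] using
    hf.integrable_smul_left_of_hasCompactSupport hc hs

lemma IsWeakDeriv.sub (h : IsWeakDeriv k f g) (h' : IsWeakDeriv k f' g') :
    IsWeakDeriv k (fun x => f x - f' x) (fun x => g x - g' x) := by
  refine ⟨h.1.sub h'.1, h.2.1.sub h'.2.1, fun ψ hψ => ?_⟩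
  obtain ⟨c1, c2⟩ := hψ.iteratedDeriv k
  simp only [sub_mul]
  rw [integral_sub (integrable_mul_test h.1 c1 c2) (integrable_mul_test h'.1 c1 c2),
    integral_sub (integrable_mul_test h.2.1 hψ.1.continuous hψ.2)
      (integrable_mul_test h'.2.1 hψ.1.continuous hψ.2), h.2.2 ψ hψ, h'.2.2 ψ hψ]
  ring

lemma IsWeakDeriv.weakDeriv (h : IsWeakDeriv k f g) : IsWeakDeriv k f (weakDeriv k f) := by
  have he : ∃ g, IsWeakDeriv k f g := ⟨g, h⟩
  rw [FifthOrder.weakDeriv, dif_pos he]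
  exact he.choose_spec

lemma isWeakDeriv_zero (hf : LocallyIntegrable f volume) : IsWeakDeriv 0 f f :=
  ⟨hf, hf, fun ψ _ => by simp⟩

lemma weakDeriv_ae_eq_jet (hf : LocallyIntegrable f volume) (k : ℕ) :
    weakDeriv k f =ᵐ[volume] jet f k := by
  cases k with
  | zero => exact (isWeakDeriv_zero hf).weakDeriv.ae_eq (isWeakDeriv_zero hf)
  | succ k => exact EventuallyEq.rfl

lemma MemH.isWeakDeriv_jet {n : ℕ} (hf : MemH n f) (hk : k ≤ n) :
    IsWeakDeriv k f (jet f k) ∧ MemLp (jet f k) 2 volume := by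
  obtain ⟨g, hg, hg2⟩ := hf k hk
  have h : IsWeakDeriv k f (jet f k) := by
    cases k with
    | zero => exact isWeakDeriv_zero hg.1
    | succ k => exact hg.weakDeriv
  exact ⟨h, hg2.ae_eq (hg.ae_eq h)⟩

lemma eLpNorm_weakDeriv_le_hNorm {n : ℕ} (hk : k ≤ n) (f : ℝ → ℝ) :
    eLpNorm (weakDeriv k f) 2 volume ≤ hNorm n f := by
  have h1 : eLpNorm (weakDeriv k f) 2 volume =
      (eLpNorm (weakDeriv k f) 2 volume ^ 2) ^ (1 / 2 : ℝ) := by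
    rw [← ENNReal.rpow_natCast, ← ENNReal.rpow_mul]; norm_num
  rw [h1, hNorm]
  refine ENNReal.rpow_le_rpow ?_ (by norm_num)
  exact Finset.single_le_sum (f := fun j => eLpNorm (weakDeriv j f) 2 volume ^ 2)
    (fun _ _ => zero_le) (Finset.mem_range.2 (Nat.lt_succ_of_le hk))

lemma integral_sq_eq {g : ℝ → ℝ} (hg : MemLp g 2 volume) :
    ∫ x, g x ^ 2 = (eLpNorm g 2 volume).toReal ^ 2 := by
  rw [← ENNReal.toReal_pow, eLpNorm_two_sq, lintegral_enorm_sq hg,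
    ENNReal.toReal_ofReal (integral_nonneg fun _ => sq_nonneg _)]

lemma integral_sq_le_of_eLpNorm_le {g : ℝ → ℝ} (hg : MemLp g 2 volume) {B : ℝ≥0}
    (h : eLpNorm g 2 volume ≤ B) : ∫ x, g x ^ 2 ≤ (B : ℝ) ^ 2 := by
  rw [integral_sq_eq hg]
  exact pow_le_pow_left₀ ENNReal.toReal_nonneg
    (ENNReal.toReal_le_of_le_ofReal B.2 (by simpa using h)) 2

end

/-- The square of the `L²` norm is continuous. -/
lemma continuousOn_integral_sq {g : ℝ → ℝ → ℝ} {S : Set ℝ}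
    (hg : ∀ t ∈ S, MemLp (g t) 2 volume)
    (h : ∀ t ∈ S, Tendsto (fun s => eLpNorm (fun x => g s x - g t x) 2 volume) (𝓝[S] t) (𝓝 0)) :
    ContinuousOn (fun t => ∫ x, g t x ^ 2) S := by
  have h1 : ContinuousOn (fun t => (eLpNorm (g t) 2 volume).toReal) S := by
    intro t ht
    rw [ContinuousWithinAt, tendsto_iff_norm_sub_tendsto_zero]
    have h2 := (ENNReal.tendsto_toReal ENNReal.zero_ne_top).comp (h t ht)
    refine squeeze_zero' (Eventually.of_forall fun _ => norm_nonneg _) ?_ h2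
    filter_upwards [self_mem_nhdsWithin] with s hs
    have h3 := abs_norm_sub_norm_le ((hg s hs).toLp (g s)) ((hg t ht).toLp (g t))
    rw [← MemLp.toLp_sub, Lp.norm_toLp, Lp.norm_toLp, Lp.norm_toLp] at h3
    exact h3
  refine (h1.pow 2).congr fun t ht => ?_
  exact integral_sq_eq (hg t ht)

section

variable {Q₀ Q₁ : MvPolynomial (Fin 3) ℝ} {T : ℝ} {u : ℝ → ℝ → ℝ}

/-- The norm of a difference involves the chosen weak derivative of the difference; by uniqueness it
agrees almost everywhere with the difference of the chosen weak derivatives. -/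
lemma InClass.continuousOn_jet (hu : InClass T u) {k : ℕ} (hk : k ≤ 10) :
    ContinuousOn (fun t => ∫ x, jet (u t) k x ^ 2) (Icc 0 T) := by
  have hJ := fun t ht => (hu.1 t ht).1.isWeakDeriv_jet hk
  refine continuousOn_integral_sq (fun t ht => (hJ t ht).2) fun t ht => ?_
  refine tendsto_of_tendsto_of_tendsto_of_le_of_le' tendsto_const_nhds (hu.2 t ht)
    (Eventually.of_forall fun _ => zero_le) ?_
  filter_upwards [self_mem_nhdsWithin] with s hs
  have h1 := (hJ s hs).1.sub (hJ t ht).1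
  rw [eLpNorm_congr_ae (h1.ae_eq h1.weakDeriv)]
  exact (eLpNorm_weakDeriv_le_hNorm hk _).trans le_self_add

lemma InClass.continuousOn_weight (hu : InClass T u) :
    ContinuousOn (fun t => ∫ x, (bracket x ^ 2 * u t x) ^ 2) (Icc 0 T) := by
  refine continuousOn_integral_sq (g := fun t x => bracket x ^ 2 * u t x)
    (fun t ht => (hu.1 t ht).2) fun t ht => ?_
  refine tendsto_of_tendsto_of_tendsto_of_le_of_le tendsto_const_nhds (hu.2 t ht)
    (fun _ => zero_le) fun s => ?_
  simp only [← mul_sub]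
  exact le_add_self

/-- The bound `M` depends on the individual solution. It serves only to justify the mollification
and to make its errors tend to zero, so it does not enter the final constants. -/
lemma InClass.exists_controlled (hu : InClass T u) :
    ∃ M, ∀ t ∈ Icc 0 T, Controlled M (u t) := by
  have hb : ∀ g : ℝ → ℝ, ContinuousOn g (Icc 0 T) → ∃ C, ∀ t ∈ Icc 0 T, g t ≤ C := fun g hg => by
    obtain ⟨C, hC⟩ := isCompact_Icc.bddAbove_image hg
    exact ⟨C, fun t ht => hC (mem_image_of_mem g ht)⟩
  choose! C hC using fun (k : ℕ) (hk : k ≤ 10) => hb _ (hu.continuousOn_jet hk)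
  obtain ⟨D, hD⟩ := hb _ hu.continuousOn_weight
  refine ⟨D + ∑ k ∈ Finset.range 11, |C k|, fun t ht => ?_⟩
  have hD0 : 0 ≤ D := (integral_nonneg fun _ => sq_nonneg _).trans (hD t ht)
  have h0 : 0 ≤ ∑ k ∈ Finset.range 11, |C k| := Finset.sum_nonneg fun _ _ => abs_nonneg _
  refine ⟨fun k hk => ((hu.1 t ht).1.isWeakDeriv_jet hk).1,
    fun k hk => ((hu.1 t ht).1.isWeakDeriv_jet hk).2, fun k hk => ?_, (hu.1 t ht).2,
    (hD t ht).trans (by linarith)⟩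
  have h1 := Finset.single_le_sum (f := fun k => |C k|) (fun _ _ => abs_nonneg _)
    (Finset.mem_range.2 (Nat.lt_succ_of_le hk))
  have h2 := hC k hk t ht
  have h3 := le_abs_self (C k)
  linarith

lemma IsSolution.mono {T' : ℝ} (h : T' ≤ T) (hu : IsSolution Q₀ Q₁ T u) :
    IsSolution Q₀ Q₁ T' u := by
  have hs : Icc 0 T' ⊆ Icc 0 T := Icc_subset_Icc_right h
  exact ⟨⟨fun t ht => hu.1.1 t (hs ht), fun t ht =>
    (hu.1.2 t (hs ht)).mono_left (nhdsWithin_mono t hs)⟩,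
    fun ψ hψ t ht => (hu.2 ψ hψ t (hs ht)).mono hs⟩

/-- The bounds contained in the size of a pair of functions. -/
lemma MemX.integral_le {f : ℝ → ℝ} (hf : MemX f) {B : ℝ≥0}
    (h : hNorm 10 f + eLpNorm (fun x => x ^ 2 * f x) 2 volume ≤ B) :
    ∫ x, (bracket x ^ 2 * f x) ^ 2 ≤ 4 * (B : ℝ) ^ 2 ∧ ∫ x, jet f 8 x ^ 2 ≤ 4 * (B : ℝ) ^ 2 := by
  have hB : 0 ≤ (B : ℝ) ^ 2 := sq_nonneg _
  have hj : ∀ k ≤ 10, ∫ x, jet f k x ^ 2 ≤ (B : ℝ) ^ 2 := fun k hk => by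
    refine integral_sq_le_of_eLpNorm_le (hf.1.isWeakDeriv_jet hk).2 ?_
    rw [← eLpNorm_congr_ae (weakDeriv_ae_eq_jet (hf.1.isWeakDeriv_jet hk).1.1 k)]
    exact (eLpNorm_weakDeriv_le_hNorm hk f).trans (le_self_add.trans h)
  have hf0 : MemLp f 2 volume := (hf.1.isWeakDeriv_jet (k := 0) (by lia)).2
  have e : ∀ x, bracket x ^ 2 * f x = f x + x ^ 2 * f x := fun x => by rw [bracket_sq]; ring
  have hx : MemLp (fun x => x ^ 2 * f x) 2 volume := by
    have := hf.2.sub hf0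
    refine this.congr_norm ?_ ?_
    · exact ((continuous_pow 2).aestronglyMeasurable).mul hf0.1
    · refine Eventually.of_forall fun x => ?_
      simp only [Pi.sub_apply, e, add_sub_cancel_left]
  have h1 := integral_sq_le_of_eLpNorm_le hx (le_add_self.trans h)
  have h2 := integral_add_sq_le hf0 hx
  have h3 := hj 0 (by lia)
  simp only [jet] at h3
  refine ⟨?_, (hj 8 (by lia)).trans (by linarith)⟩
  simp only [e]
  linarith

end

/-! ### Growth of the norms and the local existence time. -/

lemma abs_integral_mul_mul_le_of_small {κ f g : ℝ → ℝ} (hκ : BddCont κ)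
    (hf : MemLp f 2 volume) (hg : MemLp g 2 volume) {C A K ε : ℝ} (hε : 0 < ε)
    (h : ∀ x, |κ x| ≤ C) (hA : ∫ x, f x ^ 2 ≤ A) (hK : ∫ x, g x ^ 2 ≤ K * ε ^ 2) :
    |∫ x, κ x * f x * g x| ≤ C * (A + K) * ε := by
  have hC : 0 ≤ C := (abs_nonneg _).trans (h 0)
  have h1 := abs_integral_mul_mul_le hκ hf (hg.const_mul ε⁻¹) h
  have e1 : ∫ x, κ x * f x * (ε⁻¹ * g x) = ε⁻¹ * ∫ x, κ x * f x * g x := by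
    rw [← integral_const_mul]; congr 1; ext x; ring
  have e2 : ∫ x, (ε⁻¹ * g x) ^ 2 ≤ K := by
    have : ∫ x, (ε⁻¹ * g x) ^ 2 = (ε ^ 2)⁻¹ * ∫ x, g x ^ 2 := by
      rw [← integral_const_mul]; congr 1; ext x; ring
    rw [this, inv_mul_le_iff₀ (by positivity)]
    linarith
  rw [e1, abs_mul, abs_of_pos (inv_pos.2 hε), inv_mul_le_iff₀ hε] at h1
  have h2 := mul_le_mul_of_nonneg_left (add_le_add hA e2) hC
  have h3 := mul_le_mul_of_nonneg_left h2 hε.le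
  linarith

/-- The contribution of a small error to the energy estimate of order eight. -/
lemma SmoothingWeight.abs_integral_error_le_of_small {B c : ℝ} {φ : ℕ → ℝ → ℝ}
    (hφ : SmoothingWeight B c φ) {V r : ℕ → ℝ → ℝ} (hV : L2Tower V) (hr : L2Tower r)
    {A K ε : ℝ} (hε : 0 < ε) (hA : ∀ k ≤ 10, ∫ x, V k x ^ 2 ≤ A)
    (h : ∫ x, r 6 x ^ 2 ≤ K * ε ^ 2) :
    |∫ x, φ 0 x * V 8 x * r 8 x| ≤ 4 * (B * (A + K) * ε) := by
  have hb := hφ.tower.bddCont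
  -- The error is small only up to order six. Two of its eight derivatives are moved onto `φ V 8`,
  -- which is possible because `V 10` is still bounded in `L²`; four integrals result.
  have e : ∀ i ≤ 4, ∀ j l, (∫ x, φ (i + 1) x * V j x * r l x) +
      (∫ x, φ i x * V (j + 1) x * r l x) + (∫ x, φ i x * V j x * r (l + 1) x) = 0 :=
    fun i hi j l => integral_deriv_mul_mul (hφ.tower.hasDerivAt i (by lia)) (hV.hasDerivAt j)
      (hr.hasDerivAt l) (hb i (by lia)) (hb (i + 1) (by lia)) (hV.memLp j) (hV.memLp (j + 1))
      (hr.memLp l) (hr.memLp (l + 1))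
  have key : ∀ k ≤ 5, ∀ i ≤ 10, |∫ x, φ k x * V i x * r 6 x| ≤ B * (A + K) * ε :=
    fun k hk i hi => abs_integral_mul_mul_le_of_small (hb k hk) (hV.memLp i) (hr.memLp 6) hε
      (fun x => hφ.abs_le k x hk) (hA i hi) h
  have k1 := _root_.abs_le.1 (key 2 (by lia) 8 (by lia))
  have k2 := _root_.abs_le.1 (key 1 (by lia) 9 (by lia))
  have k3 := _root_.abs_le.1 (key 0 (by lia) 10 (by lia))
  have e1 := e 0 (by lia) 8 7
  have e2 := e 1 (by lia) 8 6
  have e3 := e 0 (by lia) 9 6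
  simp only [Nat.reduceAdd] at e1 e2 e3
  rw [_root_.abs_le]
  constructor <;> linarith [k1.1, k1.2, k2.1, k2.2, k3.1, k3.2]

section

variable {Q₀ Q₁ : MvPolynomial (Fin 3) ℝ} {s M : ℝ} {u : ℝ → ℝ → ℝ}

/-- The growth of an energy of a solution, given the energy inequality for its mollifications. -/
lemma IsSolution.energy_le (hQ₀ : ∀ α ∈ Q₀.support, 1 ≤ α.degree)
    (hQ₁ : ∀ α ∈ Q₁.support, 2 ≤ α.degree) (hs : 0 ≤ s) (hu : IsSolution Q₀ Q₁ s u)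
    (hM : ∀ t ∈ Icc 0 s, Controlled M (u t)) {φ : ℝ → ℝ} (hφ : BddCont φ) {k : ℕ} (hk : k ≤ 9)
    {K L : ℝ} (hK : 0 ≤ K) (hL : 0 ≤ L)
    (h : ∀ n : ℕ, ∀ t ∈ Ioo 0 s, 2 * (∫ x, φ x * mollTower n (u t) k x *
      mollTower n (u t) (k + 5) x) - 2 * (∫ x, φ x * mollTower n (u t) k x *
      DiffPoly.eval (mollTower n (u t)) (DiffPoly.D^[k] (nonlin Q₀ Q₁)) x) +
      2 * (∫ x, φ x * mollTower n (u t) k x * mollError Q₀ Q₁ n (u t) k x) ≤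
      K + L * (1 / ((n : ℝ) + 1))) :
    ∫ x, φ x * jet (u s) k x ^ 2 ≤ (∫ x, φ x * jet (u 0) k x ^ 2) + K * s := by
  have h0s : (0 : ℝ) ∈ Icc 0 s := left_mem_Icc.2 hs
  have hss : s ∈ Icc 0 s := right_mem_Icc.2 hs
  obtain ⟨Kr, -, hKr⟩ := Controlled.exists_mollError_bound hQ₀ hQ₁ M
  have hn : ∀ n : ℕ, ∫ x, φ x * mollTower n (u s) k x ^ 2 ≤
      (∫ x, φ x * mollTower n (u 0) k x ^ 2) + (K + L * (1 / ((n : ℝ) + 1))) * s := by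
    intro n
    obtain ⟨A, hA0, hA⟩ := Controlled.exists_mollTower_bound hQ₀ hQ₁ M n k
    obtain ⟨hφc, D, hD⟩ := hφ
    have hD0 : 0 ≤ D := (abs_nonneg _).trans (hD 0)
    obtain ⟨e1, e2⟩ := hasDerivAt_energy (f := fun t x => mollTower n (u t) k x)
      (f' := fun t x => mollTower n (u t) (k + 5) x - mollTower n (nonlinearity Q₀ Q₁ (u t)) k x)
      (W := fun _ x => φ x) (W' := fun _ _ => 0) (T := s) (A := A + D)
      (fun t ht x => hu.hasDerivWithinAt_mollTower hQ₀ hQ₁ hM n k ht x)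
      (fun t _ x => hasDerivWithinAt_const t _ (φ x))
      (fun t ht => ((hM t ht).wTower n).toL2Tower.continuous k) (fun t ht => (hA _ (hM t ht)).2.1)
      (fun _ _ => hφc) (fun _ _ => continuous_const)
      (fun t ht x => ((hA _ (hM t ht)).1 x).trans (by linarith))
      (fun t ht x => ((hA _ (hM t ht)).2.2 x).trans (by linarith))
      (fun _ _ x => (hD x).trans (by linarith)) (fun _ _ x => by rw [abs_zero]; linarith)
    -- Gronwall's inequality with rate zero: the assumed bound does not contain the energy, so the
    -- growth is linear in time.
    have h1 := le_exp_mul_of_hasDerivAt_le le_rfl (by positivity : 0 ≤ K + L * (1 / ((n : ℝ) + 1)))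
      e1 e2 (fun t ht => ?_) hss
    · simpa using h1
    · have hMt := hM t (Ioo_subset_Icc_self ht)
      have hV := (hMt.wTower n).toL2Tower
      have tN : L2Tower (fun k => DiffPoly.eval (mollTower n (u t))
          (DiffPoly.D^[k] (nonlin Q₀ Q₁))) := hV.eval_iterate fun p hp =>
        le_trans (by lia) (of_mem_nonlin hQ₀ hQ₁ hp).1
      have bφ : BddCont φ := ⟨hφc, D, hD⟩
      have i1 := bφ.integrable_mul_mul (hV.memLp k) (hV.memLp (k + 5))
      have i2 := bφ.integrable_mul_mul (hV.memLp k) (tN.memLp k)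
      have i3 := bφ.integrable_mul_mul (hV.memLp k) ((hKr _ hMt n).1.memLp k)
      have i12 : Integrable (fun x => 2 * (φ x * mollTower n (u t) k x *
          mollTower n (u t) (k + 5) x) - 2 * (φ x * mollTower n (u t) k x *
          DiffPoly.eval (mollTower n (u t)) (DiffPoly.D^[k] (nonlin Q₀ Q₁)) x)) :=
        (i1.const_mul 2).sub (i2.const_mul 2)
      have h2 := h n t ht
      rw [← integral_const_mul, ← integral_const_mul, ← integral_const_mul,
        ← integral_sub (i1.const_mul 2) (i2.const_mul 2),
        ← integral_add i12 (i3.const_mul 2)] at h2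
      rw [zero_mul, zero_add]
      refine le_of_eq_of_le ?_ h2
      congr 1; ext x
      rw [mollTower_sub_eq]; ring
  have hlim : ∀ t ∈ Icc 0 s, Tendsto (fun n => ∫ x, φ x * mollTower n (u t) k x ^ 2) atTop
      (𝓝 (∫ x, φ x * jet (u t) k x ^ 2)) := fun t ht =>
    tendsto_integral_mul_sq hφ ((hM t ht).memLp k (by lia))
      (fun n => ((hM t ht).wTower n).memLp k) (K := 4 * M) fun n =>
        ((hM t ht).integral_mollTower_sub_sq_le n hk).2.trans_eq (by ring)
  have hr : Tendsto (fun n : ℕ => (K + L * (1 / ((n : ℝ) + 1))) * s) atTop (𝓝 (K * s)) := by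
    have := ((tendsto_one_div_add_atTop_nhds_zero_nat (𝕜 := ℝ)).const_mul L).const_add K
    simpa using this.mul_const s
  exact le_of_tendsto_of_tendsto' (hlim s hss) ((hlim 0 h0s).add hr) hn

/-- The growth of the size of a solution. -/
theorem exists_growth_bound (hQ₀ : ∀ α ∈ Q₀.support, 1 ≤ α.degree)
    (hQ₁ : ∀ α ∈ Q₁.support, 2 ≤ α.degree) {m : ℝ} (hm : 0 ≤ m) : ∃ K : ℝ, 0 ≤ K ∧
      ∀ s, 0 ≤ s → ∀ u, IsSolution Q₀ Q₁ s u →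
      (∀ t ∈ Ioo 0 s, ∫ x, (bracket x ^ 2 * u t x) ^ 2 ≤ m ∧ ∫ x, jet (u t) 8 x ^ 2 ≤ m) →
      ∫ x, (bracket x ^ 2 * u s x) ^ 2 ≤ (∫ x, (bracket x ^ 2 * u 0 x) ^ 2) + K * s ∧
      ∫ x, jet (u s) 8 x ^ 2 ≤ 2 * (∫ x, jet (u 0) 8 x ^ 2) + K * s := by
  -- The weighted norm of a mollification exceeds that of the function by a factor of at most `9`.
  obtain ⟨C, hC, hdec⟩ := exists_decayBound (9 * m)
  have hP := fun (p : ℝ × List ℕ) (hp : p ∈ nonlin Q₀ Q₁) => of_mem_nonlin hQ₀ hQ₁ hp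
  obtain ⟨B, hB, hχ⟩ := exists_truncated_weight
  obtain ⟨K₁, hK₁⟩ := exists_weighted_energy_bound
    (fun p hp => ⟨(hP p hp).1, (hP p hp).2.2⟩) hC hB
  obtain ⟨B', c, φ, hφ⟩ := exists_smoothingWeight
  obtain ⟨K₂, hK₂⟩ := exists_top_energy_bound
    (fun p hp => ⟨(hP p hp).1, (hP p hp).2.1⟩) hC hφ
  refine ⟨|K₁| + |K₂|, by positivity, fun s hs u hu hsm => ?_⟩
  obtain ⟨M, hM⟩ := hu.1.exists_controlled
  have hM0 : 0 ≤ M := (hM 0 (left_mem_Icc.2 hs)).nonneg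
  obtain ⟨Kr, hKr0, hKr⟩ := Controlled.exists_mollError_bound hQ₀ hQ₁ M
  have hd : ∀ n, ∀ t ∈ Ioo 0 s, DecayBound C (mollTower n (u t)) := fun n t ht => by
    have hMt := hM t (Ioo_subset_Icc_self ht)
    refine hdec _ (hMt.wTower n) ((hMt.wInt_mollTower_le n).trans ?_)
      ((hMt.integral_mollTower_sq_le_jet n (by lia)).trans ((hsm t ht).2.trans (by linarith)))
    exact mul_le_mul_of_nonneg_left (hsm t ht).1 (by norm_num)
  have hsM := hM s (right_mem_Icc.2 hs)
  have h0M := hM 0 (left_mem_Icc.2 hs)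
  constructor
  · have hw0 : 0 ≤ ∫ x, (bracket x ^ 2 * u 0 x) ^ 2 := integral_nonneg fun _ => sq_nonneg _
    -- The square of `g n` is the truncated weight with `δ = 1/(n+1)`; it is bounded for each `n`
    -- and is removed at the end by Fatou's lemma.
    set g : ℕ → ℝ → ℝ := fun n x => (1 + x ^ 2) / (1 + 1 / ((n : ℝ) + 1) * (1 + x ^ 2)) with hg
    have hgb : ∀ n x, 0 ≤ g n x ∧ g n x ≤ bracket x ^ 2 := fun n x => by
      have h1 : (0 : ℝ) ≤ 1 + x ^ 2 := by positivity
      refine ⟨by positivity, ?_⟩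
      rw [bracket_sq]
      exact div_le_self h1 (le_add_of_nonneg_right (by positivity))
    have key : ∀ n : ℕ, MemLp (fun x => g n x * u s x) 2 volume ∧
        ∫ x, (g n x * u s x) ^ 2 ≤
          (∫ x, (bracket x ^ 2 * u 0 x) ^ 2) + (|K₁| + |K₂|) * s := by
      intro n
      obtain ⟨χ, tχ, hχ0, hχ1⟩ := hχ (1 / ((n : ℝ) + 1)) (by positivity)
      have hχg : ∀ x, χ 0 x = g n x ^ 2 := hχ0
      have hχb : ∀ x, |χ 0 x| ≤ brPow 4 x := fun x => by
        rw [hχg, abs_of_nonneg (sq_nonneg _)]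
        have e : brPow 4 x = (bracket x ^ 2) ^ 2 := by
          rw [← pow_mul, brPow, ← Real.rpow_natCast]; norm_num
        rw [e]
        exact pow_le_pow_left₀ (hgb n x).1 (hgb n x).2 2
      obtain ⟨hχc, D, hD⟩ := tχ.bddCont 0 (by lia)
      have hD0 : 0 ≤ D := (abs_nonneg _).trans (hD 0)
      have hE := hu.energy_le hQ₀ hQ₁ hs hM (k := 0) ⟨hχc, D, hD⟩ (by lia)
        (K := |K₁|) (L := 2 * (D * (M + Kr))) (abs_nonneg _) (by positivity) (fun l t ht => ?_)
      · have e1 : ∀ t, ∫ x, χ 0 x * jet (u t) 0 x ^ 2 = ∫ x, (g n x * u t x) ^ 2 := fun t => by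
          congr 1; ext x; rw [hχg]; simp only [jet]; ring
        rw [e1, e1] at hE
        have cg : Continuous (g n) := by
          refine Continuous.div (by fun_prop) (by fun_prop) fun x => ?_
          positivity
        refine ⟨hsM.memLp_weight.mono (cg.aestronglyMeasurable.mul (hsM.memLp 0 (by lia)).1)
          (Eventually.of_forall fun x => ?_), hE.trans (add_le_add ?_ ?_)⟩
        · simp only [norm_mul, Real.norm_eq_abs, abs_of_nonneg (hgb n x).1]
          rw [abs_of_nonneg (sq_nonneg (bracket x))]
          exact mul_le_mul_of_nonneg_right (hgb n x).2 (abs_nonneg _)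
        · refine integral_mono_of_nonneg (Eventually.of_forall fun _ => sq_nonneg _)
            h0M.memLp_weight.integrable_sq (Eventually.of_forall fun x => ?_)
          change (g n x * u 0 x) ^ 2 ≤ (bracket x ^ 2 * u 0 x) ^ 2
          rw [mul_pow, mul_pow]
          exact mul_le_mul_of_nonneg_right (pow_le_pow_left₀ (hgb n x).1 (hgb n x).2 2)
            (sq_nonneg _)
        · exact mul_le_mul_of_nonneg_right (le_add_of_nonneg_right (abs_nonneg _)) hs
      · have hMt := hM t (Ioo_subset_Icc_self ht)
        have hV := hMt.wTower l
        have h1 := hK₁ _ hV (hd l t ht) χ tχ hχb fun k x hk => by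
          refine (hχ1 k x hk).trans_eq ?_
          rw [brPow, ← Real.rpow_natCast]; norm_num
        have h2 := abs_integral_mul_mul_le_of_small ⟨hχc, D, hD⟩ (hV.memLp 0)
          ((hKr _ hMt l).1.memLp 0) (by positivity : 0 < 1 / ((l : ℝ) + 1)) hD
          (hMt.integral_mollTower_sq_le l (by lia)) ((hKr _ hMt l).2 0 (by lia))
        have h3 := le_abs_self K₁
        have h4 := (le_abs_self _).trans h2
        simp only [Function.iterate_zero, id_eq, zero_add]
        linarith
    refine (memLp_two_of_tendsto (by positivity) (fun n => (key n).1) (fun n => (key n).2)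
      (Eventually.of_forall fun x => ?_)).2
    refine Tendsto.mul_const _ ?_
    have h1 := ((tendsto_one_div_add_atTop_nhds_zero_nat (𝕜 := ℝ)).mul_const
      (1 + x ^ 2)).const_add 1
    have h2 : Tendsto (fun n => g n x) atTop (𝓝 ((1 + x ^ 2) / (1 + 0 * (1 + x ^ 2)))) :=
      tendsto_const_nhds.div h1 (by norm_num)
    rw [bracket_sq]
    simpa only [zero_mul, add_zero, div_one] using h2
  · have hE := hu.energy_le hQ₀ hQ₁ hs hM (k := 8) (hφ.tower.bddCont 0 (by lia)) (by lia)
      (K := |K₂|) (L := 8 * (B' * (M + Kr))) (abs_nonneg _)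
      (by have := hφ.nonneg; positivity) (fun l t ht => ?_)
    · have i1 := hsM.memLp 8 (by lia)
      have i2 := h0M.memLp 8 (by lia)
      have h1 : ∫ x, jet (u s) 8 x ^ 2 ≤ ∫ x, φ 0 x * jet (u s) 8 x ^ 2 :=
        integral_mono i1.integrable_sq ((hφ.tower.bddCont 0 (by lia)).integrable_mul_sq i1)
          fun x => le_mul_of_one_le_left (sq_nonneg _) (hφ.one_le x)
      have h2 : ∫ x, φ 0 x * jet (u 0) 8 x ^ 2 ≤ 2 * ∫ x, jet (u 0) 8 x ^ 2 := by
        rw [← integral_const_mul]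
        exact integral_mono ((hφ.tower.bddCont 0 (by lia)).integrable_mul_sq i2)
          (i2.integrable_sq.const_mul 2)
          fun x => mul_le_mul_of_nonneg_right (hφ.le_two x) (sq_nonneg _)
      have h3 : |K₂| * s ≤ (|K₁| + |K₂|) * s :=
        mul_le_mul_of_nonneg_right (le_add_of_nonneg_left (abs_nonneg _)) hs
      linarith
    · have hMt := hM t (Ioo_subset_Icc_self ht)
      have hV := hMt.wTower l
      have h1 := hK₂ _ hV (hd l t ht)
      have h2 := hφ.abs_integral_error_le_of_small hV.toL2Tower (hKr _ hMt l).1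
        (by positivity : 0 < 1 / ((l : ℝ) + 1)) (fun k hk => hMt.integral_mollTower_sq_le l hk)
        ((hKr _ hMt l).2 6 le_rfl)
      have h3 := le_abs_self K₂
      have h4 := (le_abs_self _).trans h2
      simp only [Nat.reduceAdd]
      linarith

end

lemma Controlled.mono {M M' : ℝ} {f : ℝ → ℝ} (h : M ≤ M') (hf : Controlled M f) :
    Controlled M' f :=
  ⟨hf.isWeakDeriv, hf.memLp, fun k hk => (hf.integral_le k hk).trans h, hf.memLp_weight,
    hf.weight_le.trans h⟩

/-- The size of a solution is controlled on a time interval depending on the initial size. -/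
theorem exists_local_bound {Q₀ Q₁ : MvPolynomial (Fin 3) ℝ}
    (hQ₀ : ∀ α ∈ Q₀.support, 1 ≤ α.degree) (hQ₁ : ∀ α ∈ Q₁.support, 2 ≤ α.degree) {q : ℝ}
    (hq : 0 ≤ q) : ∃ τ : ℝ, 0 < τ ∧ ∀ T, T ≤ τ → ∀ u, IsSolution Q₀ Q₁ T u →
      ∫ x, (bracket x ^ 2 * u 0 x) ^ 2 ≤ q → ∫ x, jet (u 0) 8 x ^ 2 ≤ q → ∀ t ∈ Icc 0 T,
        ∫ x, (bracket x ^ 2 * u t x) ^ 2 ≤ 2 * q + 1 ∧ ∫ x, jet (u t) 8 x ^ 2 ≤ 2 * q + 1 := by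
  obtain ⟨K, hK, hgrow⟩ := exists_growth_bound hQ₀ hQ₁ (by positivity : 0 ≤ 2 * q + 1)
  -- On this interval `K s < 1`, so that a solution bounded by `2q + 1` before time `s` is strictly
  -- below `2q + 1` at time `s`.
  refine ⟨1 / (K + 1), by positivity, fun T hT u hu h1 h2 t ht => ?_⟩
  set P : ℝ → ℝ := fun t => max (∫ x, (bracket x ^ 2 * u t x) ^ 2) (∫ x, jet (u t) 8 x ^ 2)
    with hP
  have cP : ContinuousOn P (Icc 0 T) :=
    hu.1.continuousOn_weight.sup (hu.1.continuousOn_jet (by lia))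
  rw [← max_le_iff]
  change P t ≤ 2 * q + 1
  by_contra hc
  -- Continuity argument: by compactness there is a first time at which the level `2q + 1` is
  -- reached, and the growth bound up to that time contradicts it.
  have hA : IsCompact (Icc 0 T ∩ P ⁻¹' Ici (2 * q + 1)) :=
    isCompact_Icc.of_isClosed_subset (cP.preimage_isClosed_of_isClosed isClosed_Icc isClosed_Ici)
      inter_subset_left
  obtain ⟨s, ⟨hs, hsP⟩, hmin⟩ := hA.exists_isLeast ⟨t, ht, (not_le.1 hc).le⟩
  obtain ⟨g1, g2⟩ := hgrow s hs.1 u (hu.mono hs.2) fun r hr => by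
    rw [← max_le_iff]
    by_contra hc'
    exact absurd (hmin ⟨⟨hr.1.le, hr.2.le.trans hs.2⟩, (not_le.1 hc').le⟩) (not_le.2 hr.2)
  have hKs : K * s < 1 := by
    have h3 : s ≤ 1 / (K + 1) := hs.2.trans hT
    rw [le_div_iff₀ (by positivity)] at h3
    rcases hs.1.eq_or_lt with h0 | h0
    · rw [← h0]; norm_num
    · linarith
  have : P s < 2 * q + 1 := max_lt (by linarith) (by linarith)
  exact absurd hsP (not_le.2 this)

/-! ### The rate of the exponential weight. -/

section Rate

variable {a₀ ε : ℝ}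

/-- The lower bound is the value at `ε = 0`, namely `3/2 + 5/4 = 11/4`. Divided by four it gives the
coefficient `11/16` of the energy estimate. -/
lemma kConst_ge (hε : 0 < ε) (hε1 : ε < 1) : 11 / 4 * (5 / 4) ^ 5 ≤ kConst ε := by
  have h1 : (5 : ℝ) / 4 ≤ 25 / (4 * (5 - ε)) := by
    rw [le_div_iff₀ (by linarith)]; linarith
  rw [kConst]
  have : (5 : ℝ) ^ 5 / 4 ^ 5 = (5 / 4) ^ 5 := by norm_num
  rw [this]
  have h2 : (0 : ℝ) ≤ (5 / 4) ^ 5 := by positivity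
  nlinarith

lemma one_le_rate (hε : 0 < ε) (hε1 : ε < 1) {t : ℝ} (ht : 0 ≤ t) :
    1 ≤ 1 + kConst ε * a₀ ^ 4 * t := by
  have : 0 ≤ kConst ε := le_trans (by positivity) (kConst_ge hε hε1)
  have : 0 ≤ kConst ε * a₀ ^ 4 * t := by positivity
  linarith

lemma aRate_pos (ha : 0 < a₀) (hε : 0 < ε) (hε1 : ε < 1) {t : ℝ} (ht : 0 ≤ t) :
    0 < aRate a₀ ε t :=
  div_pos ha (Real.rpow_pos_of_pos (zero_lt_one.trans_le (one_le_rate hε hε1 ht)) _)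

lemma aRate_anti (ha : 0 < a₀) (hε : 0 < ε) (hε1 : ε < 1) {s t : ℝ} (hs : 0 ≤ s) (hst : s ≤ t) :
    aRate a₀ ε t ≤ aRate a₀ ε s := by
  have h1 := one_le_rate (a₀ := a₀) hε hε1 hs
  have : 0 ≤ kConst ε := le_trans (by positivity) (kConst_ge hε hε1)
  have h2 : kConst ε * a₀ ^ 4 * s ≤ kConst ε * a₀ ^ 4 * t := by gcongr
  refine div_le_div_of_nonneg_left ha.le (Real.rpow_pos_of_pos (by linarith) _) ?_
  exact Real.rpow_le_rpow (by linarith) (by linarith) (by norm_num)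

lemma aRate_zero : aRate a₀ ε 0 = a₀ := by simp [aRate]

/-- The rate is the explicit solution of `a' = -(k/4) a⁵`, the equation which makes `a' p`
comparable with `-(a p')⁵`. -/
lemma hasDerivAt_aRate (hε : 0 < ε) (hε1 : ε < 1) {t : ℝ} (ht : 0 ≤ t) :
    HasDerivAt (aRate a₀ ε) (-(kConst ε / 4) * aRate a₀ ε t ^ 5) t := by
  have h1 := one_le_rate (a₀ := a₀) hε hε1 ht
  set D : ℝ := 1 + kConst ε * a₀ ^ 4 * t with hD
  have hD0 : 0 < D := by linarith
  have d1 : HasDerivAt (fun t => 1 + kConst ε * a₀ ^ 4 * t) (kConst ε * a₀ ^ 4) t := by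
    simpa using ((hasDerivAt_id t).const_mul (kConst ε * a₀ ^ 4)).const_add 1
  have d2 := (d1.rpow_const (p := -(1 / 4 : ℝ)) (Or.inl hD0.ne')).const_mul a₀
  have e : ∀ᶠ s in 𝓝 t, aRate a₀ ε s =
      a₀ * (1 + kConst ε * a₀ ^ 4 * s) ^ (-(1 / 4 : ℝ)) := by
    have : ∀ᶠ s in 𝓝 t, 0 < 1 + kConst ε * a₀ ^ 4 * s :=
      continuousAt_const.eventually_lt d1.continuousAt hD0
    filter_upwards [this] with s hs
    rw [Real.rpow_neg hs.le, aRate, div_eq_mul_inv]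
  refine (d2.congr_of_eventuallyEq e).congr_deriv ?_
  have e1 : aRate a₀ ε t = a₀ * D ^ (-(1 / 4 : ℝ)) := e.self_of_nhds
  have e2 : (D ^ (-(1 / 4 : ℝ))) ^ 5 = D ^ (-(1 / 4 : ℝ) - 1) := by
    rw [← Real.rpow_natCast, ← Real.rpow_mul hD0.le]; norm_num
  rw [e1, mul_pow, e2, ← hD]
  ring

end Rate

/-! ### Propagation of the exponential weight. -/

section

variable {Q₀ Q₁ : MvPolynomial (Fin 3) ℝ} {T : ℝ}

/-- Propagation of the exponentially weighted norm for the truncated weights. -/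
theorem exists_truncated_exponential_bound (hQ₀ : ∀ α ∈ Q₀.support, 1 ≤ α.degree)
    (hQ₁ : ∀ α ∈ Q₁.support, 2 ≤ α.degree) {m a₀ ε : ℝ} (hm : 0 ≤ m) (ha₀ : 0 < a₀)
    (hε : 0 < ε) (hε1 : ε < 1) (hT : 0 < T) : ∃ K : ℝ, 0 ≤ K ∧ ∀ u u' : ℝ → ℝ → ℝ,
      IsSolution Q₀ Q₁ T u → IsSolution Q₀ Q₁ T u' →
      (∀ t ∈ Icc 0 T, ∫ x, (bracket x ^ 2 * u t x) ^ 2 ≤ m ∧ ∫ x, jet (u t) 8 x ^ 2 ≤ m) →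
      (∀ t ∈ Icc 0 T, ∫ x, (bracket x ^ 2 * u' t x) ^ 2 ≤ m ∧ ∫ x, jet (u' t) 8 x ^ 2 ≤ m) →
      ∀ δ : ℝ, 0 < δ → δ ≤ 1 → ∀ t ∈ Icc 0 T,
        ∫ x, Real.exp (aRate a₀ ε t * pW δ x) * (u t x - u' t x) ^ 2 ≤
          Real.exp (K * t) * ((∫ x, Real.exp (a₀ * pW δ x) * (u 0 x - u' 0 x) ^ 2) + K * t) := by
  obtain ⟨C, hC, hdec⟩ := exists_decayBound (9 * m)
  -- Since `a` decreases, its values on `[0,T]` lie between `a(T) > 0` and `a₀`; the constant thus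
  -- depends on `a₀`, `ε`, `T` and not on the time.
  obtain ⟨K, hK, hexp⟩ := exists_exponential_energy_bound
    (L₀ := ofMvPoly Q₀) (L₁ := ofMvPoly Q₁) (fun p hp => of_mem_ofMvPoly hQ₀ hp)
    (fun p hp => of_mem_ofMvPoly hQ₁ hp) hC (a₁ := aRate a₀ ε T) (a₀ := a₀)
    (aRate_pos ha₀ hε hε1 hT.le)
  refine ⟨K, hK, fun u u' hu hu' hum hum' δ hδ hδ1 t ht => ?_⟩
  obtain ⟨M₁, hM₁⟩ := hu.1.exists_controlled
  obtain ⟨M₂, hM₂⟩ := hu'.1.exists_controlled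
  set M := max M₁ M₂ with hMdef
  have hM : ∀ t ∈ Icc 0 T, Controlled M (u t) := fun t ht => (hM₁ t ht).mono (le_max_left _ _)
  have hM' : ∀ t ∈ Icc 0 T, Controlled M (u' t) := fun t ht => (hM₂ t ht).mono (le_max_right _ _)
  -- The constants `Kr` and `D` depend on the solutions and on `δ`, but they occur only in front of
  -- `1/(n+1)²` and disappear in the limit.
  obtain ⟨Kr, hKr0, hKr⟩ := Controlled.exists_mollError_bound hQ₀ hQ₁ M
  have hd : ∀ {v : ℝ → ℝ → ℝ}, (∀ t ∈ Icc 0 T, Controlled M (v t)) →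
      (∀ t ∈ Icc 0 T, ∫ x, (bracket x ^ 2 * v t x) ^ 2 ≤ m ∧ ∫ x, jet (v t) 8 x ^ 2 ≤ m) →
      ∀ n, ∀ t ∈ Icc 0 T, DecayBound C (mollTower n (v t)) := fun hv hvm n t ht =>
    hdec _ ((hv t ht).wTower n) (((hv t ht).wInt_mollTower_le n).trans
      (mul_le_mul_of_nonneg_left (hvm t ht).1 (by norm_num)))
      (((hv t ht).integral_mollTower_sq_le_jet n (by lia)).trans ((hvm t ht).2.trans (by linarith)))
  set a : ℝ → ℝ := aRate a₀ ε with hadef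
  set κ : ℝ := kConst ε / 4 with hκdef
  have hκ : 11 / 16 * (5 / 4) ^ 5 ≤ κ := by
    have := kConst_ge hε hε1
    rw [hκdef]; linarith
  have hκ0 : 0 ≤ κ := le_trans (by positivity) hκ
  have ha : ∀ t ∈ Icc 0 T, 0 < a t ∧ aRate a₀ ε T ≤ a t ∧ a t ≤ a₀ := fun t ht =>
    ⟨aRate_pos ha₀ hε hε1 ht.1, aRate_anti ha₀ hε hε1 ht.1 ht.2,
      (aRate_anti ha₀ hε hε1 le_rfl ht.1).trans_eq aRate_zero⟩
  set D : ℝ := Real.exp (a₀ * (10 / δ)) with hD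
  have hD0 : 0 < D := Real.exp_pos _
  have hφD : ∀ t ∈ Icc 0 T, ∀ x, Real.exp (a t * pW δ x) ≤ D := fun t ht x => by
    rw [hD, Real.exp_le_exp]
    exact mul_le_mul (ha t ht).2.2 (pW_le_const hδ x) (pW_nonneg hδ x) ha₀.le
  have cφ : ∀ c : ℝ, Continuous (fun x => Real.exp (c * pW δ x)) := fun c =>
    (bddCont_exp_pW hδ c).1
  have hn : ∀ n : ℕ, ∫ x, Real.exp (a t * pW δ x) *
      (mollTower n (u t) 0 x - mollTower n (u' t) 0 x) ^ 2 ≤ Real.exp (K * t) *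
      ((∫ x, Real.exp (a 0 * pW δ x) * (mollTower n (u 0) 0 x - mollTower n (u' 0) 0 x) ^ 2) +
        (K + 4 * D * Kr * (1 / ((n : ℝ) + 1)) ^ 2) * t) := by
    intro n
    obtain ⟨A, hA0, hA⟩ := Controlled.exists_mollTower_bound hQ₀ hQ₁ M n 0
    have hfA : 0 ≤ κ * a₀ ^ 5 * (10 / δ) * D := by positivity
    obtain ⟨e1, e2⟩ := hasDerivAt_energy
      (f := fun t x => mollTower n (u t) 0 x - mollTower n (u' t) 0 x)
      (f' := fun t x => (mollTower n (u t) (0 + 5) x -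
        mollTower n (nonlinearity Q₀ Q₁ (u t)) 0 x) - (mollTower n (u' t) (0 + 5) x -
        mollTower n (nonlinearity Q₀ Q₁ (u' t)) 0 x))
      (W := fun t x => Real.exp (a t * pW δ x))
      (W' := fun t x => -κ * a t ^ 5 * (pW δ x * Real.exp (a t * pW δ x)))
      (T := T) (A := 2 * A + D + κ * a₀ ^ 5 * (10 / δ) * D)
      (fun t ht x => (hu.hasDerivWithinAt_mollTower hQ₀ hQ₁ hM n 0 ht x).fun_sub
        (hu'.hasDerivWithinAt_mollTower hQ₀ hQ₁ hM' n 0 ht x))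
      (fun t ht x => ((((hasDerivAt_aRate hε hε1 ht.1).mul_const (pW δ x)).exp).congr_deriv
        (by simp only [hadef, hκdef]; ring)).hasDerivWithinAt)
      (fun t ht => (((hM t ht).wTower n).toL2Tower.continuous 0).sub
        (((hM' t ht).wTower n).toL2Tower.continuous 0))
      (fun t ht => (hA _ (hM t ht)).2.1.sub (hA _ (hM' t ht)).2.1)
      (fun t _ => cφ (a t))
      (fun t _ => continuous_const.mul ((bddCont_pW hδ).1.mul (cφ (a t))))
      (fun t ht x => by
        have h1 := (hA _ (hM t ht)).1 x
        have h2 := (hA _ (hM' t ht)).1 x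
        have h3 := mul_le_mul_of_nonneg_left
          (abs_sub (mollTower n (u t) 0 x) (mollTower n (u' t) 0 x)) (sq_nonneg (bracket x))
        linarith)
      (fun t ht x => by
        have h1 := (hA _ (hM t ht)).2.2 x
        have h2 := (hA _ (hM' t ht)).2.2 x
        refine (abs_sub _ _).trans ?_
        linarith)
      (fun t ht x => by
        rw [abs_of_pos (Real.exp_pos _)]
        have := hφD t ht x
        linarith)
      (fun t ht x => by
        have h1 : a t ^ 5 ≤ a₀ ^ 5 := pow_le_pow_left₀ (ha t ht).1.le (ha t ht).2.2 5
        have h2 := pW_nonneg hδ x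
        have h3 := (ha t ht).1
        have h4 : κ * a t ^ 5 * (pW δ x * Real.exp (a t * pW δ x)) ≤
            κ * a₀ ^ 5 * ((10 / δ) * D) := by
          have := hφD t ht x
          have := pW_le_const hδ x
          gcongr
        have h5 : 0 ≤ κ * a t ^ 5 * (pW δ x * Real.exp (a t * pW δ x)) := by positivity
        rw [neg_mul, neg_mul, abs_neg, abs_of_nonneg h5]
        linarith)
    refine le_exp_mul_of_hasDerivAt_le hK (by positivity) e1 e2 (fun t ht => ?_) ht
    have ht' := Ioo_subset_Icc_self ht
    have hMt := hM t ht'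
    have hMt' := hM' t ht'
    have hV := hMt.wTower n
    have hV' := hMt'.wTower n
    have tr := (hKr _ hMt n).1.sub (hKr _ hMt' n).1
    have hmain := hexp δ hδ hδ1 (a t) (-κ * a t ^ 5) (ha t ht').2.1 (ha t ht').2.2
      (by
        have := mul_le_mul_of_nonneg_right hκ (pow_pos (ha t ht').1 5).le
        linarith) _ _ hV hV' (hd hM hum n t ht') (hd hM' hum' n t ht') _ (tr.memLp 0)
    have hr : ∫ x, Real.exp (a t * pW δ x) * (mollError Q₀ Q₁ n (u t) 0 x -
        mollError Q₀ Q₁ n (u' t) 0 x) ^ 2 ≤ 4 * D * Kr * (1 / ((n : ℝ) + 1)) ^ 2 := by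
      have h1 := (hKr _ hMt n).2 0 (by lia)
      have h2 := (hKr _ hMt' n).2 0 (by lia)
      have h3 := integral_add_sq_le ((hKr _ hMt n).1.memLp 0) ((hKr _ hMt' n).1.memLp 0).neg
      simp only [Pi.neg_apply, neg_sq, ← sub_eq_add_neg] at h3
      calc _ ≤ ∫ x, D * (mollError Q₀ Q₁ n (u t) 0 x - mollError Q₀ Q₁ n (u' t) 0 x) ^ 2 :=
            integral_mono ((bddCont_exp_pW hδ (a t)).integrable_mul_sq (tr.memLp 0))
              ((tr.integrable_sq 0).const_mul D)
              fun x => mul_le_mul_of_nonneg_right (hφD t ht' x) (sq_nonneg _)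
        _ ≤ D * (4 * (Kr * (1 / ((n : ℝ) + 1)) ^ 2)) := by
            rw [integral_const_mul]
            exact mul_le_mul_of_nonneg_left (h3.trans (by linarith)) hD0.le
        _ = _ := by ring
    have bφ := bddCont_exp_pW hδ (a t)
    have eN : ∀ f : ℝ → ℝ, ∀ x, DiffPoly.eval (mollTower n f) (nonlin Q₀ Q₁) x =
        DiffPoly.eval (mollTower n f) (ofMvPoly Q₀) x * mollTower n f 3 x +
          DiffPoly.eval (mollTower n f) (ofMvPoly Q₁) x := fun f x => by
      rw [nonlin, DiffPoly.eval_append, eval_map_cons]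
    have mN : ∀ f, WTower (mollTower n f) →
        MemLp (DiffPoly.eval (mollTower n f) (nonlin Q₀ Q₁)) 2 volume := fun f hf =>
      hf.toL2Tower.memLp_eval fun p hp => le_trans (by lia) (of_mem_nonlin hQ₀ hQ₁ hp).1
    have tw := hV.toL2Tower.sub hV'.toL2Tower
    have i1 : Integrable (fun x => pW δ x * Real.exp (a t * pW δ x) *
        (mollTower n (u t) 0 x - mollTower n (u' t) 0 x) ^ 2) :=
      ((bddCont_pW hδ).mul bφ).integrable_mul_sq (tw.memLp 0)
    have mR : MemLp (fun x => (mollTower n (u t) 5 x - mollTower n (u' t) 5 x) -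
        (DiffPoly.eval (mollTower n (u t)) (nonlin Q₀ Q₁) x -
          DiffPoly.eval (mollTower n (u' t)) (nonlin Q₀ Q₁) x) +
        (mollError Q₀ Q₁ n (u t) 0 x - mollError Q₀ Q₁ n (u' t) 0 x)) 2 volume :=
      ((tw.memLp 5).sub ((mN _ hV).sub (mN _ hV'))).add (tr.memLp 0)
    have i2 := bφ.integrable_mul_mul (tw.memLp 0) mR
    simp only [← eN] at hmain
    rw [← integral_const_mul, ← integral_const_mul,
      ← integral_add (i1.const_mul _) (i2.const_mul 2)] at hmain
    refine le_trans (le_of_eq ?_) (hmain.trans (by linarith))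
    congr 1; ext x
    rw [mollTower_sub_eq, mollTower_sub_eq]
    simp only [Function.iterate_zero, id_eq, zero_add]
    ring
  have hlim : ∀ t ∈ Icc 0 T, ∀ c : ℝ, Tendsto (fun n => ∫ x, Real.exp (c * pW δ x) *
      (mollTower n (u t) 0 x - mollTower n (u' t) 0 x) ^ 2) atTop
      (𝓝 (∫ x, Real.exp (c * pW δ x) * (u t x - u' t x) ^ 2)) := fun t ht c => by
    refine tendsto_integral_mul_sq (bddCont_exp_pW hδ c)
      (((hM t ht).memLp 0 (by lia)).sub ((hM' t ht).memLp 0 (by lia)))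
      (fun n => (((hM t ht).wTower n).memLp 0).sub (((hM' t ht).wTower n).memLp 0))
      (K := 16 * M) fun n => ?_
    obtain ⟨h1, h2⟩ := (hM t ht).integral_mollTower_sub_sq_le n (k := 0) (by lia)
    obtain ⟨h3, h4⟩ := (hM' t ht).integral_mollTower_sub_sq_le n (k := 0) (by lia)
    have h5 := integral_add_sq_le h1 h3.neg
    simp only [Pi.neg_apply, neg_sq, ← sub_eq_add_neg, jet] at h5 h2 h4
    refine le_trans (le_of_eq ?_) (h5.trans (by linarith))
    congr 1; ext x
    simp only [Pi.sub_apply, jet]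
    ring
  have hr : Tendsto (fun n : ℕ => (K + 4 * D * Kr * (1 / ((n : ℝ) + 1)) ^ 2) * t) atTop
      (𝓝 (K * t)) := by
    have := (((tendsto_one_div_add_atTop_nhds_zero_nat (𝕜 := ℝ)).pow 2).const_mul
      (4 * D * Kr)).const_add K
    simpa using this.mul_const t
  have h0 : a 0 = a₀ := aRate_zero
  rw [h0] at hn
  exact le_of_tendsto_of_tendsto' (hlim t ht _)
    (((hlim 0 (left_mem_Icc.2 hT.le) a₀).add hr).const_mul _) hn

/-- Propagation of the exponentially weighted norm. -/
theorem exists_expWeighted_bound (hQ₀ : ∀ α ∈ Q₀.support, 1 ≤ α.degree)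
    (hQ₁ : ∀ α ∈ Q₁.support, 2 ≤ α.degree) {m a₀ ε : ℝ} (hm : 0 ≤ m) (ha₀ : 0 < a₀)
    (hε : 0 < ε) (hε1 : ε < 1) (hT : 0 < T) (Λ : ℝ≥0) : ∃ c : ℝ≥0, ∀ u u' : ℝ → ℝ → ℝ,
      IsSolution Q₀ Q₁ T u → IsSolution Q₀ Q₁ T u' →
      (∀ t ∈ Icc 0 T, ∫ x, (bracket x ^ 2 * u t x) ^ 2 ≤ m ∧ ∫ x, jet (u t) 8 x ^ 2 ≤ m) →
      (∀ t ∈ Icc 0 T, ∫ x, (bracket x ^ 2 * u' t x) ^ 2 ≤ m ∧ ∫ x, jet (u' t) 8 x ^ 2 ≤ m) →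
      expWeighted a₀ (fun x => u 0 x - u' 0 x) ≤ Λ →
      ∀ t ∈ Icc 0 T, expWeighted (aRate a₀ ε t) (fun x => u t x - u' t x) ≤ c := by
  obtain ⟨K, hK, h⟩ := exists_truncated_exponential_bound hQ₀ hQ₁ hm ha₀ hε hε1 hT
  -- The factor `exp a₀` is the price for replacing `x₊^{5/4}` by the smooth `yW ≤ x₊^{5/4} + 1` at
  -- the initial time; at later times `x₊^{5/4} ≤ yW` goes the right way.
  set c : ℝ := Real.exp (K * T) * (Real.exp a₀ * Λ + K * T) with hc
  have hc0 : 0 ≤ c := by positivity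
  refine ⟨c.toNNReal, fun u u' hu hu' hum hum' hΛ t ht => ?_⟩
  have hw : ∀ t ∈ Icc 0 T, MemLp (fun x => u t x - u' t x) 2 volume := fun t ht =>
    ((hu.1.1 t ht).1.isWeakDeriv_jet (k := 0) (by lia)).2.sub
      ((hu'.1.1 t ht).1.isWeakDeriv_jet (k := 0) (by lia)).2
  have h0 : ∀ δ : ℝ, 0 < δ →
      ∫ x, Real.exp (a₀ * pW δ x) * (u 0 x - u' 0 x) ^ 2 ≤ Real.exp a₀ * Λ := by
    intro δ hδ
    have hw0 := hw 0 (left_mem_Icc.2 hT.le)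
    rw [← ENNReal.ofReal_le_ofReal_iff (by positivity), ofReal_integral_eq_lintegral_ofReal
      ((bddCont_exp_pW hδ a₀).integrable_mul_sq hw0)
      (Eventually.of_forall fun x => mul_nonneg (Real.exp_pos _).le (sq_nonneg _))]
    calc _ ≤ ∫⁻ x, ENNReal.ofReal (Real.exp a₀) * ENNReal.ofReal
          (Real.exp (a₀ * (max x 0) ^ (5 / 4 : ℝ)) * |u 0 x - u' 0 x| ^ 2) := by
          refine lintegral_mono fun x => ?_
          rw [← ENNReal.ofReal_mul (Real.exp_pos _).le, sq_abs, ← mul_assoc, ← Real.exp_add]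
          refine ENNReal.ofReal_le_ofReal (mul_le_mul_of_nonneg_right ?_ (sq_nonneg _))
          rw [Real.exp_le_exp]
          have h1 := (pW_le_yW hδ x).trans (yW_le x)
          nlinarith
      _ = ENNReal.ofReal (Real.exp a₀) * expWeighted a₀ (fun x => u 0 x - u' 0 x) :=
          lintegral_const_mul' _ _ ENNReal.ofReal_ne_top
      _ ≤ ENNReal.ofReal (Real.exp a₀) * Λ := by gcongr
      _ = _ := by
          rw [ENNReal.ofReal_mul (Real.exp_pos _).le, ENNReal.ofReal_coe_nnreal]
  have hat := aRate_pos ha₀ hε hε1 ht.1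
  set a := aRate a₀ ε t with hadef
  have hδ : ∀ n : ℕ, 0 < 1 / ((n : ℝ) + 1) ∧ 1 / ((n : ℝ) + 1) ≤ 1 := fun n => by
    refine ⟨by positivity, ?_⟩
    rw [div_le_one (by positivity)]
    linarith [(Nat.cast_nonneg n : (0 : ℝ) ≤ n)]
  set F : ℕ → ℝ → ℝ := fun n x =>
    Real.exp (a / 2 * pW (1 / ((n : ℝ) + 1)) x) * (u t x - u' t x) with hF
  have hF2 : ∀ n x, F n x ^ 2 =
      Real.exp (a * pW (1 / ((n : ℝ) + 1)) x) * (u t x - u' t x) ^ 2 := fun n x => by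
    simp only [hF]
    rw [mul_pow, ← Real.exp_nat_mul]
    congr 2
    push_cast; ring
  have hFm : ∀ n, MemLp (F n) 2 volume := fun n =>
    (bddCont_exp_pW (hδ n).1 (a / 2)).memLp_mul (hw t ht)
  have hFc : ∀ n, ∫ x, F n x ^ 2 ≤ c := fun n => by
    simp only [hF2]
    refine (h u u' hu hu' hum hum' _ (hδ n).1 (hδ n).2 t ht).trans ?_
    have h1 := h0 _ (hδ n).1
    have h2 := ht.2
    have h3 : 0 ≤ ∫ x, Real.exp (a₀ * pW (1 / ((n : ℝ) + 1)) x) * (u 0 x - u' 0 x) ^ 2 :=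
      integral_nonneg fun x => mul_nonneg (Real.exp_pos _).le (sq_nonneg _)
    have h4 : 0 ≤ K * t := mul_nonneg hK ht.1
    rw [hc]
    gcongr
  -- The truncation is removed along `δ = 1/(n+1)` by Fatou's lemma, applied to the square roots of
  -- the weighted densities; finiteness of the limit is part of the conclusion.
  obtain ⟨g1, g2⟩ := memLp_two_of_tendsto (f := fun x => Real.exp (a / 2 * yW x) *
    (u t x - u' t x)) hc0 hFm hFc (Eventually.of_forall fun x => by
      refine Tendsto.mul_const _ ((Real.continuous_exp.tendsto _).comp (Tendsto.const_mul _ ?_))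
      exact (tendsto_pW x).comp (tendsto_nhdsWithin_iff.2
        ⟨tendsto_one_div_add_atTop_nhds_zero_nat, Eventually.of_forall fun n => (hδ n).1⟩))
  calc expWeighted a (fun x => u t x - u' t x) ≤
        ∫⁻ x, ‖Real.exp (a / 2 * yW x) * (u t x - u' t x)‖ₑ ^ 2 := by
        refine lintegral_mono fun x => ?_
        rw [Real.enorm_eq_ofReal_abs, ← ENNReal.ofReal_pow (abs_nonneg _), sq_abs, sq_abs,
          mul_pow, ← Real.exp_nat_mul]
        refine ENNReal.ofReal_le_ofReal (mul_le_mul_of_nonneg_right ?_ (sq_nonneg _))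
        rw [Real.exp_le_exp]
        have := mul_le_mul_of_nonneg_left (max_rpow_le_yW x) hat.le
        push_cast
        linarith
    _ ≤ ENNReal.ofReal c := by
        rw [lintegral_enorm_sq g1]
        exact ENNReal.ofReal_le_ofReal g2

end

end FifthOrder

end

theorem theorem4 (Q₀ Q₁ : MvPolynomial (Fin 3) ℝ)
    (hQ₀ : ∀ α ∈ Q₀.support, 1 ≤ α.degree) (hQ₁ : ∀ α ∈ Q₁.support, 2 ≤ α.degree) :
    -- on the local existence time, which depends only on the size of the data,
    -- the bound depends on the data only through their size and `Λ`
    (∃ τ : ℝ≥0 → ℝ, (∀ R, 0 < τ R) ∧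
      ∀ a₀ : ℝ, 0 < a₀ → ∀ ε : ℝ, 0 < ε → ε < 1 → ∀ R Λ : ℝ≥0, ∀ T : ℝ, 0 < T → T ≤ τ R →
        ∃ c : ℝ≥0, ∀ u₁ u₂ : ℝ → ℝ → ℝ,
          FifthOrder.IsSolution Q₀ Q₁ T u₁ → FifthOrder.IsSolution Q₀ Q₁ T u₂ →
          FifthOrder.pairSize (u₁ 0) (u₂ 0) ≤ R →
          FifthOrder.expWeighted a₀ (fun x => u₁ 0 x - u₂ 0 x) ≤ Λ →
          ⨆ t ∈ Icc 0 T,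
            FifthOrder.expWeighted (FifthOrder.aRate a₀ ε t) (fun x => u₁ t x - u₂ t x) ≤ c) ∧
    -- on an arbitrary interval `[0,T]` on which the solutions exist,
    -- the bound depends on the size of the solutions on that interval
    (∀ a₀ : ℝ, 0 < a₀ → ∀ ε : ℝ, 0 < ε → ε < 1 → ∀ B Λ : ℝ≥0, ∀ T : ℝ, 0 < T →
        ∃ c : ℝ≥0, ∀ u₁ u₂ : ℝ → ℝ → ℝ,
          FifthOrder.IsSolution Q₀ Q₁ T u₁ → FifthOrder.IsSolution Q₀ Q₁ T u₂ →
          (∀ t ∈ Icc 0 T, FifthOrder.pairSize (u₁ t) (u₂ t) ≤ B) →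
          FifthOrder.expWeighted a₀ (fun x => u₁ 0 x - u₂ 0 x) ≤ Λ →
          ⨆ t ∈ Icc 0 T,
            FifthOrder.expWeighted (FifthOrder.aRate a₀ ε t) (fun x => u₁ t x - u₂ t x) ≤ c) := by
  -- The two parts differ only in the origin of the bound `m` for `∫ ⟨x⟩⁴u²` and `∫ (∂⁸u)²` on the
  -- whole interval: by `exists_local_bound` it is `2q + 1` with `q = 4R²` in the first, while it is
  -- `4B²` directly in the second.
  constructor
  · choose τ hτ0 hτ using fun R : ℝ≥0 =>
      FifthOrder.exists_local_bound hQ₀ hQ₁ (q := 4 * (R : ℝ) ^ 2) (by positivity)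
    refine ⟨τ, hτ0, fun a₀ ha₀ ε hε hε1 R Λ T hT hTτ => ?_⟩
    obtain ⟨c, hc⟩ := FifthOrder.exists_expWeighted_bound hQ₀ hQ₁
      (m := 2 * (4 * (R : ℝ) ^ 2) + 1) (by positivity) ha₀ hε hε1 hT Λ
    refine ⟨c, fun u₁ u₂ h₁ h₂ hR hΛ => iSup₂_le ?_⟩
    have h0 : (0 : ℝ) ∈ Icc 0 T := left_mem_Icc.2 hT.le
    obtain ⟨p₁, q₁⟩ := (h₁.1.1 0 h0).integral_le (le_self_add.trans hR)
    obtain ⟨p₂, q₂⟩ := (h₂.1.1 0 h0).integral_le (le_add_self.trans hR)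
    exact hc u₁ u₂ h₁ h₂ (hτ R T hTτ u₁ h₁ p₁ q₁) (hτ R T hTτ u₂ h₂ p₂ q₂) hΛ
  · intro a₀ ha₀ ε hε hε1 B Λ T hT
    obtain ⟨c, hc⟩ := FifthOrder.exists_expWeighted_bound hQ₀ hQ₁
      (m := 4 * (B : ℝ) ^ 2) (by positivity) ha₀ hε hε1 hT Λ
    exact ⟨c, fun u₁ u₂ h₁ h₂ hB hΛ => iSup₂_le (hc u₁ u₂ h₁ h₂
      (fun t ht => (h₁.1.1 t ht).integral_le (le_self_add.trans (hB t ht)))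
      (fun t ht => (h₂.1.1 t ht).integral_le (le_add_self.trans (hB t ht))) hΛ)⟩
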